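/- Let $A$ be a unital simple $C^*$-algebra (no separability or amenability is assumed) that belongs to the class $\mathcal C_1$ defined below. Then $A$ has stable rank one, i.e. the invertible elements of $A$ are norm dense in $A$. Definitions. For $a,b\in A_+$ write $a\lesssim b$ if there is a sequence $(x_n)$ in $A$ with $\lim_{n\to\infty}\|x_n^*bx_n-a\|=0$. For an integer $d\ge 0$, let $\mathcal I_d$ be the class of all $C^*$-algebras of the form $PM_r(C(X))P$, where $r\ge 1$ is an integer, $X$ is a nonempty compact subset of a finite CW complex $Y$ of covering dimension at most $d$, and $P=Q|_X$ for some projection $Q\in M_r(C(Y))$ (equivalently, the nonzero algebras in $\mathcal I_d$ are the nonzero quotients of the algebras $QM_r(C(Y))Q$). A unital simple $C^*$-algebra $A$ is in $\mathcal C_1$ if for every finite subset $\mathcal F\subset A$, all $\varepsilon>0$ and $\eta>0$, and every nonzero $a\in A_+$ there are a projection $p\in A$, an integer $d\ge 0$ and a $C^*$-subalgebra $C\subset A$ with unit $1_C=p$, isomorphic to an algebra $PM_r(C(X))P\in\mathcal I_d$ as above, such that $$\|pb-bp\|<\varepsilon\ \text{ and }\ \operatorname{dist}(pbp,C)<\varepsilon\quad\text{for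 all } b\in\mathcal F,$$ $$\operatorname{rank}P(x)>0\ \text{ and }\ \frac{d+1}{\operatorname{rank}P(x)}<\frac{\eta}{2}\quad\text{for all } x\in X,\qquad\text{and}\qquad 1-p\lesssim a.$$ -/

import Mathlib

open Filter Topology

noncomputable section

namespace TracialAH

/-- The (Lebesgue) covering dimension of `Y` is at most `k`: every finite open cover has an open
refinement such that every point lies in at most `k + 1` of its members. -/
def CoveringDimLE (Y : Type*) [TopologicalSpace Y] (k : ℕ) : Prop :=
  ∀ 𝒰 : Set (Set Y), 𝒰.Finite → (∀ U ∈ 𝒰, IsOpen U) → ⋃₀ 𝒰 = Set.univ →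
    ∃ 𝒱 : Set (Set Y), (∀ V ∈ 𝒱, IsOpen V) ∧ ⋃₀ 𝒱 = Set.univ ∧
      (∀ V ∈ 𝒱, ∃ U ∈ 𝒰, V ⊆ U) ∧ ∀ y : Y, {V ∈ 𝒱 | y ∈ V}.encard ≤ (k : ℕ∞) + 1

/-- `Y` admits the structure of a finite CW complex (Hausdorffness is assumed separately). -/
def IsFiniteCWComplex (Y : Type*) [TopologicalSpace Y] : Prop :=
  ∃ _ : CWComplex (Set.univ : Set Y), RelCWComplex.Finite (Set.univ : Set Y)

/-- The corner `P M P` cut out by a projection `P` of a star algebra `M`. -/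
def corner {M : Type*} [Ring M] [StarRing M] [Algebra ℂ M] [StarModule ℂ M] (P : M)
    (hP : IsStarProjection P) : NonUnitalStarSubalgebra ℂ M where
  carrier := {a | P * a = a ∧ a * P = a}
  zero_mem' := by simp
  add_mem' := by
    rintro a b ⟨ha, ha'⟩ ⟨hb, hb'⟩
    exact ⟨by rw [mul_add, ha, hb], by rw [add_mul, ha', hb']⟩
  mul_mem' := by
    rintro a b ⟨ha, _⟩ ⟨_, hb'⟩
    exact ⟨by rw [← mul_assoc, ha], by rw [mul_assoc, hb']⟩
  smul_mem' := by
    rintro c a ⟨ha, ha'⟩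
    exact ⟨by rw [mul_smul_comm, ha], by rw [smul_mul_assoc, ha']⟩
  star_mem' := by
    rintro a ⟨ha, ha'⟩
    have h : star P = P := hP.isSelfAdjoint
    refine ⟨?_, ?_⟩
    · have := congrArg star ha'
      rwa [star_mul, h] at this
    · have := congrArg star ha
      rwa [star_mul, h] at this

/-- The corner really is `{P m P : m ∈ M}`. -/
theorem mem_corner_iff {M : Type*} [Ring M] [StarRing M] [Algebra ℂ M] [StarModule ℂ M] {P : M}
    (hP : IsStarProjection P) {a : M} : a ∈ corner P hP ↔ ∃ m : M, a = P * m * P := by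
  have h : P * P = P := hP.isIdempotentElem
  constructor
  · rintro ⟨ha, ha'⟩
    exact ⟨a, by rw [ha, ha']⟩
  · rintro ⟨m, rfl⟩
    exact ⟨by rw [← mul_assoc, ← mul_assoc, h], by rw [mul_assoc, h]⟩

/-- The data presenting an algebra `P M_r(C(X)) P` of the class `I_d`: a finite CW complex `Y` of
covering dimension at most `d`, a nonempty compact subset `X` of `Y`, and a projection `Q` of
`M_r(C(Y))` whose restriction to `X` is `P`.  Every such `P M_r(C(X)) P` is a quotient of
`Q M_r(C(Y)) Q` by restriction, and every nonzero quotient of the latter has this form.  (A finite CW complex has at most continuum many points,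
so nothing is lost by taking `Y : Type`.) -/
structure HomogeneousModel (d : ℕ) where
  /-- the finite CW complex -/
  Y : Type
  [topY : TopologicalSpace Y]
  [t2Y : T2Space Y]
  finiteCW : IsFiniteCWComplex Y
  dim_le : CoveringDimLE Y d
  /-- the compact subset -/
  X : Set Y
  isCompact_X : IsCompact X
  nonempty_X : X.Nonempty
  /-- the matrix size -/
  r : ℕ
  r_pos : 1 ≤ r
  /-- the projection over `Y` -/
  Q : Matrix (Fin r) (Fin r) C(Y, ℂ)
  isStarProjection_Q : IsStarProjection Q

attribute [instance] HomogeneousModel.topY HomogeneousModel.t2Y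

namespace HomogeneousModel

variable {d : ℕ} (m : HomogeneousModel d)

/-- The restriction `P` of `Q` to `X`. -/
def P : Matrix (Fin m.r) (Fin m.r) C(m.X, ℂ) :=
  m.Q.map (fun f => f.restrict m.X)

theorem isStarProjection_P : IsStarProjection m.P := by
  have h1 : m.Q * m.Q = m.Q := m.isStarProjection_Q.isIdempotentElem
  have h2 : star m.Q = m.Q := m.isStarProjection_Q.isSelfAdjoint
  constructor
  · change m.P * m.P = m.P
    ext i j x
    have h := congrArg (fun f : C(m.Y, ℂ) => f x) (congrFun (congrFun h1 i) j)
    simpa [P, Matrix.mul_apply] using h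
  · change star m.P = m.P
    ext i j x
    have h := congrArg (fun f : C(m.Y, ℂ) => f x) (congrFun (congrFun h2 i) j)
    simpa [P, Matrix.star_apply] using h

/-- The algebra `P M_r(C(X)) P`. -/
def algebra : NonUnitalStarSubalgebra ℂ (Matrix (Fin m.r) (Fin m.r) C(m.X, ℂ)) :=
  corner m.P m.isStarProjection_P

/-- The rank of the matrix `P(x)`. -/
def rankAt (x : m.X) : ℕ :=
  (m.P.map (fun f => f x)).rank

end HomogeneousModel

/-- A unital C*-algebra is simple: it is nonzero and has no closed two-sided ideals other than
`0` and itself. -/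
def IsSimpleCStar (A : Type*) [CStarAlgebra A] : Prop :=
  Nontrivial A ∧ ∀ I : TwoSidedIdeal A, IsClosed (I : Set A) → I = ⊥ ∨ I = ⊤

/-- Cuntz subequivalence `a ≲ b` (used for positive `a`, `b`). -/
def CuntzLE {A : Type*} [CStarAlgebra A] (a b : A) : Prop :=
  ∃ x : ℕ → A, Tendsto (fun n => ‖star (x n) * b * x n - a‖) atTop (𝓝 0)

/-- The approximation property defining the class `C_g`, for `g : ℕ → ℕ`. -/
def InClassC (g : ℕ → ℕ) (A : Type*) [CStarAlgebra A] [PartialOrder A] [StarOrderedRing A] :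
    Prop :=
  ∀ (F : Finset A) (ε η : ℝ), 0 < ε → 0 < η → ∀ a : A, 0 ≤ a → a ≠ 0 →
    ∃ (p : A) (C : NonUnitalStarSubalgebra ℂ A) (d : ℕ) (m : HomogeneousModel d),
      IsStarProjection p ∧
      IsClosed (C : Set A) ∧
      Nonempty (C ≃⋆ₐ[ℂ] m.algebra) ∧
      -- `p` is the unit of `C`
      (p ∈ C ∧ ∀ c ∈ C, p * c = c ∧ c * p = c) ∧
      (∀ b ∈ F, ‖p * b - b * p‖ < ε) ∧
      (∀ b ∈ F, Metric.infDist (p * b * p) (C : Set A) < ε) ∧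
      (∀ x : m.X, 0 < m.rankAt x ∧
        ((d : ℝ) + 1) / (m.rankAt x : ℝ) < η / ((g d : ℝ) + 1)) ∧
      CuntzLE (1 - p) a

/-- The class `C_1`: the case `g(d) = 1` for all `d`. -/
def InClassC1 (A : Type*) [CStarAlgebra A] [PartialOrder A] [StarOrderedRing A] : Prop :=
  InClassC (fun _ => 1) A

/-- A unital C*-algebra has stable rank one: its invertible elements are dense. -/
def HasStableRankOne (A : Type*) [CStarAlgebra A] : Prop :=
  Dense {x : A | IsUnit x}

end TracialAH

end

open Filter Topology

/-! ### General position by Hausdorff dimension, and partitions of unity of bounded order. -/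

namespace TracialAH

/-! Let `x` be non-invertible. The algebra is directly finite (`mul_eq_one_of_mul_eq_one`), so
neither `x⋆x` nor `xx⋆` is invertible, and functional calculus (`exists_cut`) replaces `x` by a
nearby `y = u'xu` that is killed on the right by some nonzero `k` and on the left by some nonzero
`k'`. By simplicity, finitely many two-sided translates of an element on which `k` acts as `1` add
up to `1`, and likewise for `k'`. Pass to a homogeneous block whose fibre rank is large compared
with `d + 1`: these identities survive approximately in each fibre and force `k` and `k'` to be
close to `1` on subspaces of dimension at least `5(d + 1)`. This leaves room for orthogonal trivial
rank-two subbundles on which `k` and `k'` are almost `1` (`exists_isometry_of_rayleigh`,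
`exists_two_isometries`), hence for a partial isometry `v` with `v² = 0` such that `y` is close to
`(1 - v⋆v) y (1 - vv⋆)`. Multiplying by the unitary that exchanges `v⋆v` and `vv⋆` gives an element
orthogonal on both sides to `v⋆v`, which is a sum of two nonzero orthogonal projections.

It remains to approximate an element orthogonal on both sides to such projections `e₁`, `e₂`
(`mem_closure_isUnit_of_orthogonal`). Choose a second block, with unit `p`, such that `1 - p ≲ e₁`,
and make the element commute with `p`. The part under `1 - p` is made invertible by the matrix with
rows `(z, -ε)` and `(ε, 0)`, invertible for every `z`, whose second coordinate is supplied by `e₁`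
(`isUnit_block`). The part under `p` has a spare projection of fibre rank at least `5(d + 1)`,
coming from `e₂`; this absorbs the topological obstruction to perturbing a map of bundles over a
`d`-dimensional space to an invertible one (`exists_corner_inverse_near`).

Both bundle statements are general position arguments. A partition of unity of order `d + 1` makes
the data at each point depend on at most `d + 1` real coefficients, and `dimH_setOf_exists_le` shows
that a generic choice avoids every bad configuration as soon as there are fewer parameters than
equations. No theory of vector bundles is needed. -/

open Module in
-- Parametric transversality: the parameter adds `dim V` and the equation removes more than that. On
-- the incidence set in `V × W`, the map sending `(θ, G)` to `θ` and the component of `G` along `ker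
-- (L θ₀)` is locally antilipschitz, so that set has dimension at most `dim V + dim ker (L θ₀) < dim
-- W`. Only Lipschitz data are required, which matters because `specCut` is not smooth.
theorem dimH_setOf_exists_le {V W F : Type*} [NormedAddCommGroup V] [NormedSpace ℝ V]
    [FiniteDimensional ℝ V] [NormedAddCommGroup W] [NormedSpace ℝ W] [FiniteDimensional ℝ W]
    [NormedAddCommGroup F] [NormedSpace ℝ F] (Θ : Set V) (L : V → W →L[ℝ] F) (b : V → F)
    (hL : LocallyLipschitz L) (hb : LocallyLipschitz b)
    (h : ∀ θ ∈ Θ, finrank ℝ V < finrank ℝ (LinearMap.range (L θ : W →ₗ[ℝ] F))) :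
    dimH {G : W | ∃ θ ∈ Θ, L θ G = b θ} ≤ (finrank ℝ W - 1 : ℕ) := by
  set A : Set (V × W) := {q | q.1 ∈ Θ ∧ L q.1 q.2 = b q.1} with hA
  have himg : {G : W | ∃ θ ∈ Θ, L θ G = b θ} = Prod.snd '' A := by
    ext G
    simp [hA]
  rw [himg]
  refine (LipschitzWith.prod_snd.dimH_image_le A).trans ?_
  by_contra! hlt
  -- Excess dimension is already visible in every neighbourhood of a single point, so a local
  -- estimate suffices.
  obtain ⟨x, hx, hxt⟩ := exists_mem_nhdsWithin_lt_dimH_of_lt_dimH hlt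
  obtain ⟨θ₀, G₀⟩ := x
  have hθ₀ : θ₀ ∈ Θ := hx.1
  set K₀ := LinearMap.ker (L θ₀ : W →ₗ[ℝ] F)
  obtain ⟨π, hπ⟩ := K₀.subtype.exists_leftInverse_of_injective K₀.ker_subtype
  have hinj : LinearMap.ker ((L θ₀ : W →ₗ[ℝ] F).prod π) = ⊥ := by
    rw [LinearMap.ker_eq_bot']
    intro w hw
    simp only [LinearMap.prod_apply, Function.prod_apply, Prod.mk_eq_zero] at hw
    have h1 : w ∈ K₀ := hw.1
    have h2 := LinearMap.congr_fun hπ ⟨w, h1⟩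
    simp only [LinearMap.comp_apply, Submodule.subtype_apply, hw.2, LinearMap.id_apply] at h2
    exact (congrArg Subtype.val h2).symm
  obtain ⟨C₀, hC₀, hanti⟩ := LinearMap.exists_antilipschitzWith _ hinj
  have hC₀' : (0 : ℝ) < C₀ := hC₀
  obtain ⟨K₁, t₁, ht₁, hK₁⟩ := hL θ₀
  obtain ⟨K₂, t₂, ht₂, hK₂⟩ := hb θ₀
  -- With this radius the error of freezing `L` at `θ₀` costs at most half of `‖G - G'‖`, which is
  -- absorbed in `e6`.
  have hη : (0 : ℝ) < 1 / (2 * C₀) := by positivity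
  have hLc : ∀ᶠ θ in 𝓝 θ₀, ‖L θ - L θ₀‖ < 1 / (2 * C₀) := by
    have := (hL.continuous.tendsto θ₀).eventually (Metric.ball_mem_nhds _ hη)
    simpa [dist_eq_norm] using this
  set U : Set (V × W) := (t₁ ∩ t₂ ∩ {θ | ‖L θ - L θ₀‖ < 1 / (2 * C₀)}) ×ˢ Metric.ball G₀ 1
  have hU : U ∈ 𝓝 (θ₀, G₀) :=
    prod_mem_nhds (inter_mem (inter_mem ht₁ ht₂) hLc) (Metric.ball_mem_nhds _ one_pos)
  set t : Set (V × W) := A ∩ U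
  have ht : t ∈ 𝓝[A] (θ₀, G₀) := inter_mem_nhdsWithin _ hU
  have hlt' := hxt t ht
  set R : ℝ := ‖G₀‖ + 1
  set M : ℝ := K₂ + K₁ * R
  have hM : 0 ≤ M := by positivity
  let f : t → V × K₀ := fun q => (q.1.1, π q.1.2)
  have hf : AntilipschitzWith (1 + 2 * C₀ * (⟨M, hM⟩ + 1)) f := by
    refine AntilipschitzWith.of_le_mul_dist ?_
    rintro ⟨⟨θ, G⟩, ⟨hθ, hG⟩, ⟨⟨hθ1, hθ2⟩, hθ3⟩, hGb⟩ ⟨⟨θ', G'⟩, ⟨hθ', hG'⟩, ⟨⟨hθ1', hθ2'⟩, hθ3'⟩, hGb'⟩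
    simp only at hθ hG hθ1 hθ2 hθ3 hGb hθ' hG' hθ1' hθ2' hθ3' hGb'
    have e1 : ‖L θ' - L θ‖ ≤ K₁ * ‖θ - θ'‖ := by
      have := hK₁.dist_le_mul _ hθ1 _ hθ1'
      rwa [dist_comm, dist_eq_norm, dist_eq_norm] at this
    have e2 : ‖b θ - b θ'‖ ≤ K₂ * ‖θ - θ'‖ := by
      have := hK₂.dist_le_mul _ hθ2 _ hθ2'
      rwa [dist_eq_norm, dist_eq_norm] at this
    have e3 : ‖G'‖ ≤ R := by
      have : ‖G' - G₀‖ < 1 := by simpa [dist_eq_norm] using hGb'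
      calc ‖G'‖ = ‖G₀ + (G' - G₀)‖ := by congr 1; abel
        _ ≤ ‖G₀‖ + ‖G' - G₀‖ := norm_add_le _ _
        _ ≤ R := by simp only [R]; linarith
    -- Subtract the equations at the two points after freezing the coefficient at `θ₀`.
    have e4 : ‖L θ₀ (G - G')‖ ≤ 1 / (2 * C₀) * ‖G - G'‖ + M * ‖θ - θ'‖ := by
      have : L θ₀ (G - G') = (L θ₀ - L θ) (G - G') + ((b θ - b θ') + (L θ' - L θ) G') := by
        simp only [map_sub, sub_apply, hG, hG']
        abel
      rw [this]
      refine (norm_add_le _ _).trans (add_le_add ?_ ((norm_add_le _ _).trans ?_))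
      · refine (ContinuousLinearMap.le_opNorm _ _).trans ?_
        gcongr
        rw [norm_sub_rev]
        exact hθ3.le
      · calc ‖b θ - b θ'‖ + ‖(L θ' - L θ) G'‖ ≤ K₂ * ‖θ - θ'‖ + (K₁ * ‖θ - θ'‖) * R := by
              refine add_le_add e2 ((ContinuousLinearMap.le_opNorm _ _).trans ?_)
              gcongr
          _ = M * ‖θ - θ'‖ := by simp only [M]; ring
    have e5 : ‖G - G'‖ ≤ C₀ * (‖L θ₀ (G - G')‖ + ‖π (G - G')‖) := by
      have := hanti.le_mul_dist G G'
      rw [dist_eq_norm, dist_eq_norm, ← map_sub] at this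
      refine this.trans ?_
      gcongr
      rw [LinearMap.prod_apply, Prod.norm_def]
      exact max_le_add_of_nonneg (norm_nonneg _) (norm_nonneg _)
    have e6 : ‖G - G'‖ ≤ 2 * C₀ * (M * ‖θ - θ'‖ + ‖π (G - G')‖) := by
      have : C₀ * (1 / (2 * C₀) * ‖G - G'‖) = ‖G - G'‖ / 2 := by field_simp
      nlinarith [mul_le_mul_of_nonneg_left e4 hC₀'.le]
    set D := dist (f ⟨(θ, G), ⟨⟨hθ, hG⟩, ⟨⟨⟨hθ1, hθ2⟩, hθ3⟩, hGb⟩⟩⟩)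
      (f ⟨(θ', G'), ⟨⟨hθ', hG'⟩, ⟨⟨⟨hθ1', hθ2'⟩, hθ3'⟩, hGb'⟩⟩⟩) with hD
    have d1 : ‖θ - θ'‖ ≤ D := by
      rw [hD, Prod.dist_eq, ← dist_eq_norm]
      exact le_max_left _ _
    have d2 : ‖π (G - G')‖ ≤ D := by
      rw [hD, Prod.dist_eq, map_sub, ← dist_eq_norm]
      exact le_max_right _ _
    have d0 : 0 ≤ D := dist_nonneg
    have : dist (⟨(θ, G), ⟨⟨hθ, hG⟩, ⟨⟨⟨hθ1, hθ2⟩, hθ3⟩, hGb⟩⟩⟩ : t)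
      ⟨(θ', G'), ⟨⟨hθ', hG'⟩, ⟨⟨⟨hθ1', hθ2'⟩, hθ3'⟩, hGb'⟩⟩⟩ ≤ ‖θ - θ'‖ + ‖G - G'‖ := by
      rw [Subtype.dist_eq, Prod.dist_eq, dist_eq_norm, dist_eq_norm]
      exact max_le_add_of_nonneg (norm_nonneg _) (norm_nonneg _)
    refine this.trans ?_
    have e7 : 2 * C₀ * (M * ‖θ - θ'‖ + ‖π (G - G')‖) ≤ 2 * C₀ * (M * D + D) := by gcongr
    push_cast
    change _ ≤ (1 + 2 * (C₀ : ℝ) * (M + 1)) * D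
    nlinarith
  have h1 : dimH (Set.univ : Set t) = dimH t := by
    rw [← isometry_subtype_coe.dimH_image, Set.image_univ, Subtype.range_coe]
  have h2 : dimH t ≤ finrank ℝ (V × K₀) := by
    rw [← h1]
    refine (hf.le_dimH_image _).trans ?_
    rw [← Real.dimH_univ_eq_finrank]
    exact dimH_mono (Set.subset_univ _)
  have h3 : finrank ℝ (V × K₀) ≤ finrank ℝ W - 1 := by
    have r1 := LinearMap.finrank_range_add_finrank_ker (L θ₀ : W →ₗ[ℝ] F)
    have r2 := h θ₀ hθ₀
    rw [Module.finrank_prod]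
    change _ + finrank ℝ K₀ ≤ _
    change _ + finrank ℝ K₀ = _ at r1
    omega
  exact absurd (hlt'.trans_le (h2.trans (by exact_mod_cast h3))) (lt_irrefl _)

/-- The partition of unity is subordinate to a finite subfamily of a refinement of order `d + 1`.
The bound on the number of nonzero coefficients makes the approximant depend on `d + 1` real
parameters at each point, whatever the value of `N`. -/
theorem exists_partition_approx {X : Type*} [TopologicalSpace X] [CompactSpace X] [T2Space X]
    {d : ℕ} (hX : CoveringDimLE X d) {V : Type*} [NormedAddCommGroup V] [NormedSpace ℝ V]
    (F : C(X, V)) {τ : ℝ} (hτ : 0 < τ) :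
    ∃ (N : ℕ) (φ : Fin N → C(X, ℝ)) (x : Fin N → X), (∀ i t, 0 ≤ φ i t) ∧ (∀ t, ∑ i, φ i t = 1) ∧
      (∀ t, (Finset.univ.filter fun i => φ i t ≠ 0).card ≤ d + 1) ∧
      ∀ t, ‖∑ i, φ i t • F (x i) - F t‖ < τ := by
  classical
  have hcov : ∀ t : X, IsOpen (F ⁻¹' Metric.ball (F t) (τ / 2)) := fun t =>
    Metric.isOpen_ball.preimage F.continuous
  obtain ⟨s, hs⟩ := isCompact_univ.elim_finite_subcover (fun t : X => F ⁻¹' Metric.ball (F t) (τ / 2))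
    hcov (fun t _ => Set.mem_iUnion.2 ⟨t, by simp [hτ]⟩)
  obtain ⟨𝒱, hVo, hVc, hVr, hVm⟩ := hX ((fun t : X => F ⁻¹' Metric.ball (F t) (τ / 2)) '' s)
    (s.finite_toSet.image _) (by rintro _ ⟨t, -, rfl⟩; exact hcov t) (by
      rw [Set.sUnion_image]; exact Set.univ_subset_iff.1 hs)
  obtain ⟨T, hT⟩ := isCompact_univ.elim_finite_subcover (fun V : 𝒱 => (V : Set X))
    (fun V => hVo V V.2) (by rw [← Set.sUnion_eq_iUnion, hVc])
  have hx : ∀ V : 𝒱, ∃ x : X, ∀ t ∈ (V : Set X), ‖F x - F t‖ < τ / 2 := by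
    intro V
    obtain ⟨U, hU, hVU⟩ := hVr V V.2
    obtain ⟨x, -, rfl⟩ := hU
    refine ⟨x, fun t ht => ?_⟩
    have := hVU ht
    rw [norm_sub_rev, ← dist_eq_norm]
    simpa using this
  choose x hx using hx
  obtain ⟨f, hf⟩ := PartitionOfUnity.exists_isSubordinate isClosed_univ
    (fun V : T => ((V : 𝒱) : Set X)) (fun V => hVo _ V.1.2) (by
      intro t ht
      obtain ⟨V, hV⟩ := Set.mem_iUnion.1 (hT ht)
      obtain ⟨hVT, htV⟩ := Set.mem_iUnion.1 hV
      exact Set.mem_iUnion.2 ⟨⟨V, hVT⟩, htV⟩)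
  have hsupp : ∀ (V : T) (t : X), f V t ≠ 0 → t ∈ ((V : 𝒱) : Set X) := fun V t h =>
    hf V (subset_tsupport _ h)
  have hsum : ∀ t, ∑ V : T, f V t = 1 := fun t => by
    rw [← f.sum_eq_one (Set.mem_univ t), finsum_eq_sum_of_fintype]
  refine ⟨Fintype.card T, fun i => f ((Fintype.equivFin T).symm i),
    fun i => x ((Fintype.equivFin T).symm i), fun i t => f.nonneg _ _, fun t => ?_, fun t => ?_,
    fun t => ?_⟩
  · rw [← hsum t]
    exact (Fintype.equivFin T).symm.sum_comp fun V => f V t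
  · have h1 := hVm t
    have hinj : Function.Injective fun i : Fin (Fintype.card T) =>
        (((Fintype.equivFin T).symm i : 𝒱) : Set X) :=
      Subtype.val_injective.comp (Subtype.val_injective.comp (Fintype.equivFin T).symm.injective)
    have h2 : (((Finset.univ.filter fun i => f ((Fintype.equivFin T).symm i) t ≠ 0).image
        fun i => (((Fintype.equivFin T).symm i : 𝒱) : Set X) : Finset (Set X)) : Set (Set X)) ⊆
        {V ∈ 𝒱 | t ∈ V} := by
      intro V hV
      simp only [Finset.coe_image, Set.mem_image, Finset.mem_coe, Finset.mem_filter] at hV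
      obtain ⟨i, ⟨-, hi⟩, rfl⟩ := hV
      exact ⟨Subtype.coe_prop _, hsupp _ _ hi⟩
    have h3 := (Set.encard_le_encard h2).trans h1
    rw [Set.encard_coe_eq_coe_finsetCard, Finset.card_image_of_injective _ hinj] at h3
    exact_mod_cast h3
  · have h4 : ∑ i, f ((Fintype.equivFin T).symm i) t • F (x ((Fintype.equivFin T).symm i)) - F t =
        ∑ V : T, f V t • (F (x V) - F t) := by
      rw [(Fintype.equivFin T).symm.sum_comp fun V : T => f V t • F (x V)]
      simp only [smul_sub, Finset.sum_sub_distrib, ← Finset.sum_smul, hsum, one_smul]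
    rw [h4]
    calc ‖∑ V : T, f V t • (F (x V) - F t)‖ ≤ ∑ V : T, f V t * (τ / 2) := by
          refine norm_sum_le_of_le _ fun V _ => ?_
          rw [norm_smul, Real.norm_of_nonneg (f.nonneg _ _)]
          by_cases h : f V t = 0
          · simp [h]
          · exact mul_le_mul_of_nonneg_left (hx _ _ (hsupp V t h)).le (f.nonneg _ _)
      _ = τ / 2 := by rw [← Finset.sum_mul, hsum, one_mul]
      _ < τ := by linarith

end TracialAH

/-! ### Spectral cut-offs of self-adjoint operators. -/

namespace TracialAH

section Spectral

variable {E : Type*} [NormedAddCommGroup E] [InnerProductSpace ℂ E] [FiniteDimensional ℂ E]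

open Module ComplexConjugate

theorem exists_eigenbasis {a : E →L[ℂ] E} (ha : IsSelfAdjoint a) :
    ∃ p : OrthonormalBasis (Fin (finrank ℂ E)) ℂ E × (Fin (finrank ℂ E) → ℝ),
      ∀ i, a (p.1 i) = (p.2 i : ℂ) • p.1 i := by
  have h : (a : E →ₗ[ℂ] E).IsSymmetric := ha.isSymmetric
  exact ⟨(h.eigenvectorBasis rfl, h.eigenvalues rfl), fun i => h.apply_eigenvectorBasis rfl i⟩

theorem inner_eigenbasis {a : E →L[ℂ] E} (ha : IsSelfAdjoint a) {ι : Type*} [Fintype ι]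
    {u : OrthonormalBasis ι ℂ E} {l : ι → ℝ} (h : ∀ i, a (u i) = (l i : ℂ) • u i) (i : ι) (ξ : E) :
    inner ℂ (u i) (a ξ) = l i * inner ℂ (u i) ξ := by
  have := ha.isSymmetric (u i) ξ
  simp only [ContinuousLinearMap.coe_coe] at this
  rw [← this, h, inner_smul_left, Complex.conj_ofReal]

theorem re_inner_eq_sum {a : E →L[ℂ] E} (ha : IsSelfAdjoint a) {ι : Type*} [Fintype ι]
    {u : OrthonormalBasis ι ℂ E} {l : ι → ℝ} (h : ∀ i, a (u i) = (l i : ℂ) • u i) (ξ : E) :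
    (inner ℂ (a ξ) ξ).re = ∑ i, l i * ‖inner ℂ (u i) ξ‖ ^ 2 := by
  rw [← u.sum_inner_mul_inner (a ξ) ξ, Complex.re_sum]
  refine Finset.sum_congr rfl fun i _ => ?_
  rw [← inner_conj_symm, inner_eigenbasis ha h, map_mul, Complex.conj_ofReal, mul_assoc,
    ← Complex.normSq_eq_conj_mul_self, Complex.normSq_eq_norm_sq, ← Complex.ofReal_mul,
    Complex.ofReal_re]

/-- The operator `(a - θ)₊` for a self-adjoint operator `a`. -/
noncomputable def specCut (θ : ℝ) (a : E →L[ℂ] E) : E →L[ℂ] E :=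
  open scoped Classical in
  if ha : IsSelfAdjoint a then
    ∑ i, ((max ((exists_eigenbasis ha).choose.2 i - θ) 0 : ℝ) : ℂ) •
      InnerProductSpace.rankOne ℂ ((exists_eigenbasis ha).choose.1 i)
        ((exists_eigenbasis ha).choose.1 i)
  else 0

theorem exists_eigenbasis_specCut (θ : ℝ) {a : E →L[ℂ] E} (ha : IsSelfAdjoint a) :
    ∃ (u : OrthonormalBasis (Fin (finrank ℂ E)) ℂ E) (l : Fin (finrank ℂ E) → ℝ),
      (∀ i, a (u i) = (l i : ℂ) • u i) ∧
      ∀ i, specCut θ a (u i) = ((max (l i - θ) 0 : ℝ) : ℂ) • u i := by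
  refine ⟨(exists_eigenbasis ha).choose.1, (exists_eigenbasis ha).choose.2,
    (exists_eigenbasis ha).choose_spec, fun i => ?_⟩
  rw [specCut, dif_pos ha, sum_apply, Finset.sum_eq_single i]
  · simp
  · intro j _ hj
    have := (exists_eigenbasis ha).choose.1.orthonormal.2 hj
    simp [this]
  · simp

theorem isSelfAdjoint_specCut (θ : ℝ) (a : E →L[ℂ] E) : IsSelfAdjoint (specCut θ a) := by
  rw [specCut]
  split_ifs with ha
  · refine isSelfAdjoint_sum _ fun i _ => ?_
    refine IsSelfAdjoint.smul (Complex.conj_ofReal _) ?_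
    exact InnerProductSpace.adjoint_rankOne _ _
  · exact .zero _

omit [FiniteDimensional ℂ E] in
theorem norm_le_of_inner_le {ι : Type*} [Fintype ι] (u w : OrthonormalBasis ι ℂ E)
    (T : E →L[ℂ] E) {c : ℝ} (hc : ∀ i j, ‖inner ℂ (u i) (T (w j))‖ ≤ c) (hc0 : 0 ≤ c) :
    ‖T‖ ≤ (Fintype.card ι * Fintype.card ι : ℝ) * c := by
  refine T.opNorm_le_bound (by positivity) fun ξ => ?_
  have h1 : ∀ i, ‖inner ℂ (u i) (T ξ)‖ ≤ Fintype.card ι * (‖ξ‖ * c) := by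
    intro i
    conv_lhs => rw [← w.sum_repr' ξ, map_sum, inner_sum]
    suffices h : ‖∑ j, inner ℂ (u i) (T (inner ℂ (w j) ξ • w j))‖ ≤ ∑ _j : ι, ‖ξ‖ * c by
      simpa [inner_smul_right] using h
    refine norm_sum_le_of_le _ fun j _ => ?_
    rw [map_smul, inner_smul_right, norm_mul]
    refine mul_le_mul ?_ (hc i j) (norm_nonneg _) (norm_nonneg _)
    simpa [w.orthonormal.1 j] using norm_inner_le_norm (𝕜 := ℂ) (w j) ξ
  calc ‖T ξ‖ = ‖∑ i, inner ℂ (u i) (T ξ) • u i‖ := by rw [u.sum_repr']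
    _ ≤ ∑ i : ι, Fintype.card ι * (‖ξ‖ * c) := by
        refine norm_sum_le_of_le _ fun i _ => ?_
        rw [norm_smul, u.orthonormal.1, mul_one]
        exact h1 i
    _ = _ := by simp; ring

/-- Compare matrix coefficients between an eigenbasis of `a` and one of `b`: the coefficient of `a -
b` is `(l i - m j) ⟨u i, w j⟩`, and the cut-off only replaces `l`, `m` by their images under a
`1`-Lipschitz function. Any Lipschitz constant is good enough for the dimension count. -/
theorem norm_specCut_sub_le (θ : ℝ) {a b : E →L[ℂ] E} (ha : IsSelfAdjoint a)
    (hb : IsSelfAdjoint b) :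
    ‖specCut θ a - specCut θ b‖ ≤ (finrank ℂ E * finrank ℂ E : ℝ) * ‖a - b‖ := by
  obtain ⟨u, l, hu, hu'⟩ := exists_eigenbasis_specCut θ ha
  obtain ⟨w, m, hw, hw'⟩ := exists_eigenbasis_specCut θ hb
  have key := norm_le_of_inner_le u w (specCut θ a - specCut θ b) (c := ‖a - b‖) ?_ (norm_nonneg _)
  · simpa using key
  intro i j
  have e1 : inner ℂ (u i) ((specCut θ a - specCut θ b) (w j)) =
      ((max (l i - θ) 0 - max (m j - θ) 0 : ℝ) : ℂ) * inner ℂ (u i) (w j) := by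
    rw [sub_apply, inner_sub_right, inner_eigenbasis (isSelfAdjoint_specCut θ a) hu', hw',
      inner_smul_right, ← sub_mul, ← Complex.ofReal_sub]
  have e2 : inner ℂ (u i) ((a - b) (w j)) = ((l i - m j : ℝ) : ℂ) * inner ℂ (u i) (w j) := by
    rw [sub_apply, inner_sub_right, inner_eigenbasis ha hu, hw,
      inner_smul_right, ← sub_mul, ← Complex.ofReal_sub]
  have e3 : ‖inner ℂ (u i) ((a - b) (w j))‖ ≤ ‖a - b‖ := by
    refine (norm_inner_le_norm _ _).trans ?_
    simpa using (a - b).le_opNorm (w j)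
  refine le_trans ?_ e3
  rw [e1, e2, norm_mul, norm_mul, Complex.norm_real, Complex.norm_real]
  gcongr
  have := abs_max_sub_max_le_abs (l i - θ) (m j - θ) 0
  simpa using this

theorem le_re_inner_specCut (θ : ℝ) {a : E →L[ℂ] E} (ha : IsSelfAdjoint a) (ζ : E) :
    θ * ‖specCut θ a ζ‖ ^ 2 ≤ (inner ℂ (a (specCut θ a ζ)) (specCut θ a ζ)).re := by
  obtain ⟨u, l, hu, hu'⟩ := exists_eigenbasis_specCut θ ha
  rw [re_inner_eq_sum ha hu, ← u.sum_sq_norm_inner_right, Finset.mul_sum]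
  refine Finset.sum_le_sum fun i _ => ?_
  rw [inner_eigenbasis (isSelfAdjoint_specCut θ a) hu']
  rcases le_total (l i) θ with h | h
  · simp [max_eq_right (sub_nonpos.2 h)]
  · gcongr

theorem re_inner_le_of_specCut_eq_zero {θ : ℝ} {a : E →L[ℂ] E} (ha : IsSelfAdjoint a) {ξ : E}
    (h : specCut θ a ξ = 0) : (inner ℂ (a ξ) ξ).re ≤ θ * ‖ξ‖ ^ 2 := by
  obtain ⟨u, l, hu, hu'⟩ := exists_eigenbasis_specCut θ ha
  rw [re_inner_eq_sum ha hu, ← u.sum_sq_norm_inner_right, Finset.mul_sum]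
  refine Finset.sum_le_sum fun i _ => ?_
  have h1 := inner_eigenbasis (isSelfAdjoint_specCut θ a) hu' i ξ
  rw [h, inner_zero_right, eq_comm, mul_eq_zero] at h1
  rcases h1 with h1 | h1
  · have h2 : max (l i - θ) 0 = 0 := by exact_mod_cast h1
    have h3 : l i ≤ θ := by
      have := le_max_left (l i - θ) 0
      linarith
    gcongr
  · simp [h1]

/-- `S` is the span of the eigenvectors with eigenvalue of modulus greater than `δ`. -/
theorem exists_spectral_subspace {κ : E →L[ℂ] E} (hκ : IsSelfAdjoint κ) {δ : ℝ} (hδ : 0 < δ) :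
    ∃ S : Submodule ℂ E, (∀ ξ ∈ S, ∃ ζ, ξ = κ ζ ∧ δ * ‖ζ‖ ≤ ‖ξ‖) ∧
      ∀ ξ ∈ Sᗮ, ‖κ ξ‖ ≤ δ * ‖ξ‖ := by
  obtain ⟨⟨u, l⟩, hu⟩ := exists_eigenbasis hκ
  simp only at hu
  let S : Submodule ℂ E :=
    { carrier := {ξ | ∀ i, |l i| ≤ δ → inner ℂ (u i) ξ = 0}
      zero_mem' := by simp
      add_mem' := fun {a b} ha hb i hi => by rw [inner_add_right, ha i hi, hb i hi, add_zero]
      smul_mem' := fun c a ha i hi => by rw [inner_smul_right, ha i hi, mul_zero] }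
  have sq_le : ∀ x y : E, ∀ c : ℝ, 0 ≤ c → (∀ i, c * ‖inner ℂ (u i) x‖ ≤ ‖inner ℂ (u i) y‖) →
      c * ‖x‖ ≤ ‖y‖ := by
    intro x y c hc h
    refine abs_le_of_sq_le_sq' ?_ (norm_nonneg _) |>.2
    rw [mul_pow, ← u.sum_sq_norm_inner_right x, ← u.sum_sq_norm_inner_right y, Finset.mul_sum]
    refine Finset.sum_le_sum fun i _ => ?_
    rw [← mul_pow]
    exact pow_le_pow_left₀ (by positivity) (h i) 2
  refine ⟨S, fun ξ hξ => ?_, fun ξ hξ => ?_⟩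
  · set ζ : E := ∑ i, ((l i : ℂ)⁻¹ * inner ℂ (u i) ξ) • u i
    have hζ : ∀ i, inner ℂ (u i) ζ = (l i : ℂ)⁻¹ * inner ℂ (u i) ξ := fun i => by
      simp only [ζ]
      rw [u.orthonormal.inner_right_fintype]
    have hl : ∀ i, (l i : ℂ) * ((l i : ℂ)⁻¹ * inner ℂ (u i) ξ) = inner ℂ (u i) ξ := by
      intro i
      rcases le_or_gt |l i| δ with h | h
      · rw [hξ i h]; simp
      · have : (l i : ℂ) ≠ 0 := by
          intro h0
          have : l i = 0 := by exact_mod_cast h0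
          rw [this, abs_zero] at h
          linarith
        rw [← mul_assoc, mul_inv_cancel₀ this, one_mul]
    refine ⟨ζ, ?_, ?_⟩
    · refine InnerProductSpace.ext_inner_left_basis u.toBasis fun i => ?_
      rw [u.coe_toBasis, inner_eigenbasis hκ hu, hζ, hl]
    · refine sq_le _ _ _ hδ.le fun i => ?_
      rw [← hl i, hζ]
      rcases le_or_gt |l i| δ with h | h
      · rw [hξ i h]; simp
      · rw [norm_mul (l i : ℂ), Complex.norm_real, Real.norm_eq_abs]
        gcongr
  · have h1 : δ⁻¹ * ‖κ ξ‖ ≤ ‖ξ‖ := by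
      refine sq_le _ _ _ (by positivity) fun i => ?_
      rw [inner_eigenbasis hκ hu, norm_mul, Complex.norm_real, Real.norm_eq_abs]
      rcases le_or_gt |l i| δ with h | h
      · calc δ⁻¹ * (|l i| * ‖inner ℂ (u i) ξ‖) ≤ δ⁻¹ * (δ * ‖inner ℂ (u i) ξ‖) := by gcongr
          _ = _ := by field_simp
      · have : u i ∈ S := fun j hj => u.orthonormal.2 (by rintro rfl; linarith)
        rw [hξ _ this]
        simp
    rwa [inv_mul_le_iff₀ hδ] at h1

end Spectral

end TracialAH

/-! ### Continuous polar decomposition, and generic linear maps. -/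

namespace TracialAH

theorem exists_inv_sqrt {B : Type*} [CStarAlgebra B] {a : B} (ha : IsSelfAdjoint a)
    (hspec : ∀ x ∈ spectrum ℝ a, 0 < x) : ∃ s : B, IsSelfAdjoint s ∧ s * a * s = 1 := by
  have hcont : ContinuousOn (fun x : ℝ => (√x)⁻¹) (spectrum ℝ a) := by
    refine ContinuousOn.inv₀ Real.continuous_sqrt.continuousOn fun x hx => ?_
    exact (Real.sqrt_pos.2 (hspec x hx)).ne'
  let s : B := cfc (fun x : ℝ => (√x)⁻¹) a
  refine ⟨s, cfc_predicate _ _, ?_⟩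
  have hsas : s * cfc (fun x : ℝ => x) a * s = 1 := by
    simp only [s]
    rw [← cfc_mul (fun x : ℝ => (√x)⁻¹) (fun x => x) a hcont continuousOn_id,
      ← cfc_mul (fun x : ℝ => (√x)⁻¹ * x) (fun x : ℝ => (√x)⁻¹) a (hcont.mul continuousOn_id) hcont,
      ← cfc_one ℝ a]
    refine cfc_congr fun x hx => ?_
    have h0 := hspec x hx
    have h1 : √x ≠ 0 := (Real.sqrt_pos.2 h0).ne'
    have h2 := Real.mul_self_sqrt h0.le
    simp only [Pi.one_apply]
    field_simp
    rw [sq, h2]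
  rwa [cfc_id' ℝ a] at hsas

/-- Functional calculus in the C⋆-algebra `C(X, B)` itself gives continuity in `t` at no cost;
invertibility there is fibrewise. -/
theorem exists_inv_sqrt_continuousMap {X B : Type*} [TopologicalSpace X] [CompactSpace X]
    [CStarAlgebra B] (a : C(X, B)) (ha : ∀ t, star (a t) = a t)
    (h : ∀ x : ℝ, x ≤ 0 → ∀ t, IsUnit ((x : ℂ) • (1 : B) - a t)) :
    ∃ s : C(X, B), ∀ t, star (s t) = s t ∧ s t * a t * s t = 1 := by
  have hspec : ∀ x ∈ spectrum ℝ a, 0 < x := by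
    intro x hx
    by_contra! hx0
    refine hx ((ContinuousMap.isUnit_iff_forall_isUnit _).2 fun t => ?_)
    have := h x hx0 t
    rwa [Complex.coe_smul, ← Algebra.algebraMap_eq_smul_one] at this
  have ha' : IsSelfAdjoint a := ContinuousMap.ext ha
  obtain ⟨s, hs, hsas⟩ := exists_inv_sqrt ha' hspec
  exact ⟨s, fun t => ⟨congrArg (fun f : C(X, B) => f t) hs,
    congrArg (fun f : C(X, B) => f t) hsas⟩⟩

section Isometrize

variable {E F : Type*} [NormedAddCommGroup E] [InnerProductSpace ℂ E] [FiniteDimensional ℂ E]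
  [NormedAddCommGroup F] [InnerProductSpace ℂ F] [FiniteDimensional ℂ F]

theorem isUnit_of_injective {a : F →L[ℂ] F} (h : ∀ z, a z = 0 → z = 0) : IsUnit a := by
  rw [ContinuousLinearMap.isUnit_iff_bijective]
  have h1 : Function.Injective (a : F →ₗ[ℂ] F) := by
    rw [← LinearMap.ker_eq_bot]
    exact LinearMap.ker_eq_bot'.2 h
  exact ⟨h1, LinearMap.injective_iff_surjective.1 h1⟩

/-- The witness is `(U⋆U)^(-1/2)`: composing with it replaces a fibrewise injective `U` by its polar
part. -/
theorem exists_isometrize {X : Type*} [TopologicalSpace X] [CompactSpace X]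
    (U : C(X, F →L[ℂ] E)) (hU : ∀ t z, U t z = 0 → z = 0) :
    ∃ s : C(X, F →L[ℂ] F), ∀ t z, ‖U t (s t z)‖ = ‖z‖ := by
  obtain ⟨a, hat⟩ : ∃ a : C(X, F →L[ℂ] F), ∀ t, a t = (ContinuousLinearMap.adjoint (U t)) ∘L U t :=
    ⟨⟨fun t => (ContinuousLinearMap.adjoint (U t)) ∘L U t, by fun_prop⟩, fun _ => rfl⟩
  have ha : ∀ t, star (a t) = a t := fun t => by
    rw [hat, ContinuousLinearMap.star_eq_adjoint, ContinuousLinearMap.adjoint_comp,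
      ContinuousLinearMap.adjoint_adjoint]
  have hapos : ∀ t z, inner ℂ z (a t z) = (‖U t z‖ : ℂ) ^ 2 := by
    intro t z
    rw [hat, ContinuousLinearMap.comp_apply, ContinuousLinearMap.adjoint_inner_right,
      inner_self_eq_norm_sq_to_K]
    rfl
  obtain ⟨s, hs⟩ := exists_inv_sqrt_continuousMap a ha fun x hx0 t =>
    isUnit_of_injective fun z hz => hU t z <| by
      have h1 : (x : ℂ) • z - a t z = 0 := hz
      have h2 : inner ℂ z ((x : ℂ) • z - a t z) = ((x * ‖z‖ ^ 2 - ‖U t z‖ ^ 2 : ℝ) : ℂ) := by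
        rw [inner_sub_right, inner_smul_right, hapos, inner_self_eq_norm_sq_to_K]
        push_cast
        rfl
      rw [h1, inner_zero_right] at h2
      have h3 : x * ‖z‖ ^ 2 - ‖U t z‖ ^ 2 = 0 := by exact_mod_cast h2.symm
      have h4 : ‖U t z‖ ^ 2 ≤ 0 := by nlinarith [sq_nonneg ‖z‖]
      have h5 : ‖U t z‖ = 0 :=
        pow_eq_zero_iff (two_ne_zero) |>.1 (le_antisymm h4 (sq_nonneg ‖U t z‖))
      exact norm_eq_zero.1 h5
  refine ⟨s, fun t z => ?_⟩
  obtain ⟨hs1, hs2⟩ := hs t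
  rw [ContinuousLinearMap.star_eq_adjoint] at hs1
  have h1 : inner ℂ z ((s t * a t * s t) z) = inner ℂ (s t z) (a t (s t z)) := by
    conv_rhs => rw [← hs1, ContinuousLinearMap.adjoint_inner_left]
    rw [hs1]
    rfl
  rw [hs2, hapos] at h1
  have h2 : (‖z‖ : ℂ) ^ 2 = (‖U t (s t z)‖ : ℂ) ^ 2 := by
    rw [← h1]
    exact (inner_self_eq_norm_sq_to_K (𝕜 := ℂ) z).symm
  have h3 : ‖z‖ ^ 2 = ‖U t (s t z)‖ ^ 2 := by exact_mod_cast h2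
  exact ((sq_eq_sq₀ (norm_nonneg _) (norm_nonneg _)).1 h3).symm

end Isometrize

section Generic

open Module in
theorem dimH_setOf_bilin_le {Y F W E K : Type*} [NormedAddCommGroup Y] [NormedSpace ℝ Y]
    [FiniteDimensional ℝ Y] [NormedAddCommGroup F] [NormedSpace ℝ F] [FiniteDimensional ℝ F]
    [NormedAddCommGroup W] [NormedSpace ℝ W] [FiniteDimensional ℝ W] [NormedAddCommGroup E]
    [NormedSpace ℝ E] [NormedAddCommGroup K] [NormedSpace ℝ K] (G : Y → E →L[ℝ] K)
    (hG : LocallyLipschitz G) (ev : F →L[ℝ] W →L[ℝ] E) (Θ : Set (Y × F)) (b : Y × F → K)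
    (hb : LocallyLipschitz b)
    (h : ∀ q ∈ Θ, finrank ℝ Y + finrank ℝ F <
      finrank ℝ (LinearMap.range ((G q.1 ∘L ev q.2 : W →L[ℝ] K) : W →ₗ[ℝ] K))) :
    dimH {V : W | ∃ q ∈ Θ, G q.1 (ev q.2 V) = b q} ≤ (finrank ℝ W - 1 : ℕ) := by
  refine dimH_setOf_exists_le Θ (fun q => G q.1 ∘L ev q.2) b ?_ hb fun q hq => ?_
  · have h1 : LocallyLipschitz fun q : (E →L[ℝ] K) × F => q.1 ∘L ev q.2 :=
      ContDiff.locallyLipschitz (𝕂 := ℝ)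
        (contDiff_fst.clm_comp (ev.contDiff.comp contDiff_snd))
    have h3 : LocallyLipschitz (fun q : Y × F => G q.1) :=
      LocallyLipschitz.comp (f := G) (g := Prod.fst) hG LipschitzWith.prod_fst.locallyLipschitz
    have h2 : LocallyLipschitz (fun q : Y × F => (G q.1, q.2)) :=
      h3.prodMk LipschitzWith.prod_snd.locallyLipschitz
    exact LocallyLipschitz.comp (f := fun q : (E →L[ℝ] K) × F => q.1 ∘L ev q.2)
      (g := fun q : Y × F => (G q.1, q.2)) h1 h2
  · rw [Module.finrank_prod]
    exact h q hq

variable {E F : Type*} [NormedAddCommGroup E] [InnerProductSpace ℂ E] [FiniteDimensional ℂ E]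
  [NormedAddCommGroup F] [InnerProductSpace ℂ F] [FiniteDimensional ℂ F]

open Module

omit [FiniteDimensional ℂ E] [FiniteDimensional ℂ F] in
theorem exists_clm_apply_eq {z : F} (hz : z ≠ 0) (v : E) : ∃ T : F →L[ℂ] E, T z = v := by
  refine ⟨((‖z‖ : ℂ) ^ 2)⁻¹ • InnerProductSpace.rankOne ℂ v z, ?_⟩
  have : (‖z‖ : ℂ) ^ 2 ≠ 0 := by simpa using hz
  simp only [smul_apply, InnerProductSpace.rankOne_apply]
  rw [inner_self_eq_norm_sq_to_K, smul_smul]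
  change (((‖z‖ : ℂ) ^ 2)⁻¹ * (‖z‖ : ℂ) ^ 2) • v = v
  rw [inv_mul_cancel₀ this, one_smul]

instance : FiniteDimensional ℝ (F →L[ℂ] E) := FiniteDimensional.complexToReal _

/-- For a fixed support `J`, a bad `V` comes with at most `d + 1` coefficients and a vector `z` of
`F`, that is, at most `d + 1 + 2 dim F` real parameters, against at least `2R` real equations. There
are finitely many `J`, so a generic `V` is never bad. -/
theorem exists_generic [Nontrivial E] [Nontrivial F] {N d R : ℕ} (θ : ℝ) (a : Fin N → (E →L[ℂ] E))
    (ha : ∀ i, IsSelfAdjoint (a i)) (hd : d + 1 + 2 * finrank ℂ F < 2 * R) :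
    ∃ V : F →L[ℂ] E, ∀ φ : Fin N → ℝ, (Finset.univ.filter fun i => φ i ≠ 0).card ≤ d + 1 →
      R ≤ finrank ℂ (LinearMap.range (specCut θ (∑ i, φ i • a i) : E →ₗ[ℂ] E)) →
      ∀ z, specCut θ (∑ i, φ i • a i) (V z) = 0 → z = 0 := by
  classical
  obtain ⟨G, hGdef⟩ : ∃ G : (J : Finset (Fin N)) → (J → ℝ) → (E →L[ℂ] E),
    G = fun (J : Finset (Fin N)) (y : J → ℝ) => specCut θ (∑ j : J, y j • a j) := ⟨_, rfl⟩
  let Θ : (J : Finset (Fin N)) → Set ((J → ℝ) × F) := fun J =>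
    {q | q.2 ≠ 0 ∧ R ≤ finrank ℂ (LinearMap.range (G J q.1 : E →ₗ[ℂ] E))}
  have hsa : ∀ (J : Finset (Fin N)) (y : J → ℝ), IsSelfAdjoint (∑ j : J, y j • a j) := fun J y =>
    isSelfAdjoint_sum _ fun j _ => IsSelfAdjoint.smul (star_trivial _) (ha j)
  have hG : ∀ J, LocallyLipschitz (G J) := by
    intro J
    have h1 : LocallyLipschitz (fun y : J → ℝ => ∑ j : J, y j • a j) :=
      ContDiff.locallyLipschitz (𝕂 := ℝ) (by fun_prop)
    intro y
    rw [hGdef]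
    obtain ⟨K, t, ht, hK⟩ := h1 y
    refine ⟨(finrank ℂ E * finrank ℂ E : NNReal) * K, t, ht, LipschitzOnWith.of_dist_le_mul ?_⟩
    intro y1 h1 y2 h2
    have := hK.dist_le_mul _ h1 _ h2
    rw [dist_eq_norm] at this ⊢
    refine (norm_specCut_sub_le θ (hsa J y1) (hsa J y2)).trans ?_
    push_cast
    rw [mul_assoc _ (K : ℝ)]
    gcongr
  have hWpos : 0 < finrank ℝ (F →L[ℂ] E) := by
    obtain ⟨z, hz⟩ := exists_ne (0 : F)
    obtain ⟨v, hv⟩ := exists_ne (0 : E)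
    obtain ⟨T, hT⟩ := exists_clm_apply_eq hz v
    have : Nontrivial (F →L[ℂ] E) := ⟨T, 0, by rintro rfl; exact hv (by simpa using hT.symm)⟩
    exact finrank_pos
  have hdim : ∀ J : Finset (Fin N), J.card ≤ d + 1 →
      dimH {V : F →L[ℂ] E | ∃ q ∈ Θ J, G J q.1 (V q.2) = 0} ≤ (finrank ℝ (F →L[ℂ] E) - 1 : ℕ) := by
    intro J hJ
    have hG' : LocallyLipschitz fun y => (G J y).restrictScalars ℝ := by
      intro y
      obtain ⟨K, t, ht, hK⟩ := hG J y
      exact ⟨K, t, ht, fun y1 h1 y2 h2 => hK h1 h2⟩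
    refine dimH_setOf_bilin_le _ hG' (ContinuousLinearMap.restrictScalarsL ℂ F E ℝ ℝ).flip (Θ J)
      (fun _ => 0) (LipschitzWith.const 0).locallyLipschitz ?_
    rintro ⟨y, z⟩ ⟨hz, hR⟩
    -- Since `z ≠ 0`, evaluation at `z` is onto, so the equation on `V` has the full rank of the
    -- cut-off operator.
    have h1 : LinearMap.range ((((G J y).restrictScalars ℝ) ∘L
        (ContinuousLinearMap.restrictScalarsL ℂ F E ℝ ℝ).flip z : (F →L[ℂ] E) →L[ℝ] E) :
          (F →L[ℂ] E) →ₗ[ℝ] E) = (LinearMap.range (G J y : E →ₗ[ℂ] E)).restrictScalars ℝ := by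
      ext v
      simp only [LinearMap.mem_range, Submodule.restrictScalars_mem]
      constructor
      · rintro ⟨V, hV⟩
        exact ⟨_, hV⟩
      · rintro ⟨w, hw⟩
        obtain ⟨V, hV⟩ := exists_clm_apply_eq hz w
        refine ⟨V, ?_⟩
        rw [← hw, ← hV]
        rfl
    rw [h1]
    change _ < finrank ℝ (LinearMap.range (G J y : E →ₗ[ℂ] E))
    rw [finrank_real_of_complex F, finrank_real_of_complex (LinearMap.range (G J y : E →ₗ[ℂ] E))]
    simp only [finrank_fintype_fun_eq_card, Fintype.card_coe]
    simp only at hR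
    omega
  have hdense : Dense (⋃ J ∈ {J : Finset (Fin N) | J.card ≤ d + 1},
      {V : F →L[ℂ] E | ∃ q ∈ Θ J, G J q.1 (V q.2) = 0})ᶜ := by
    refine dense_compl_of_dimH_lt_finrank ?_
    rw [dimH_bUnion (Set.to_countable _)]
    refine (iSup₂_le (a := ((finrank ℝ (F →L[ℂ] E) - 1 : ℕ) : ENNReal)) fun J hJ =>
      hdim J hJ).trans_lt ?_
    exact_mod_cast Nat.sub_lt hWpos one_pos
  obtain ⟨V, hV⟩ := hdense.nonempty
  refine ⟨V, fun φ hφ hR z hz => ?_⟩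
  by_contra hz0
  refine hV (Set.mem_biUnion (x := Finset.univ.filter fun i => φ i ≠ 0) hφ ?_)
  have hsum : ∑ j : (Finset.univ.filter fun i => φ i ≠ 0 : Finset (Fin N)), φ j • a j =
      ∑ i, φ i • a i := by
    rw [Finset.sum_coe_sort (Finset.univ.filter fun i => φ i ≠ 0) (fun i => φ i • a i)]
    refine Finset.sum_filter_of_ne fun i _ h h0 => h ?_
    rw [h0, zero_smul]
  refine ⟨(fun j => φ j, z), ⟨hz0, ?_⟩, ?_⟩
  · subst hGdef
    rw [← hsum] at hR
    exact hR
  · simpa only [hGdef, hsum] using hz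

end Generic
end TracialAH

/-! ### Trivial subbundles with large Rayleigh quotient. -/

namespace TracialAH

section Rayleigh

variable {X : Type*} [TopologicalSpace X] [CompactSpace X] [T2Space X]
  {E F : Type*} [NormedAddCommGroup E] [InnerProductSpace ℂ E] [FiniteDimensional ℂ E]
  [NormedAddCommGroup F] [InnerProductSpace ℂ F] [FiniteDimensional ℂ F]

open Module

omit [FiniteDimensional ℂ E] in
theorem abs_re_inner_sub_le (a b : E →L[ℂ] E) (ξ : E) :
    |(inner ℂ (a ξ) ξ).re - (inner ℂ (b ξ) ξ).re| ≤ ‖a - b‖ * ‖ξ‖ ^ 2 := by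
  rw [← Complex.sub_re, ← inner_sub_left]
  refine (Complex.abs_re_le_norm _).trans ((norm_inner_le_norm _ _).trans ?_)
  have := (a - b).le_opNorm ξ
  rw [sub_apply] at this
  nlinarith [norm_nonneg ξ]

/-- Push a generic constant map `F → E` through the spectral cut-off of an approximation of `H`,
compress by `P`, and take the polar part. The cut-off has fibrewise rank at least `R` because it is
injective on `S`, so `exists_generic` keeps the composite injective over all of `X`. -/
theorem exists_isometry_of_rayleigh [Nonempty X] [Nontrivial F] {d R : ℕ}
    (hX : CoveringDimLE X d) (P H : C(X, E →L[ℂ] E)) (hP : ∀ t, IsStarProjection (P t))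
    (hH : ∀ t, IsSelfAdjoint (H t)) (hPH : ∀ t, P t * H t = H t) {θ θ' : ℝ} (hθ' : 0 < θ')
    (hθ : θ' < θ)
    (hS : ∀ t, ∃ S : Submodule ℂ E, R ≤ finrank ℂ S ∧
      ∀ ξ ∈ S, θ * ‖ξ‖ ^ 2 ≤ (inner ℂ (H t ξ) ξ).re)
    (hd : d + 1 + 2 * finrank ℂ F < 2 * R) :
    ∃ U : C(X, F →L[ℂ] E), (∀ t z, ‖U t z‖ = ‖z‖) ∧ (∀ t z, P t (U t z) = U t z) ∧
      ∀ t z, θ' * ‖z‖ ^ 2 ≤ (inner ℂ (H t (U t z)) (U t z)).re := by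
  have hE : Nontrivial E := by
    obtain ⟨t⟩ := ‹Nonempty X›
    obtain ⟨S, hS1, -⟩ := hS t
    have : 0 < finrank ℂ E := lt_of_lt_of_le (by omega) (hS1.trans (Submodule.finrank_le S))
    exact nontrivial_of_finrank_pos this
  -- The approximation error is `τ` and the cut is at `θ' + τ`. On the range of the cut-off `H`
  -- keeps quotient at least `θ'`, while on `S` the approximant has quotient at least `θ - τ = θ' +
  -- 3τ`, above the cut.
  set τ : ℝ := (θ - θ') / 4 with hτ
  have hτ0 : 0 < τ := by linarith
  obtain ⟨N, φ, x, -, -, hφc, hφa⟩ := exists_partition_approx hX H hτ0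
  obtain ⟨V, hV⟩ := exists_generic (F := F) (θ' + τ) (fun i => H (x i)) (fun i => hH _) hd
  have hsa : ∀ t, IsSelfAdjoint (∑ i, φ i t • H (x i)) := fun t =>
    isSelfAdjoint_sum _ fun i _ => IsSelfAdjoint.smul (star_trivial _) (hH _)
  have hclose : ∀ t ξ, |(inner ℂ ((∑ i, φ i t • H (x i)) ξ) ξ).re - (inner ℂ (H t ξ) ξ).re| ≤
      τ * ‖ξ‖ ^ 2 := fun t ξ => (abs_re_inner_sub_le _ _ ξ).trans <| by
    have := (hφa t).le
    gcongr
  have hcont : Continuous fun t => specCut (θ' + τ) (∑ i, φ i t • H (x i)) := by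
    have h1 : Continuous fun t => ∑ i, φ i t • H (x i) := by fun_prop
    refine continuous_iff_continuousAt.2 fun t₀ => ?_
    refine tendsto_iff_norm_sub_tendsto_zero.2 (squeeze_zero (fun _ => norm_nonneg _)
      (fun t => norm_specCut_sub_le _ (hsa t) (hsa t₀)) ?_)
    have h2 := (tendsto_iff_norm_sub_tendsto_zero.1 (h1.tendsto t₀)).const_mul
      (finrank ℂ E * finrank ℂ E : ℝ)
    rwa [mul_zero] at h2
  have hray : ∀ t z, θ' * ‖specCut (θ' + τ) (∑ i, φ i t • H (x i)) z‖ ^ 2 ≤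
      (inner ℂ (H t (specCut (θ' + τ) (∑ i, φ i t • H (x i)) z))
        (specCut (θ' + τ) (∑ i, φ i t • H (x i)) z)).re := by
    intro t z
    have h1 := le_re_inner_specCut (θ' + τ) (hsa t) z
    have h2 := (abs_le.1 (hclose t (specCut (θ' + τ) (∑ i, φ i t • H (x i)) z))).2
    nlinarith
  have hrank : ∀ t, R ≤ finrank ℂ (LinearMap.range
      (specCut (θ' + τ) (∑ i, φ i t • H (x i)) : E →ₗ[ℂ] E)) := by
    intro t
    obtain ⟨S, hS1, hS2⟩ := hS t
    refine hS1.trans ?_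
    set g := (specCut (θ' + τ) (∑ i, φ i t • H (x i)) : E →ₗ[ℂ] E)
    have hinj : Function.Injective (g ∘ₗ S.subtype) := by
      rw [← LinearMap.ker_eq_bot]
      refine LinearMap.ker_eq_bot'.2 fun ξ hξ => ?_
      have h1 := re_inner_le_of_specCut_eq_zero (hsa t) (ξ := (ξ : E)) hξ
      have h2 := hS2 ξ ξ.2
      have h3 := (abs_le.1 (hclose t ξ)).1
      have h4 : ‖(ξ : E)‖ ^ 2 ≤ 0 := by
        have : τ * ‖(ξ : E)‖ ^ 2 ≤ 0 := by
          have e : θ = θ' + 4 * τ := by rw [hτ]; ring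
          rw [e] at h2
          nlinarith [mul_nonneg hτ0.le (sq_nonneg ‖(ξ : E)‖)]
        nlinarith
      have h5 : ‖(ξ : E)‖ = 0 := pow_eq_zero_iff two_ne_zero |>.1 (le_antisymm h4 (sq_nonneg _))
      exact Subtype.ext (norm_eq_zero.1 h5)
    rw [← LinearMap.finrank_range_of_inj hinj]
    exact Submodule.finrank_mono (LinearMap.range_comp_le_range _ _)
  obtain ⟨U₀, hU₀⟩ : ∃ U₀ : C(X, F →L[ℂ] E), ∀ t, U₀ t =
      P t ∘L (specCut (θ' + τ) (∑ i, φ i t • H (x i)) ∘L V) :=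
    ⟨⟨_, P.continuous.clm_comp (hcont.clm_comp continuous_const)⟩, fun _ => rfl⟩
  have hPsa : ∀ t u v, inner ℂ (P t u) v = inner ℂ u (P t v) := fun t u v => by
    have := (hP t).isSelfAdjoint.isSymmetric u v
    exact this
  have hHP : ∀ t η, H t (P t η) = H t η := by
    intro t η
    have h1 : H t * P t = H t := by
      have := congrArg star (hPH t)
      rwa [star_mul, (hP t).isSelfAdjoint.star_eq, (hH t).star_eq] at this
    exact congrArg (fun f : E →L[ℂ] E => f η) h1
  have hPP : ∀ t η, P t (P t η) = P t η := fun t η =>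
    congrArg (fun f : E →L[ℂ] E => f η) (hP t).isIdempotentElem
  have hPle : ∀ t η, ‖P t η‖ ≤ ‖η‖ := fun t η => by
    have h := (P t).le_opNorm η
    have h2 : ‖P t‖ ≤ 1 := (hP t).norm_le
    nlinarith [norm_nonneg η]
  have hPHap : ∀ t η, P t (H t η) = H t η := fun t η =>
    congrArg (fun f : E →L[ℂ] E => f η) (hPH t)
  -- Since `H = PHP`, compressing a vector by `P` preserves its quadratic form and only decreases
  -- its norm.
  have hrayU : ∀ t z, θ' * ‖U₀ t z‖ ^ 2 ≤ (inner ℂ (H t (U₀ t z)) (U₀ t z)).re := by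
    intro t z
    simp only [hU₀, ContinuousLinearMap.comp_apply]
    rw [hHP, ← hPsa, hPHap]
    refine le_trans ?_ (hray t (V z))
    gcongr
    exact hPle _ _
  -- Compression by `P` loses no injectivity: a vector of the cut-off range killed by `P` has zero
  -- quadratic form, and `θ' > 0`.
  obtain ⟨s, hs⟩ := exists_isometrize U₀ fun t z hz => by
    refine hV (fun i => φ i t) (hφc t) (hrank t) z ?_
    have h1 := hray t (V z)
    simp only [hU₀, ContinuousLinearMap.comp_apply] at hz
    rw [← hHP, hz, map_zero, inner_zero_left, Complex.zero_re] at h1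
    have h4 : ‖specCut (θ' + τ) (∑ i, φ i t • H (x i)) (V z)‖ ^ 2 ≤ 0 := by nlinarith
    have h5 := pow_eq_zero_iff two_ne_zero |>.1 (le_antisymm h4 (sq_nonneg _))
    exact norm_eq_zero.1 h5
  refine ⟨⟨fun t => U₀ t ∘L s t, U₀.continuous.clm_comp s.continuous⟩, hs, fun t z => ?_,
    fun t z => ?_⟩
  · change P t (U₀ t (s t z)) = U₀ t (s t z)
    simp only [hU₀, ContinuousLinearMap.comp_apply, hPP]
  · change θ' * ‖z‖ ^ 2 ≤ (inner ℂ (H t (U₀ t (s t z))) (U₀ t (s t z))).re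
    rw [← hs t z]
    exact hrayU t (s t z)

end Rayleigh
end TracialAH

/-! ### Units near elements of `f C(X, B(K))` when `f` has large corank. -/

namespace TracialAH

section Lift

theorem isUnit_add_smul_one_sub {B : Type*} [Ring B] [Algebra ℂ B] {f : B}
    (hf : IsIdempotentElem f) {δ : ℂ} (hδ : δ ≠ 0) : IsUnit (f + δ • (1 - f)) := by
  have h1 : f * (1 - f) = 0 := by rw [mul_sub, mul_one, hf.eq, sub_self]
  have h2 : (1 - f) * f = 0 := by rw [sub_mul, one_mul, hf.eq, sub_self]
  have h3 : (1 - f) * (1 - f) = 1 - f := hf.one_sub.eq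
  have key : ∀ a b : ℂ, a * b = 1 → (f + a • (1 - f)) * (f + b • (1 - f)) = 1 := by
    intro a b hab
    simp only [add_mul, mul_add, mul_smul_comm, smul_mul_assoc, h1, h2, h3, hf.eq, smul_zero,
      add_zero, zero_add, smul_smul, mul_comm b a, hab, one_smul]
    abel
  exact ⟨⟨_, f + δ⁻¹ • (1 - f), key _ _ (mul_inv_cancel₀ hδ), key _ _ (inv_mul_cancel₀ hδ)⟩, rfl⟩

theorem isUnit_one_add_of_norm_lt {B : Type*} [NormedRing B] [CompleteSpace B] {x : B}
    (h : ‖x‖ < 1) : IsUnit (1 + x) := by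
  have := isUnit_one_sub_of_norm_lt_one (x := -x) (by rwa [norm_neg])
  rwa [sub_neg_eq_add] at this

/-- Lifting along a path: among right-invertible elements of `fB`, being of the form `f * u` with
`u` a unit is an open and closed condition, so it passes from `γ 1` to `γ 0`. Then `(f + δ(1 - f)) *
u` is a unit, close to `f * u` for small `δ`. -/
theorem exists_isUnit_near_of_path {B : Type*} [NormedRing B] [NormedAlgebra ℂ B]
    [CompleteSpace B] {f : B} (hf : IsIdempotentElem f) {γ : unitInterval → B} (hγ : Continuous γ)
    (hfγ : ∀ s, f * γ s = γ s) (hρ : ∀ s, ∃ ρ, γ s * ρ = f) (h1 : ∃ u, IsUnit u ∧ γ 1 = f * u)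
    {ε : ℝ} (hε : 0 < ε) : ∃ g, IsUnit g ∧ ‖g - γ 0‖ < ε := by
  have hloc : IsLocallyConstant fun s => ∃ u, IsUnit u ∧ γ s = f * u := by
    rw [IsLocallyConstant.iff_eventually_eq]
    intro s
    obtain ⟨ρ, hρs⟩ := hρ s
    have h2 : Tendsto (fun s' => ‖ρ * (γ s' - γ s)‖) (𝓝 s) (𝓝 0) := by
      have : Continuous fun s' => ‖ρ * (γ s' - γ s)‖ := by fun_prop
      simpa using this.tendsto s
    filter_upwards [h2.eventually (gt_mem_nhds one_pos)] with s' hs'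
    obtain ⟨w, hw⟩ := isUnit_one_add_of_norm_lt hs'
    -- Nearby points of the path differ by right multiplication by the unit `w = 1 + ρ (γ s' - γ
    -- s)`.
    have h3 : γ s * w = γ s' := by
      rw [hw, mul_add, ← mul_assoc, hρs, mul_sub, hfγ, hfγ, mul_one]
      abel
    refine propext ⟨?_, ?_⟩
    · rintro ⟨u, hu, he⟩
      refine ⟨u * ↑w⁻¹, hu.mul w⁻¹.isUnit, ?_⟩
      rw [← mul_assoc, ← he, ← h3, mul_assoc, w.mul_inv, mul_one]
    · rintro ⟨u, hu, he⟩
      exact ⟨u * w, hu.mul w.isUnit, by rw [← h3, he, mul_assoc]⟩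
  have h0 : ∃ u, IsUnit u ∧ γ 0 = f * u := by
    rw [hloc.apply_eq_of_preconnectedSpace 0 1]
    exact h1
  obtain ⟨u, hu, he⟩ := h0
  set δ : ℝ := ε / (‖(1 - f) * u‖ + 1) with hδ
  have hpos : 0 < ‖(1 - f) * u‖ + 1 := by positivity
  have hδ0 : 0 < δ := by positivity
  refine ⟨(f + (δ : ℂ) • (1 - f)) * u, (isUnit_add_smul_one_sub hf
    (by exact_mod_cast hδ0.ne')).mul hu, ?_⟩
  rw [he, add_mul, add_sub_cancel_left, smul_mul_assoc, norm_smul, Complex.norm_real,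
    Real.norm_of_nonneg hδ0.le, hδ, div_mul_eq_mul_div, div_lt_iff₀ hpos]
  nlinarith [norm_nonneg ((1 - f) * u)]

end Lift

section Generic

variable {K : Type*} [NormedAddCommGroup K] [InnerProductSpace ℂ K] [FiniteDimensional ℂ K]

open Module

/-- The same count with a homotopy parameter: `d + 1` coefficients, one more for `s`, and `2 rank f`
for `ξ`, against `2 dim K` equations. The parameter `s` makes the whole segment to `f` avoid the bad
set, not only its starting point. -/
theorem exists_generic_surjective {N d : ℕ} (f : K →L[ℂ] K) (c : Fin N → (K →L[ℂ] K))
    (hd : d + 2 + 2 * finrank ℂ (LinearMap.range (f : K →ₗ[ℂ] K)) < 2 * finrank ℂ K)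
    {ε : ℝ} (hε : 0 < ε) :
    ∃ G : K →L[ℂ] K, ‖G‖ < ε ∧ ∀ φ : Fin N → ℝ,
      (Finset.univ.filter fun i => φ i ≠ 0).card ≤ d + 1 → ∀ s : ℝ,
      ∀ ξ ∈ LinearMap.range (f : K →ₗ[ℂ] K),
        (1 - s) • (∑ i, φ i • c i) ξ + s • ξ + G ξ = 0 → ξ = 0 := by
  classical
  set Rg := LinearMap.range (f : K →ₗ[ℂ] K)
  let ev : Rg →L[ℝ] (K →L[ℂ] K) →L[ℝ] K :=
    (ContinuousLinearMap.restrictScalarsL ℂ K K ℝ ℝ).flip ∘L (Rg.subtypeL.restrictScalars ℝ)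
  let b : (J : Finset (Fin N)) → ((J → ℝ) × ℝ) × Rg → K := fun J q =>
    -((1 - q.1.2) • (∑ j : J, q.1.1 j • c j (q.2 : K)) + q.1.2 • (q.2 : K))
  let Θ : (J : Finset (Fin N)) → Set (((J → ℝ) × ℝ) × Rg) := fun J => {q | (q.2 : K) ≠ 0}
  have hb : ∀ J, LocallyLipschitz (b J) := by
    intro J
    have hsub : ContDiff ℝ 1 fun q : ((J → ℝ) × ℝ) × Rg => (q.2 : K) :=
      (Rg.subtypeL.restrictScalars ℝ).contDiff.comp contDiff_snd
    have hcj : ∀ j : J, ContDiff ℝ 1 fun q : ((J → ℝ) × ℝ) × Rg => c j (q.2 : K) := fun j =>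
      ((c j).restrictScalars ℝ).contDiff.comp hsub
    have hcoord : ∀ j : J, ContDiff ℝ 1 fun q : ((J → ℝ) × ℝ) × Rg => q.1.1 j := fun j => by
      fun_prop
    have h1 : ContDiff ℝ 1 fun q : ((J → ℝ) × ℝ) × Rg => q.1.2 := by fun_prop
    have h2 : ContDiff ℝ 1 fun q : ((J → ℝ) × ℝ) × Rg => 1 - q.1.2 := by fun_prop
    exact ContDiff.locallyLipschitz (𝕂 := ℝ) (ContDiff.neg (ContDiff.add (h2.smul
      (ContDiff.sum fun j _ => (hcoord j).smul (hcj j))) (h1.smul hsub)))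
  have hK : 0 < finrank ℂ K := by omega
  have hKn : Nontrivial K := nontrivial_of_finrank_pos hK
  have hWpos : 0 < finrank ℝ (K →L[ℂ] K) := finrank_pos
  have hdim : ∀ J : Finset (Fin N), J.card ≤ d + 1 →
      dimH {V : K →L[ℂ] K | ∃ q ∈ Θ J, V q.2 = b J q} ≤ (finrank ℝ (K →L[ℂ] K) - 1 : ℕ) := by
    intro J hJ
    refine dimH_setOf_bilin_le (fun _ : (J → ℝ) × ℝ => ContinuousLinearMap.id ℝ K)
      (LipschitzWith.const _).locallyLipschitz ev (Θ J) (b J) (hb J) ?_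
    rintro ⟨y, z⟩ hz
    have h1 : LinearMap.range ((ContinuousLinearMap.id ℝ K ∘L ev z : (K →L[ℂ] K) →L[ℝ] K) :
        (K →L[ℂ] K) →ₗ[ℝ] K) = ⊤ := by
      rw [LinearMap.range_eq_top]
      intro v
      obtain ⟨T, hT⟩ := exists_clm_apply_eq hz v
      exact ⟨T, hT⟩
    rw [h1, finrank_top, Module.finrank_prod, finrank_real_of_complex K,
      finrank_real_of_complex Rg, finrank_self]
    simp only [finrank_fintype_fun_eq_card, Fintype.card_coe]
    omega
  have hdense : Dense (⋃ J ∈ {J : Finset (Fin N) | J.card ≤ d + 1},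
      {V : K →L[ℂ] K | ∃ q ∈ Θ J, V q.2 = b J q})ᶜ := by
    refine dense_compl_of_dimH_lt_finrank ?_
    rw [dimH_bUnion (Set.to_countable _)]
    refine (iSup₂_le (a := ((finrank ℝ (K →L[ℂ] K) - 1 : ℕ) : ENNReal)) fun J hJ =>
      hdim J hJ).trans_lt ?_
    exact_mod_cast Nat.sub_lt hWpos one_pos
  obtain ⟨G, hG, hGε⟩ := hdense.exists_dist_lt 0 hε
  refine ⟨G, by rwa [dist_zero_left] at hGε, fun φ hφ s ξ hξ he => ?_⟩
  by_contra hξ0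
  refine hG (Set.mem_biUnion (x := Finset.univ.filter fun i => φ i ≠ 0) hφ
    ⟨((fun j => φ j, s), ⟨ξ, hξ⟩), hξ0, ?_⟩)
  have hsum : ∑ j : (Finset.univ.filter fun i => φ i ≠ 0 : Finset (Fin N)), φ j • c j ξ =
      (∑ i, φ i • c i) ξ := by
    rw [Finset.sum_coe_sort (Finset.univ.filter fun i => φ i ≠ 0) (fun i => φ i • c i ξ), sum_apply]
    refine Finset.sum_filter_of_ne fun i _ h h0 => h ?_
    rw [h0, zero_smul]
  change G ξ = -((1 - s) • (∑ j : (Finset.univ.filter fun i => φ i ≠ 0 : Finset (Fin N)),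
    φ j • c j ξ) + s • ξ)
  rw [hsum]
  exact eq_neg_of_add_eq_zero_right he

/-- The right inverse is `T⋆ (TT⋆ + 1 - f)⁻¹`. -/
theorem exists_right_inverse_of_isUnit {X B : Type*} [TopologicalSpace X] [CompactSpace X]
    [CStarAlgebra B] (f T : C(X, B)) (hf : IsIdempotentElem f) (hfT : f * T = T)
    (h : ∀ t, IsUnit (T t * star (T t) + (1 - f t))) : ∃ ρ, T * ρ = f := by
  obtain ⟨w, hw⟩ := (ContinuousMap.isUnit_iff_forall_isUnit (T * star T + (1 - f))).2 h
  refine ⟨star T * ↑w⁻¹, ?_⟩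
  have h1 : f * w = T * star T := by
    rw [hw, mul_add, ← mul_assoc, hfT, mul_sub, mul_one, hf.eq, sub_self, add_zero]
  rw [← mul_assoc, ← h1, mul_assoc, w.mul_inv, mul_one]

theorem exists_isUnit_near_of_generic {X B : Type*} [TopologicalSpace X] [CompactSpace X]
    [CStarAlgebra B] {f : B} (hf : IsStarProjection f) (c c' : C(X, B))
    (hfc : ∀ t, f * c' t = c' t) {ε : ℝ} (hε : 0 < ε) (hcc : ∀ t, ‖c' t - c t‖ ≤ ε / 4) (G : B)
    (hG : ‖G‖ < min (ε / 4) (1 / 2))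
    (h : ∀ (s : unitInterval) (t : X), IsUnit
      ((((1 - (s : ℝ) : ℝ) : ℂ) • c' t + ((s : ℝ) : ℂ) • f + f * star G) *
        star (((1 - (s : ℝ) : ℝ) : ℂ) • c' t + ((s : ℝ) : ℂ) • f + f * star G) + (1 - f))) :
    ∃ g : C(X, B), IsUnit g ∧ ‖g - c‖ < ε := by
  set fC : C(X, B) := ContinuousMap.const X f
  set GC : C(X, B) := ContinuousMap.const X (star G)
  have hfC : IsIdempotentElem fC := ContinuousMap.ext fun _ => hf.isIdempotentElem
  have hfc' : fC * c' = c' := ContinuousMap.ext hfc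
  have hGC : ‖GC‖ ≤ min (ε / 4) (1 / 2) :=
    (ContinuousMap.norm_le _ (by positivity)).2 fun t => by
      change ‖star G‖ ≤ _
      rw [norm_star]
      exact hG.le
  have hfCn : ‖fC‖ ≤ 1 := (ContinuousMap.norm_le _ zero_le_one).2 fun t => hf.norm_le
  -- The path joins a perturbation of `c` to `f (1 + G⋆)`, which has the form `f` times a unit
  -- because `‖G‖ < 1/2`.
  let γ : unitInterval → C(X, B) := fun s =>
    (((1 - (s : ℝ) : ℝ) : ℂ) • c' + ((s : ℝ) : ℂ) • fC) + fC * GC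
  have hγ : Continuous γ := by
    have h1 : Continuous fun s : unitInterval => ((1 - (s : ℝ) : ℝ) : ℂ) := by fun_prop
    have h2 : Continuous fun s : unitInterval => ((s : ℝ) : ℂ) := by fun_prop
    exact ((h1.smul continuous_const).add (h2.smul continuous_const)).add continuous_const
  have hfγ : ∀ s, fC * γ s = γ s := fun s => by
    simp only [γ, mul_add, mul_smul_comm, hfc', hfC.eq]
    rw [← mul_assoc, hfC.eq]
  have h0 : ‖γ 0 - c‖ ≤ ε / 4 + ε / 4 := by
    have e1 : γ 0 - c = (c' - c) + fC * GC := by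
      have z : ((0 : unitInterval) : ℝ) = 0 := rfl
      simp only [γ, z, sub_zero, Complex.ofReal_one, one_smul, Complex.ofReal_zero, zero_smul,
        add_zero]
      abel
    rw [e1]
    refine (norm_add_le _ _).trans (add_le_add ?_ ?_)
    · refine (ContinuousMap.norm_le _ (by positivity)).2 fun t => ?_
      exact hcc t
    · refine (norm_mul_le _ _).trans ?_
      have := hGC.trans (min_le_left _ _)
      nlinarith [norm_nonneg GC]
  have h1 : ∃ u, IsUnit u ∧ γ 1 = fC * u := by
    refine ⟨1 + GC, isUnit_one_add_of_norm_lt ?_, ?_⟩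
    · have := hGC.trans (min_le_right _ _)
      linarith
    · have z : ((1 : unitInterval) : ℝ) = 1 := rfl
      simp only [γ, z, sub_self, Complex.ofReal_zero, zero_smul, zero_add,
        Complex.ofReal_one, one_smul, mul_add, mul_one]
  obtain ⟨g, hg, hgn⟩ := exists_isUnit_near_of_path hfC hγ hfγ
    (fun s => exists_right_inverse_of_isUnit fC (γ s) hfC (hfγ s) (h s)) h1
    (ε := ε / 4) (by linarith)
  refine ⟨g, hg, ?_⟩
  calc ‖g - c‖ = ‖(g - γ 0) + (γ 0 - c)‖ := by congr 1; abel
    _ ≤ ‖g - γ 0‖ + ‖γ 0 - c‖ := norm_add_le _ _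
    _ < ε := by linarith

theorem isUnit_mul_star_add {T f : K →L[ℂ] K} (hf : IsStarProjection f)
    (h : ∀ ξ, f ξ = ξ → star T ξ = 0 → ξ = 0) : IsUnit (T * star T + (1 - f)) := by
  refine isUnit_of_injective fun ξ hξ => ?_
  have h1 : inner ℂ ξ ((T * star T) ξ) = (‖star T ξ‖ : ℂ) ^ 2 := by
    have : inner ℂ ξ ((T * star T) ξ) = inner ℂ (star T ξ) (star T ξ) := by
      rw [ContinuousLinearMap.star_eq_adjoint, ContinuousLinearMap.adjoint_inner_left]
      rfl
    rw [this]
    exact inner_self_eq_norm_sq_to_K (𝕜 := ℂ) _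
  have h2 : inner ℂ ξ ((1 - f) ξ) = (‖(1 - f) ξ‖ : ℂ) ^ 2 := by
    have e1 : (1 - f) ((1 - f) ξ) = (1 - f) ξ :=
      congrArg (fun g : K →L[ℂ] K => g ξ) hf.one_sub.isIdempotentElem
    have e2 : inner ℂ ((1 - f) ξ) ((1 - f) ξ) = inner ℂ ξ ((1 - f) ((1 - f) ξ)) :=
      hf.one_sub.isSelfAdjoint.isSymmetric ξ ((1 - f) ξ)
    rw [e1] at e2
    rw [← e2]
    exact inner_self_eq_norm_sq_to_K (𝕜 := ℂ) _
  have h3 : inner ℂ ξ ((T * star T + (1 - f)) ξ) = 0 := by rw [hξ, inner_zero_right]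
  rw [add_apply, inner_add_right, h1, h2] at h3
  have h4 : ‖star T ξ‖ ^ 2 + ‖(1 - f) ξ‖ ^ 2 = 0 := by exact_mod_cast h3
  have h5 : ‖star T ξ‖ ^ 2 = 0 := by nlinarith [sq_nonneg ‖star T ξ‖, sq_nonneg ‖(1 - f) ξ‖]
  have h6 : ‖(1 - f) ξ‖ ^ 2 = 0 := by nlinarith [sq_nonneg ‖star T ξ‖, sq_nonneg ‖(1 - f) ξ‖]
  have h7 := norm_eq_zero.1 (pow_eq_zero_iff two_ne_zero |>.1 h5)
  have h8 := norm_eq_zero.1 (pow_eq_zero_iff two_ne_zero |>.1 h6)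
  refine h ξ ?_ h7
  rw [sub_apply, sub_eq_zero] at h8
  exact h8.symm

/-- Apply the generic choice to the adjoints: injectivity of the adjoint on the range of `f` is
right invertibility relative to `f`, and this holds along the whole segment from the perturbed
approximant of `c`. -/
theorem exists_isUnit_near {X : Type*} [TopologicalSpace X] [CompactSpace X] [T2Space X] {d : ℕ}
    (hX : CoveringDimLE X d) {f : K →L[ℂ] K} (hf : IsStarProjection f)
    (hd : d + 2 + 2 * finrank ℂ (LinearMap.range (f : K →ₗ[ℂ] K)) < 2 * finrank ℂ K)
    (c : C(X, K →L[ℂ] K)) (hc : ∀ t, f * c t = c t) {ε : ℝ} (hε : 0 < ε) :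
    ∃ g : C(X, K →L[ℂ] K), IsUnit g ∧ ‖g - c‖ < ε := by
  obtain ⟨N, φ, x, -, -, hφc, hφa⟩ := exists_partition_approx hX c (τ := ε / 4) (by linarith)
  obtain ⟨G, hG, hGs⟩ := exists_generic_surjective f (fun i => star (c (x i))) hd
    (ε := min (ε / 4) (1 / 2)) (by positivity)
  obtain ⟨c', hc'⟩ : ∃ c' : C(X, K →L[ℂ] K), ∀ t, c' t = ∑ i, φ i t • c (x i) :=
    ⟨⟨fun t => ∑ i, φ i t • c (x i), by fun_prop⟩, fun _ => rfl⟩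
  refine exists_isUnit_near_of_generic hf c c' (fun t => ?_) hε (fun t => ?_) G hG fun s t => ?_
  · rw [hc', Finset.mul_sum]
    exact Finset.sum_congr rfl fun i _ => by rw [mul_smul_comm, hc]
  · rw [hc']
    exact (hφa t).le
  · refine isUnit_mul_star_add hf fun ξ hξ hT => ?_
    refine hGs (fun i => φ i t) (hφc t) s ξ ⟨ξ, hξ⟩ ?_
    have e2 : star (((1 - (s : ℝ) : ℝ) : ℂ) • c' t + ((s : ℝ) : ℂ) • f + f * star G) =
        ((1 - (s : ℝ) : ℝ) : ℂ) • star (c' t) + ((s : ℝ) : ℂ) • f + G * f := by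
      rw [star_add, star_add, star_smul, star_smul, star_mul, star_star,
        hf.isSelfAdjoint.star_eq]
      simp
    have e3 : star (c' t) = ∑ i, φ i t • star (c (x i)) := by
      rw [hc', star_sum]
      exact Finset.sum_congr rfl fun i _ => by rw [star_smul, star_trivial]
    rw [e2, e3] at hT
    have e4 : (G * f) ξ = G ξ := congrArg G hξ
    rw [add_apply, add_apply, smul_apply, smul_apply, hξ, e4] at hT
    exact hT

end Generic
end TracialAH

/-! ### Schur complements and transport between corners. -/

namespace TracialAH

section Schur

theorem norm_corner_le {B : Type*} [CStarAlgebra B] {p q x : B} (hp : ‖p‖ ≤ 1) (hq : ‖q‖ ≤ 1) :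
    ‖p * x * q‖ ≤ ‖x‖ :=
  calc ‖p * x * q‖ ≤ ‖p‖ * ‖x‖ * ‖q‖ := norm_mul₃_le
    _ ≤ 1 * ‖x‖ * 1 := by gcongr
    _ = ‖x‖ := by ring

/-- `g` is nearly block diagonal with block `R` on the corner of `R`. A column operation clears the
remaining entry in the row of `R`, and the Schur complement is the desired invertible element of the
corner of `1 - R`. -/
theorem exists_corner_inverse {B : Type*} [CStarAlgebra B] {g R a : B} (hg : IsUnit g)
    (hR : IsStarProjection R) (hRa : R * a = 0) (haR : a * R = 0) {η : ℝ} (hη : η ≤ 1 / 2)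
    (h : ‖g - (a + R)‖ < η) :
    ∃ g' g'', R * g' = 0 ∧ g' * R = 0 ∧ R * g'' = 0 ∧ g'' * R = 0 ∧ g' * g'' = 1 - R ∧
      g'' * g' = 1 - R ∧ ‖g' - a‖ ≤ 2 * η := by
  obtain ⟨N, hN⟩ : ∃ N, N = 1 - R := ⟨_, rfl⟩
  have hRR : R * R = R := hR.isIdempotentElem
  have hNN : N * N = N := by rw [hN]; exact hR.one_sub.isIdempotentElem
  have hRN : R * N = 0 := by rw [hN, mul_sub, mul_one, hRR, sub_self]
  have hNR : N * R = 0 := by rw [hN, sub_mul, one_mul, hRR, sub_self]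
  have hNa : N * a = a := by rw [hN, sub_mul, one_mul, hRa, sub_zero]
  have haN : a * N = a := by rw [hN, mul_sub, mul_one, haR, sub_zero]
  have hRn : ‖R‖ ≤ 1 := hR.norm_le
  have hNn : ‖N‖ ≤ 1 := by rw [hN]; exact hR.one_sub.norm_le
  have hRN1 : R + N = 1 := by rw [hN]; abel
  obtain ⟨e, he⟩ : ∃ e, e = g - (a + R) := ⟨_, rfl⟩
  have hge : g = a + R + e := by rw [he]; abel
  rw [← he] at h
  have hη0 : 0 < η := (norm_nonneg _).trans_lt h
  have hReR : ‖R * e * R‖ < 1 := (norm_corner_le hRn hRn).trans_lt (by linarith)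
  obtain ⟨r, hr⟩ := isUnit_one_add_of_norm_lt hReR
  have hr' : (r : B) = R * g * R + N := by
    rw [hr, hge, ← hRN1]
    simp only [mul_add, add_mul, hRa, hRR, zero_add]
    abel
  obtain ⟨s, hs⟩ : ∃ s, s = ((r⁻¹ : Bˣ) : B) := ⟨_, rfl⟩
  have hrs : (R * g * R + N) * s = 1 := by rw [← hr', hs]; exact r.mul_inv
  have hsr : s * (R * g * R + N) = 1 := by rw [← hr', hs]; exact r.inv_mul
  have hNs : N * s = N := by
    have := congrArg (N * ·) hrs
    simp only [mul_one] at this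
    rwa [← mul_assoc, mul_add, mul_assoc R g R, ← mul_assoc N R, hNR, zero_mul, zero_add, hNN] at this
  have hsN : s * N = N := by
    have := congrArg (· * N) hsr
    simp only [one_mul] at this
    rwa [mul_assoc, add_mul, mul_assoc _ R N, hRN, mul_zero, zero_add, hNN] at this
  have hRs : R * s = s * R := by
    have h1 : R = 1 - N := by rw [hN]; abel
    rw [h1, sub_mul, mul_sub, hNs, hsN, one_mul, mul_one]
  have hRgRs : R * g * R * s = R := by
    have := hrs
    rw [add_mul, hNs] at this
    rw [eq_sub_of_add_eq this, hN]
    abel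
  have hsn : ‖s‖ ≤ 2 := by
    have h1 : s = 1 - R * e * R * s := by
      have : (1 + R * e * R) * s = 1 := by rw [← hr, hs]; exact r.mul_inv
      rw [add_mul, one_mul] at this
      exact eq_sub_of_add_eq this
    have h2 : ‖(1 : B)‖ ≤ 1 := IsStarProjection.norm_le (1 : B) (.one B)
    have h3 : ‖R * e * R * s‖ ≤ 1 / 2 * ‖s‖ := by
      refine (norm_mul_le _ _).trans ?_
      gcongr
      exact (norm_corner_le hRn hRn).trans (by linarith)
    have h4 : ‖s‖ ≤ 1 + 1 / 2 * ‖s‖ := by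
      conv_lhs => rw [h1]
      exact (norm_sub_le _ _).trans (add_le_add h2 h3)
    linarith
  -- The element `x` has square zero, so `1 - x` is a unit, and it is chosen to make `R g (1 - x) N`
  -- vanish; `s` inverts the block `R g R`.
  obtain ⟨x, hx⟩ : ∃ x, x = s * R * g * N := ⟨_, rfl⟩
  have hxR : x * R = 0 := by rw [hx, mul_assoc, hNR, mul_zero]
  have hRx : R * x = x := by
    rw [hx, ← mul_assoc, ← mul_assoc, ← mul_assoc, hRs, mul_assoc s R R, hRR]
  have hxN : x * N = x := by rw [hx, mul_assoc, hNN]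
  have hxx : x * x = 0 := by
    calc x * x = x * (R * x) := by rw [hRx]
      _ = 0 := by rw [← mul_assoc, hxR, zero_mul]
  have hu : IsUnit (1 - x) :=
    ⟨⟨1 - x, 1 + x, by
      have : (1 - x) * (1 + x) = 1 - x * x := by noncomm_ring
      rw [this, hxx, sub_zero], by
      have : (1 + x) * (1 - x) = 1 - x * x := by noncomm_ring
      rw [this, hxx, sub_zero]⟩, rfl⟩
  obtain ⟨w, hw⟩ := hg.mul hu
  obtain ⟨k, hk⟩ : ∃ k, k = ((w⁻¹ : Bˣ) : B) := ⟨_, rfl⟩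
  have hwk : g * (1 - x) * k = 1 := by rw [← hw, hk]; exact w.mul_inv
  have hkw : k * (g * (1 - x)) = 1 := by rw [← hw, hk]; exact w.inv_mul
  obtain ⟨g₁, hg₁⟩ : ∃ g₁, g₁ = g * (1 - x) := ⟨_, rfl⟩
  rw [← hg₁] at hwk hkw
  have hg₁R : g₁ * R = g * R := by rw [hg₁, mul_assoc, sub_mul, one_mul, hxR, sub_zero]
  have hRgx : R * g * x = R * g * N := by
    calc R * g * x = R * g * R * s * R * g * N := by
          conv_lhs => rw [← hRx, hx]
          simp only [mul_assoc]
      _ = R * g * N := by rw [hRgRs, hRR]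
  have hRg₁N : R * g₁ * N = 0 := by
    rw [hg₁, mul_assoc, mul_assoc, sub_mul, one_mul, hxN, mul_sub, mul_sub, ← mul_assoc R g x, hRgx,
      mul_assoc, sub_self]
  -- The inverse of a block triangular element is triangular because the block `R g R` is invertible
  -- in its corner.
  have hRkN : R * k * N = 0 := by
    have h1 : R * g * R * (R * k * N) = 0 := by
      calc R * g * R * (R * k * N) = R * (g₁ * R) * (R * k * N) := by rw [hg₁R, ← mul_assoc R g R]
        _ = R * g₁ * (R * R) * k * N := by simp only [mul_assoc]
        _ = R * g₁ * (1 - N) * k * N := by rw [hRR, hN, sub_sub_cancel]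
        _ = R * (g₁ * k) * N - R * g₁ * N * k * N := by
            simp only [mul_sub, sub_mul, mul_one, mul_assoc]
        _ = 0 := by rw [hwk, hRg₁N, mul_one, hRN, zero_mul, zero_mul, sub_zero]
    have h2 : (R * g * R + N) * (R * k * N) = 0 := by
      rw [add_mul, h1, zero_add, ← mul_assoc, ← mul_assoc, hNR, zero_mul, zero_mul]
    calc R * k * N = s * (R * g * R + N) * (R * k * N) := by rw [hsr, one_mul]
      _ = 0 := by rw [mul_assoc, h2, mul_zero]
  refine ⟨N * g₁ * N, N * k * N, ?_, ?_, ?_, ?_, ?_, ?_, ?_⟩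
  · rw [← mul_assoc, ← mul_assoc, hRN, zero_mul, zero_mul]
  · rw [mul_assoc, hNR, mul_zero]
  · rw [← mul_assoc, ← mul_assoc, hRN, zero_mul, zero_mul]
  · rw [mul_assoc, hNR, mul_zero]
  · calc N * g₁ * N * (N * k * N) = N * g₁ * (N * N) * k * N := by simp only [mul_assoc]
      _ = N * g₁ * (1 - R) * k * N := by rw [hNN, hN]
      _ = N * (g₁ * k) * N - N * g₁ * (R * k * N) := by
          simp only [mul_sub, sub_mul, mul_one, mul_assoc]
      _ = 1 - R := by rw [hwk, hRkN, mul_one, hNN, mul_zero, sub_zero, hN]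
  · calc N * k * N * (N * g₁ * N) = N * k * (N * N) * g₁ * N := by simp only [mul_assoc]
      _ = N * k * (1 - R) * g₁ * N := by rw [hNN, hN]
      _ = N * (k * g₁) * N - N * k * (R * g₁ * N) := by
          simp only [mul_sub, sub_mul, mul_one, mul_assoc]
      _ = 1 - R := by rw [hkw, hRg₁N, mul_one, hNN, mul_zero, sub_zero, hN]
  · have h1 : N * g₁ * N - a = N * e * N - N * e * R * s * (R * e * N) := by
      have e1 : N * g * N = a + N * e * N := by
        rw [hge]
        simp only [mul_add, add_mul, hNa, haN, hNR, add_zero]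
      have e2 : N * g * R = N * e * R := by
        rw [hge]
        simp only [mul_add, add_mul, hNa, haR, hNR, zero_mul, zero_add]
      have e3 : R * g * N = R * e * N := by
        rw [hge]
        simp only [mul_add, add_mul, hRa, hRR, hRN, zero_add]
      have e4 : N * g * x * N = N * g * R * s * (R * g * N) := by
        rw [mul_assoc _ x N, hxN]
        conv_lhs => rw [← hRx, hx]
        have : s * R = s * R * R := by rw [mul_assoc, hRR]
        simp only [mul_assoc]
      rw [hg₁, mul_sub, mul_sub, mul_one, sub_mul, ← mul_assoc, e4, e1, e2, e3]
      abel
    rw [h1]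
    have n1 : ‖N * e * N‖ ≤ η := (norm_corner_le hNn hNn).trans h.le
    have n2 : ‖N * e * R‖ ≤ η := (norm_corner_le hNn hRn).trans h.le
    have n3 : ‖R * e * N‖ ≤ 1 / 2 := (norm_corner_le hRn hNn).trans (by linarith)
    have n4 : ‖N * e * R * s * (R * e * N)‖ ≤ η * 2 * (1 / 2) :=
      norm_mul₃_le.trans (by gcongr)
    refine (norm_sub_le _ _).trans ?_
    linarith

/-- `u` embeds `1 - f` into `e`, so `q + u` carries the corner of `1 - (f - q) = q + (1 - f)` into
that of `q + e`, fixing `c`. Thus invertibility obtained after adding the auxiliary summand `1 - f`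
is brought back inside `q + e`. -/
theorem exists_corner_inverse_of_partialIsometry {B : Type*} [CStarAlgebra B] {f q e u c : B}
    (hf : IsStarProjection f) (hq : IsStarProjection q) (he : IsStarProjection e)
    (hfq : f * q = q) (hqe : q * e = 0) (hu : star u * u = 1 - f) (heu : e * u = u)
    (hqc : q * c = c) (hcq : c * q = c)
    (hc : ∀ η : ℝ, 0 < η → ∃ g, IsUnit g ∧ ‖g - (c + (f - q))‖ < η) {ε : ℝ} (hε : 0 < ε) :
    ∃ c' c'', (q + e) * c' = c' ∧ c' * (q + e) = c' ∧ (q + e) * c'' = c'' ∧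
      c'' * (q + e) = c'' ∧ c' * c'' = q + e ∧ c'' * c' = q + e ∧ ‖c' - c‖ < ε := by
  have hqq : q * q = q := hq.isIdempotentElem
  have hee : e * e = e := he.isIdempotentElem
  have hqs : star q = q := hq.isSelfAdjoint
  have hes : star e = e := he.isSelfAdjoint
  have hff : f * f = f := hf.isIdempotentElem
  have hqf : q * f = q := by
    have := congrArg star hfq
    rwa [star_mul, hqs, hf.isSelfAdjoint.star_eq] at this
  have heq : e * q = 0 := by
    have := congrArg star hqe
    rwa [star_mul, hqs, hes, star_zero] at this
  have hqu : q * u = 0 := by rw [← heu, ← mul_assoc, hqe, zero_mul]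
  have huf : u * f = 0 := by
    rw [← norm_eq_zero, ← mul_self_eq_zero, ← CStarRing.norm_star_mul_self, star_mul,
      hf.isSelfAdjoint.star_eq, mul_assoc, ← mul_assoc (star u), hu, sub_mul, one_mul, hff,
      sub_self, mul_zero, norm_zero]
  have huq : u * q = 0 := by rw [← hfq, ← mul_assoc, huf, zero_mul]
  have hqu' : q * star u = 0 := by
    have := congrArg star huq
    rwa [star_mul, hqs, star_zero] at this
  have huq' : star u * q = 0 := by
    have := congrArg star hqu
    rwa [star_mul, hqs, star_zero] at this
  have heu' : star u * e = star u := by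
    have := congrArg star heu
    rwa [star_mul, hes] at this
  obtain ⟨R, hRdef⟩ : ∃ R, R = f - q := ⟨_, rfl⟩
  have hR : IsStarProjection R := by
    rw [hRdef]
    constructor
    · change (f - q) * (f - q) = f - q
      rw [sub_mul, mul_sub, mul_sub, hff, hfq, hqf, hqq]
      abel
    · exact hf.isSelfAdjoint.sub hq.isSelfAdjoint
  obtain ⟨g, hg, hgn⟩ := hc (min (ε / 8) (1 / 2)) (by positivity)
  rw [← hRdef] at hgn
  have hRc : R * c = 0 := by
    rw [hRdef, ← hqc, ← mul_assoc, sub_mul, hfq, hqq, sub_self, zero_mul]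
  have hcR : c * R = 0 := by
    rw [hRdef, ← hcq, mul_assoc, mul_sub, hqf, hqq, sub_self, mul_zero]
  obtain ⟨g', g'', h1, h2, h3, h4, h5, h6, h7⟩ :=
    exists_corner_inverse hg hR hRc hcR (min_le_right _ _) hgn
  have hMM : (q + u) * (q + star u) = q + u * star u := by
    rw [add_mul, mul_add, mul_add, hqq, hqu', huq, add_zero, zero_add]
  have hMM' : (q + star u) * (q + u) = 1 - R := by
    rw [add_mul, mul_add, mul_add, hqq, hqu, huq', add_zero, zero_add, hu, hRdef]
    abel
  have key : ∀ a : B, R * a = 0 → (q + star u) * (q + u) * a = a := fun a ha => by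
    rw [hMM', sub_mul, one_mul, ha, sub_zero]
  have huu : u * star u * u = u := by
    rw [mul_assoc, hu, mul_sub, mul_one, huf, sub_zero]
  -- The part `z` of `e` not covered by `u` is filled with the scalar `ε/4`; the transported part
  -- contributes at most `2 · ε/8`.
  obtain ⟨z, hz⟩ : ∃ z, z = e - u * star u := ⟨_, rfl⟩
  have hqz : q * z = 0 := by rw [hz, mul_sub, hqe, ← mul_assoc, hqu, zero_mul, sub_zero]
  have hzq : z * q = 0 := by rw [hz, sub_mul, heq, mul_assoc, huq', mul_zero, sub_zero]
  have huz : star u * z = 0 := by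
    have : star u * u * star u = star u := by
      have := congrArg star huu
      rwa [star_mul, star_mul, star_star, ← mul_assoc] at this
    rw [hz, mul_sub, heu', ← mul_assoc, this, sub_self]
  have hzu : z * u = 0 := by rw [hz, sub_mul, heu, huu, sub_self]
  have hez : e * z = z := by rw [hz, mul_sub, hee, ← mul_assoc, heu]
  have hze : z * e = z := by rw [hz, sub_mul, hee, mul_assoc, heu']
  have hzz : z * z = z := by
    calc z * z = (e - u * star u) * z := by rw [← hz]
      _ = z := by rw [sub_mul, hez, mul_assoc, huz, mul_zero, sub_zero]
  have hzp : IsStarProjection z := ⟨hzz, by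
    rw [hz]; exact he.isSelfAdjoint.sub (.mul_star_self u)⟩
  have hMz : (q + star u) * z = 0 := by rw [add_mul, hqz, huz, add_zero]
  have hzM : z * (q + u) = 0 := by rw [mul_add, hzq, hzu, add_zero]
  have hpe : q + e = q + u * star u + z := by rw [hz]; abel
  have hPM : (q + e) * (q + u) = q + u := by
    rw [add_mul, mul_add, mul_add, hqq, hqu, heq, heu, add_zero, zero_add]
  have hMP : (q + star u) * (q + e) = q + star u := by
    rw [add_mul, mul_add, mul_add, hqq, hqe, huq', heu', add_zero, zero_add]
  have hPz : (q + e) * z = z := by rw [add_mul, hqz, hez, zero_add]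
  have hzP : z * (q + e) = z := by rw [mul_add, hzq, hze, zero_add]
  have prod : ∀ (a b : B) (α β : ℂ), R * b = 0 → a * b = 1 - R → α * β = 1 →
      ((q + u) * a * (q + star u) + α • z) * ((q + u) * b * (q + star u) + β • z) = q + e := by
    intro a b α β hb hab hαβ
    have t1 : (q + u) * a * (q + star u) * ((q + u) * b * (q + star u)) = q + u * star u := by
      calc (q + u) * a * (q + star u) * ((q + u) * b * (q + star u)) =
          (q + u) * (a * ((q + star u) * (q + u) * b)) * (q + star u) := by simp only [mul_assoc]
        _ = (q + u) * ((q + star u) * (q + u)) * (q + star u) := by rw [key b hb, hab, hMM']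
        _ = ((q + u) * (q + star u)) * ((q + u) * (q + star u)) := by simp only [mul_assoc]
        _ = q + u * star u := by
            rw [hMM, add_mul, mul_add, mul_add, hqq, ← mul_assoc, hqu, mul_assoc u, huq',
              ← mul_assoc _ u, huu]
            simp
    have t2 : (q + u) * a * (q + star u) * (β • z) = 0 := by
      rw [mul_smul_comm, mul_assoc, hMz, mul_zero, smul_zero]
    have t3 : (α • z) * ((q + u) * b * (q + star u)) = 0 := by
      rw [smul_mul_assoc, ← mul_assoc, ← mul_assoc, hzM, zero_mul, zero_mul, smul_zero]
    have t4 : (α • z) * (β • z) = z := by rw [smul_mul_smul_comm, hαβ, hzz, one_smul]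
    have t5 : ∀ a b c d : B, (a + c) * (b + d) = a * b + a * d + (c * b + c * d) := by
      intros
      noncomm_ring
    rw [t5, t1, t2, t3, t4, hpe, add_zero, zero_add]
  have cornerL : ∀ (a : B) (α : ℂ), (q + e) * ((q + u) * a * (q + star u) + α • z) =
      (q + u) * a * (q + star u) + α • z := fun a α => by
    rw [mul_add, ← mul_assoc, ← mul_assoc, hPM, mul_smul_comm, hPz]
  have cornerR : ∀ (a : B) (α : ℂ), ((q + u) * a * (q + star u) + α • z) * (q + e) =
      (q + u) * a * (q + star u) + α • z := fun a α => by
    rw [add_mul, mul_assoc, hMP, smul_mul_assoc, hzP]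
  have hα : ((ε / 4 : ℝ) : ℂ) ≠ 0 := by
    have : ε / 4 ≠ 0 := by positivity
    exact_mod_cast this
  refine ⟨(q + u) * g' * (q + star u) + ((ε / 4 : ℝ) : ℂ) • z,
    (q + u) * g'' * (q + star u) + ((ε / 4 : ℝ) : ℂ)⁻¹ • z, cornerL _ _, cornerR _ _, cornerL _ _,
    cornerR _ _, prod _ _ _ _ h3 h5 (mul_inv_cancel₀ hα), prod _ _ _ _ h1 h6 (inv_mul_cancel₀ hα),
    ?_⟩
  have hcM : (q + u) * c * (q + star u) = c := by
    have : (q + u) * c = c := by rw [add_mul, hqc, ← hqc, ← mul_assoc, huq, zero_mul, add_zero, hqc]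
    rw [this, mul_add, hcq, ← hcq, mul_assoc, hqu', mul_zero, add_zero, hcq]
  have hMn : ‖q + u‖ ≤ 1 := by
    rw [← sq_le_one_iff₀ (norm_nonneg _), sq, ← CStarRing.norm_star_mul_self, star_add, hqs, hMM']
    exact hR.one_sub.norm_le
  have hMn' : ‖q + star u‖ ≤ 1 := by
    have : q + star u = star (q + u) := by rw [star_add, hqs]
    rw [this, norm_star]
    exact hMn
  have e1 : (q + u) * g' * (q + star u) + ((ε / 4 : ℝ) : ℂ) • z - c =
      (q + u) * (g' - c) * (q + star u) + ((ε / 4 : ℝ) : ℂ) • z := by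
    rw [mul_sub, sub_mul, hcM]
    abel
  rw [e1]
  have n1 : ‖(q + u) * (g' - c) * (q + star u)‖ ≤ 2 * (ε / 8) :=
    (norm_corner_le hMn hMn').trans (h7.trans (by gcongr; exact min_le_left _ _))
  have n2 : ‖((ε / 4 : ℝ) : ℂ) • z‖ ≤ ε / 4 := by
    rw [norm_smul, Complex.norm_real, Real.norm_of_nonneg (by positivity)]
    have := hzp.norm_le
    nlinarith
  refine (norm_add_le _ _).trans_lt ?_
  linarith

end Schur
end TracialAH

/-! ### Invertible approximation in the corner of a bundle with spare room. -/

namespace TracialAH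

section Extension

open ContinuousLinearMap (adjoint)

/-- The orthogonal direct sum of two finite-dimensional Hilbert spaces, through its isometries. -/
theorem exists_orthogonal_sum (E F : Type*) [NormedAddCommGroup E] [InnerProductSpace ℂ E]
    [FiniteDimensional ℂ E] [NormedAddCommGroup F] [InnerProductSpace ℂ F]
    [FiniteDimensional ℂ F] :
    ∃ (i : E →L[ℂ] WithLp 2 (E × F)) (j : F →L[ℂ] WithLp 2 (E × F)),
      adjoint i ∘L i = 1 ∧ adjoint j ∘L j = 1 ∧ i ∘L adjoint i + j ∘L adjoint j = 1 := by
  obtain ⟨L, hL⟩ : ∃ L : (E × F) →L[ℂ] WithLp 2 (E × F), ∀ x, L x = WithLp.toLp 2 x :=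
    ⟨(WithLp.prodContinuousLinearEquiv 2 ℂ E F).symm, fun _ => rfl⟩
  obtain ⟨M, hM⟩ : ∃ M : WithLp 2 (E × F) →L[ℂ] (E × F), ∀ x, M x = x.ofLp :=
    ⟨(WithLp.prodContinuousLinearEquiv 2 ℂ E F), fun _ => rfl⟩
  have hi : ContinuousLinearMap.fst ℂ E F ∘L M = adjoint (L ∘L ContinuousLinearMap.inl ℂ E F) := by
    rw [ContinuousLinearMap.eq_adjoint_iff]
    intro x y
    simp [hL, hM, WithLp.prod_inner_apply]
  have hj : ContinuousLinearMap.snd ℂ E F ∘L M = adjoint (L ∘L ContinuousLinearMap.inr ℂ E F) := by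
    rw [ContinuousLinearMap.eq_adjoint_iff]
    intro x y
    simp [hL, hM, WithLp.prod_inner_apply]
  refine ⟨L ∘L ContinuousLinearMap.inl ℂ E F, L ∘L ContinuousLinearMap.inr ℂ E F, ?_, ?_, ?_⟩
  · rw [← hi]; ext x; simp [hL, hM]
  · rw [← hj]; ext x; simp [hL, hM]
  · rw [← hi, ← hj]
    refine ContinuousLinearMap.ext fun x => ?_
    simp only [hL, hM, add_apply, ContinuousLinearMap.comp_apply,
      ContinuousLinearMap.inl_apply, ContinuousLinearMap.inr_apply, ContinuousLinearMap.coe_fst',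
      ContinuousLinearMap.coe_snd', ← WithLp.toLp_add, Prod.mk_add_mk, add_zero, zero_add]
    rfl

/-- The conjugate `t ↦ i ∘ a t ∘ j`. -/
noncomputable def conjMap {X E F E' F' : Type*} [TopologicalSpace X]
    [NormedAddCommGroup E] [NormedSpace ℂ E] [NormedAddCommGroup F] [NormedSpace ℂ F]
    [NormedAddCommGroup E'] [NormedSpace ℂ E'] [NormedAddCommGroup F'] [NormedSpace ℂ F']
    (i : F →L[ℂ] F') (j : E' →L[ℂ] E) (a : C(X, E →L[ℂ] F)) : C(X, E' →L[ℂ] F') :=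
  ⟨fun t => i ∘L a t ∘L j, continuous_const.clm_comp (a.continuous.clm_comp continuous_const)⟩

variable {X E : Type*} [TopologicalSpace X] [CompactSpace X] [T2Space X] [Nonempty X]
  [NormedAddCommGroup E] [InnerProductSpace ℂ E] [FiniteDimensional ℂ E]

/-- Enlarge the fibre by `ℂ^(d+2)`, so that the projection onto `E` has enough corank for
`exists_isUnit_near`. The added trivial bundle embeds isometrically into `e`, and
`exists_corner_inverse_of_partialIsometry` moves the result back under `P`. -/
theorem exists_corner_inverse_near {d : ℕ} (hX : CoveringDimLE X d) (P e c : C(X, E →L[ℂ] E))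
    (hP : ∀ t, IsStarProjection (P t)) (he : ∀ t, IsStarProjection (e t))
    (hPe : ∀ t, P t * e t = e t)
    (hr : ∀ t, 5 * (d + 1) ≤ Module.finrank ℂ (LinearMap.range (e t : E →ₗ[ℂ] E)))
    (hc : ∀ t, (P t - e t) * c t = c t) (hc' : ∀ t, c t * (P t - e t) = c t)
    {ε : ℝ} (hε : 0 < ε) :
    ∃ c' c'' : C(X, E →L[ℂ] E), (∀ t, P t * c' t = c' t) ∧ (∀ t, c' t * P t = c' t) ∧
      (∀ t, P t * c'' t = c'' t) ∧ (∀ t, c'' t * P t = c'' t) ∧ (∀ t, c' t * c'' t = P t) ∧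
      (∀ t, c'' t * c' t = P t) ∧ ‖c' - c‖ < ε := by
  have hee : ∀ t, e t * e t = e t := fun t => (he t).isIdempotentElem
  have hPP : ∀ t, P t * P t = P t := fun t => (hP t).isIdempotentElem
  have heP : ∀ t, e t * P t = e t := fun t => by
    have := congrArg star (hPe t)
    rwa [star_mul, (he t).isSelfAdjoint.star_eq, (hP t).isSelfAdjoint.star_eq] at this
  -- The quadratic form of `e` is the squared norm on its range, so any cut below `1` works; the
  -- count is `d + 1 + 2(d + 2) < 10(d + 1)`.
  obtain ⟨U, hU, heU, -⟩ := exists_isometry_of_rayleigh (F := EuclideanSpace ℂ (Fin (d + 2)))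
    (R := 5 * (d + 1)) hX e e he (fun t => (he t).isSelfAdjoint) hee (θ := 1) (θ' := 1 / 2)
    (by norm_num) (by norm_num)
    (fun t => ⟨_, hr t, by
      rintro _ ⟨ξ, rfl⟩
      have h1 : e t (e t ξ) = e t ξ := DFunLike.congr_fun (hee t) ξ
      simp only [ContinuousLinearMap.coe_coe]
      rw [h1, one_mul, inner_self_eq_norm_sq_to_K]
      norm_cast⟩)
    (by simp; omega)
  obtain ⟨i, j, hii, hjj, hij⟩ := exists_orthogonal_sum E (EuclideanSpace ℂ (Fin (d + 2)))
  obtain ⟨K, hK1, hK2, hK3, i, j, hii, hjj, hij, hdim⟩ : ∃ (K : Type _) (_ : NormedAddCommGroup K)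
      (_ : InnerProductSpace ℂ K) (_ : FiniteDimensional ℂ K) (i : E →L[ℂ] K)
      (j : EuclideanSpace ℂ (Fin (d + 2)) →L[ℂ] K),
      adjoint i ∘L i = 1 ∧ adjoint j ∘L j = 1 ∧ i ∘L adjoint i + j ∘L adjoint j = 1 ∧
      Module.finrank ℂ K = Module.finrank ℂ E + (d + 2) := by
    obtain ⟨i, j, h⟩ := exists_orthogonal_sum E (EuclideanSpace ℂ (Fin (d + 2)))
    refine ⟨_, _, _, inferInstance, i, j, h.1, h.2.1, h.2.2, ?_⟩
    rw [(WithLp.linearEquiv 2 ℂ (E × EuclideanSpace ℂ (Fin (d + 2)))).finrank_eq]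
    simp
  have hii' : ∀ x, adjoint i (i x) = x := fun x => DFunLike.congr_fun hii x
  have hjj' : ∀ x, adjoint j (j x) = x := fun x => DFunLike.congr_fun hjj x
  have hij' : ∀ x, i (adjoint i x) + j (adjoint j x) = x := fun x => DFunLike.congr_fun hij x
  have hji : ∀ x, adjoint j (i x) = 0 := fun x => by
    have := congrArg (adjoint j) (hij' (i x))
    rwa [map_add, hii', hjj', add_eq_left] at this
  have hPe' : ∀ t x, P t (e t x) = e t x := fun t x => DFunLike.congr_fun (hPe t) x
  have heP' : ∀ t x, e t (P t x) = e t x := fun t x => DFunLike.congr_fun (heP t) x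
  have hee' : ∀ t x, e t (e t x) = e t x := fun t x => DFunLike.congr_fun (hee t) x
  have hPP' : ∀ t x, P t (P t x) = P t x := fun t x => DFunLike.congr_fun (hPP t) x
  have hcl : ∀ t x, P t (c t x) - e t (c t x) = c t x := fun t x => DFunLike.congr_fun (hc t) x
  have hcr : ∀ t x, c t (P t x - e t x) = c t x := fun t x =>
    DFunLike.congr_fun (hc' t) x
  have hf : IsStarProjection (i ∘L adjoint i) := by
    constructor
    · refine ContinuousLinearMap.ext fun x => ?_
      simp [hii']
    · change adjoint (i ∘L adjoint i) = _
      rw [ContinuousLinearMap.adjoint_comp, ContinuousLinearMap.adjoint_adjoint]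
  have conj_proj : ∀ a : C(X, E →L[ℂ] E), (∀ t, IsStarProjection (a t)) →
      IsStarProjection (conjMap i (adjoint i) a) := fun a ha => by
    constructor
    · ext t x
      have : a t (a t (adjoint i x)) = a t (adjoint i x) :=
        DFunLike.congr_fun (ha t).isIdempotentElem _
      simp [conjMap, hii', this]
    · ext t x
      change adjoint (i ∘L a t ∘L adjoint i) x = _
      rw [ContinuousLinearMap.adjoint_comp, ContinuousLinearMap.adjoint_comp,
        ContinuousLinearMap.adjoint_adjoint]
      have : adjoint (a t) = a t := (ha t).isSelfAdjoint
      rw [this]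
      rfl
  have hqt : ∀ t, IsStarProjection ((P - e) t) := fun t => by
    constructor
    · refine ContinuousLinearMap.ext fun x => ?_
      simp [hee', hPe', heP', hPP']
    · exact (hP t).isSelfAdjoint.sub (he t).isSelfAdjoint
  have hfc : IsStarProjection (ContinuousMap.const X (i ∘L adjoint i)) := by
    constructor
    · ext t : 1; exact hf.isIdempotentElem
    · ext t : 1; exact hf.isSelfAdjoint
  have hUU : ∀ t x, adjoint (U t) (U t x) = x := fun t x =>
    DFunLike.congr_fun ((U t).norm_map_iff_adjoint_comp_self.1 (hU t)) x
  obtain ⟨c', c'', h1, h2, h3, h4, h5, h6, h7⟩ := exists_corner_inverse_of_partialIsometry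
    hfc (conj_proj (P - e) hqt) (conj_proj e he) (u := conjMap i (adjoint j) U)
    (c := conjMap i (adjoint i) c)
    (by ext t x; simp [conjMap, hii'])
    (by ext t x; simp [conjMap, hii', hee', hPe'])
    (by
      ext t x
      change (adjoint (i ∘L U t ∘L adjoint j) ∘L (i ∘L U t ∘L adjoint j)) x = _
      rw [ContinuousLinearMap.adjoint_comp, ContinuousLinearMap.adjoint_comp,
        ContinuousLinearMap.adjoint_adjoint]
      simpa [hii', hUU] using eq_sub_of_add_eq' (hij' x))
    (by ext t x; simp [conjMap, hii', heU])
    (by ext t x; simp [conjMap, hii', hcl, ← map_sub])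
    (by
      ext t x
      change i (c t (adjoint i (i (P t (adjoint i x) - e t (adjoint i x))))) = _
      rw [hii', hcr]
      rfl)
    (fun η hη => by
      -- The count is `d + 2 + 2 dim E < 2 (dim E + d + 2)`.
      refine exists_isUnit_near hX hf ?_ _ (fun t => ?_) hη
      · have : LinearMap.range ((i ∘L adjoint i : K →L[ℂ] K) : K →ₗ[ℂ] K) ≤
            LinearMap.range (i : E →ₗ[ℂ] K) := by
          rintro _ ⟨x, rfl⟩
          exact ⟨adjoint i x, rfl⟩
        have h1 := Submodule.finrank_mono this
        have h2 := LinearMap.finrank_range_le (i : E →ₗ[ℂ] K)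
        omega
      · refine ContinuousLinearMap.ext fun x => ?_
        simp [conjMap, hii'])
    hε
  have hQ : ∀ t x, (conjMap i (adjoint i) (P - e) + conjMap i (adjoint i) e) t x =
      i (P t (adjoint i x)) := fun t x => by simp [conjMap]
  have ev : ∀ {a b : C(X, K →L[ℂ] K)}, a = b → ∀ t x, a t x = b t x := by
    rintro a _ rfl t x; rfl
  have l1 : ∀ t x, i (P t (adjoint i (c' t x))) = c' t x := fun t x =>
    (hQ t _).symm.trans (ev h1 t x)
  have l2 : ∀ t x, c' t (i (P t (adjoint i x))) = c' t x := fun t x => by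
    rw [← hQ]; exact ev h2 t x
  have l3 : ∀ t x, i (P t (adjoint i (c'' t x))) = c'' t x := fun t x =>
    (hQ t _).symm.trans (ev h3 t x)
  have l4 : ∀ t x, c'' t (i (P t (adjoint i x))) = c'' t x := fun t x => by
    rw [← hQ]; exact ev h4 t x
  have l5 : ∀ t x, c' t (c'' t x) = i (P t (adjoint i x)) := fun t x =>
    (ev h5 t x).trans (hQ t x)
  have l6 : ∀ t x, c'' t (c' t x) = i (P t (adjoint i x)) := fun t x =>
    (ev h6 t x).trans (hQ t x)
  have l1' : ∀ t x, P t (adjoint i (c' t x)) = adjoint i (c' t x) := fun t x => by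
    conv_rhs => rw [← l1, hii']
  have l3' : ∀ t x, P t (adjoint i (c'' t x)) = adjoint i (c'' t x) := fun t x => by
    conv_rhs => rw [← l3, hii']
  have hi1 : ‖i‖ ≤ 1 := i.opNorm_le_bound zero_le_one fun x => by
    rw [(i.norm_map_iff_adjoint_comp_self.2 hii), one_mul]
  have hi2 : ‖adjoint i‖ ≤ 1 := by rwa [LinearIsometryEquiv.norm_map]
  refine ⟨conjMap (adjoint i) i c', conjMap (adjoint i) i c'',
    fun t => ContinuousLinearMap.ext fun x => l1' t _,
    fun t => ContinuousLinearMap.ext fun x => ?_,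
    fun t => ContinuousLinearMap.ext fun x => l3' t _,
    fun t => ContinuousLinearMap.ext fun x => ?_,
    fun t => ContinuousLinearMap.ext fun x => ?_,
    fun t => ContinuousLinearMap.ext fun x => ?_, ?_⟩
  · have := congrArg (adjoint i) (l2 t (i x))
    rwa [hii'] at this
  · have := congrArg (adjoint i) (l4 t (i x))
    rwa [hii'] at this
  · change adjoint i (c' t (i (adjoint i (c'' t (i x))))) = P t x
    rw [← l3', l3, l5, hii', hii']
  · change adjoint i (c'' t (i (adjoint i (c' t (i x))))) = P t x
    rw [← l1', l1, l6, hii', hii']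
  · rw [ContinuousMap.norm_lt_iff _ hε]
    intro t
    have h8 : (conjMap (adjoint i) i c' - c) t =
        adjoint i ∘L (c' - conjMap i (adjoint i) c) t ∘L i := by
      refine ContinuousLinearMap.ext fun x => ?_
      simp [conjMap, hii']
    rw [h8]
    calc ‖adjoint i ∘L (c' - conjMap i (adjoint i) c) t ∘L i‖
        ≤ ‖adjoint i‖ * (‖(c' - conjMap i (adjoint i) c) t‖ * ‖i‖) :=
          (ContinuousLinearMap.opNorm_comp_le _ _).trans
            (by gcongr; exact ContinuousLinearMap.opNorm_comp_le _ _)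
      _ ≤ 1 * (‖(c' - conjMap i (adjoint i) c) t‖ * 1) := by gcongr
      _ = ‖(c' - conjMap i (adjoint i) c) t‖ := by ring
      _ ≤ ‖c' - conjMap i (adjoint i) c‖ := ContinuousMap.norm_coe_le_norm _ t
      _ < ε := h7

end Extension
end TracialAH

/-! ### Fibrewise operators and tracial models. -/

namespace TracialAH

/-- Extend the cover to `Y`, add the open complement of `s`, refine, and restrict to `s`.
Restriction can merge members of the refinement but not increase their multiplicity. -/
theorem CoveringDimLE.subtype {Y : Type*} [TopologicalSpace Y] [T2Space Y] {d : ℕ}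
    (hY : CoveringDimLE Y d) {s : Set Y} (hs : IsCompact s) : CoveringDimLE s d := by
  intro 𝒰 hfin hopen hcov
  have hext : ∀ U : Set s, ∃ V : Set Y, IsOpen U → IsOpen V ∧ Subtype.val ⁻¹' V = U := fun U => by
    by_cases h : IsOpen U
    · obtain ⟨V, hV⟩ := isOpen_induced_iff.1 h
      exact ⟨V, fun _ => hV⟩
    · exact ⟨∅, fun h' => absurd h' h⟩
  choose ext hext using hext
  obtain ⟨𝒱, h1, h2, h3, h4⟩ := hY (insert sᶜ (ext '' 𝒰)) ((hfin.image _).insert _)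
    (by
      rintro _ (rfl | ⟨U, hU, rfl⟩)
      · exact hs.isClosed.isOpen_compl
      · exact (hext U (hopen U hU)).1)
    (by
      refine Set.eq_univ_of_forall fun y => ?_
      by_cases hy : y ∈ s
      · obtain ⟨U, hU, hyU⟩ := Set.mem_sUnion.1 (hcov ▸ Set.mem_univ (⟨y, hy⟩ : s))
        refine ⟨ext U, Or.inr ⟨U, hU, rfl⟩, ?_⟩
        rw [← (hext U (hopen U hU)).2] at hyU
        exact hyU
      · exact ⟨sᶜ, Or.inl rfl, hy⟩)
  -- Empty traces are dropped because members lying inside the complement of `s` need not refine the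
  -- original cover.
  refine ⟨(fun V => Subtype.val ⁻¹' V) '' 𝒱 \ {∅}, ?_, ?_, ?_, ?_⟩
  · rintro _ ⟨⟨V, hV, rfl⟩, -⟩
    exact (h1 V hV).preimage continuous_subtype_val
  · refine Set.eq_univ_of_forall fun y => ?_
    obtain ⟨V, hV, hyV⟩ := Set.mem_sUnion.1 (h2 ▸ Set.mem_univ (y : Y))
    exact ⟨_, ⟨⟨V, hV, rfl⟩, fun h => (Set.mem_singleton_iff.1 h ▸ hyV : y ∈ (∅ : Set s))⟩, hyV⟩
  · rintro _ ⟨⟨V, hV, rfl⟩, hne⟩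
    obtain ⟨W, hW, hVW⟩ := h3 V hV
    rcases hW with rfl | ⟨U, hU, rfl⟩
    · refine absurd (Set.eq_empty_of_forall_notMem fun (y : s) hy => hVW hy y.2) hne
    · refine ⟨U, hU, ?_⟩
      conv_rhs => rw [← (hext U (hopen U hU)).2]
      exact Set.preimage_mono hVW
  · intro y
    refine le_trans (le_trans (Set.encard_le_encard ?_) (Set.encard_image_le
      (fun V : Set Y => (Subtype.val ⁻¹' V : Set s)) _)) (h4 y)
    rintro _ ⟨⟨⟨V, hV, rfl⟩, -⟩, hy⟩
    exact ⟨V, ⟨hV, hy⟩, rfl⟩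

/-- The fibrewise action of a matrix of continuous functions. -/
noncomputable def matrixAction {X : Type*} [TopologicalSpace X] (r : ℕ) :
    Matrix (Fin r) (Fin r) C(X, ℂ) →
      C(X, EuclideanSpace ℂ (Fin r) →L[ℂ] EuclideanSpace ℂ (Fin r)) := fun M =>
  ⟨fun t => Matrix.toEuclideanCLM (𝕜 := ℂ) (M.map fun f => f t),
    (LinearMap.continuous_of_finiteDimensional
      (Matrix.toEuclideanCLM (n := Fin r) (𝕜 := ℂ)).toAlgEquiv.toLinearMap).comp
      (continuous_matrix fun i j => (M i j).continuous)⟩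

section
variable {X : Type*} [TopologicalSpace X] {r : ℕ}

theorem matrixAction_apply (M : Matrix (Fin r) (Fin r) C(X, ℂ)) (t : X) :
    matrixAction r M t = Matrix.toEuclideanCLM (𝕜 := ℂ) (M.map fun f => f t) := rfl

theorem matrixAction_add (M N : Matrix (Fin r) (Fin r) C(X, ℂ)) :
    matrixAction r (M + N) = matrixAction r M + matrixAction r N := by
  ext t : 1
  simp only [ContinuousMap.add_apply, matrixAction_apply, ← map_add]
  rfl

theorem matrixAction_smul (c : ℂ) (M : Matrix (Fin r) (Fin r) C(X, ℂ)) :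
    matrixAction r (c • M) = c • matrixAction r M := by
  ext t : 1
  simp only [ContinuousMap.smul_apply, matrixAction_apply, ← map_smul]
  rfl

theorem matrixAction_zero : matrixAction (X := X) r 0 = 0 := by
  ext t : 1
  have : (0 : Matrix (Fin r) (Fin r) C(X, ℂ)).map (fun f => f t) = 0 := rfl
  rw [matrixAction_apply, this, map_zero]
  rfl

theorem matrixAction_mul (M N : Matrix (Fin r) (Fin r) C(X, ℂ)) :
    matrixAction r (M * N) = matrixAction r M * matrixAction r N := by
  ext t : 1
  simp only [ContinuousMap.mul_apply, matrixAction_apply, ← map_mul]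
  congr 1
  ext i j
  simp [Matrix.mul_apply]

theorem matrixAction_star (M : Matrix (Fin r) (Fin r) C(X, ℂ)) :
    matrixAction r (star M) = star (matrixAction r M) := by
  ext t : 1
  simp only [ContinuousMap.star_apply, matrixAction_apply, ← map_star]
  rfl

theorem matrixAction_bijective :
    Function.Bijective (matrixAction (X := X) r) := by
  constructor
  · intro M N h
    ext i j t
    have h1 := (Matrix.toEuclideanCLM (n := Fin r) (𝕜 := ℂ)).injective (DFunLike.congr_fun h t)
    exact congrFun (congrFun h1 i) j
  · intro h
    refine ⟨Matrix.of fun i j => ⟨fun t => (Matrix.toEuclideanCLM (𝕜 := ℂ)).symm (h t) i j,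
      (continuous_apply_apply i j).comp ((LinearMap.continuous_of_finiteDimensional
        (Matrix.toEuclideanCLM (n := Fin r) (𝕜 := ℂ)).symm.toAlgEquiv.toLinearMap).comp
        h.continuous)⟩, ?_⟩
    ext t : 1
    rw [matrixAction_apply]
    exact (Matrix.toEuclideanCLM (n := Fin r) (𝕜 := ℂ)).apply_symm_apply (h t)

end

theorem finrank_range_matrixAction {X : Type*} [TopologicalSpace X] {r : ℕ}
    (M : Matrix (Fin r) (Fin r) C(X, ℂ)) (t : X) :
    Module.finrank ℂ (LinearMap.range
      (matrixAction r M t : EuclideanSpace ℂ (Fin r) →ₗ[ℂ] EuclideanSpace ℂ (Fin r))) =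
      (M.map fun f => f t).rank := by
  rw [matrixAction_apply]
  rw [Matrix.rank_eq_finrank_range_toLin _ (EuclideanSpace.basisFun (Fin r) ℂ).toBasis
    (EuclideanSpace.basisFun (Fin r) ℂ).toBasis]
  rw [Matrix.coe_toEuclideanCLM_eq_toEuclideanLin, Matrix.toEuclideanLin_eq_toLin_orthonormal]

/-- A projection `p` of `A`, the algebra `B` of elements commuting with `p` whose `p`-part lies in a
homogeneous subalgebra, and the point evaluations of that subalgebra. -/
structure TracialModel (A : Type*) [CStarAlgebra A] where
  p : A
  isStarProjection_p : IsStarProjection p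
  B : StarSubalgebra ℂ A
  isClosed_B : IsClosed (B : Set A)
  p_mem : p ∈ B
  comm : ∀ b ∈ B, p * b = b * p
  X : Type
  [topX : TopologicalSpace X]
  [compactX : CompactSpace X]
  [t2X : T2Space X]
  [nonemptyX : Nonempty X]
  d : ℕ
  dim_le : CoveringDimLE X d
  r : ℕ
  ev : X → B →⋆ₙₐ[ℂ] (EuclideanSpace ℂ (Fin r) →L[ℂ] EuclideanSpace ℂ (Fin r))
  continuous_ev : ∀ b, Continuous fun t => ev t b
  norm_ev_le' : ∀ t b, ‖ev t b‖ ≤ ‖p * (b : A)‖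
  norm_le_of_ev : ∀ b : B, ∀ ρ : ℝ, (∀ t, ‖ev t b‖ ≤ ρ) → ‖p * (b : A)‖ ≤ ρ
  exists_of_corner : ∀ h : C(X, EuclideanSpace ℂ (Fin r) →L[ℂ] EuclideanSpace ℂ (Fin r)),
    (∀ t, ev t ⟨p, p_mem⟩ * h t = h t) → (∀ t, h t * ev t ⟨p, p_mem⟩ = h t) →
    ∃ b : B, p * (b : A) = b ∧ ∀ t, ev t b = h t

attribute [instance] TracialModel.topX TracialModel.compactX TracialModel.t2X
  TracialModel.nonemptyX TracialModel.isClosed_B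

namespace TracialModel
variable {A : Type*} [CStarAlgebra A] (M : TracialModel A)

/-- The Hilbert space on which the fibres act. -/
abbrev E : Type := EuclideanSpace ℂ (Fin M.r)

/-- The projection `p` as an element of `B`. -/
def q : M.B := ⟨M.p, M.p_mem⟩

theorem q_mul_q : M.q * M.q = M.q := Subtype.ext M.isStarProjection_p.isIdempotentElem

theorem star_q : star M.q = M.q := Subtype.ext M.isStarProjection_p.isSelfAdjoint

theorem q_comm (b : M.B) : M.q * b = b * M.q := Subtype.ext (M.comm b b.2)

theorem norm_ev_le (t : M.X) (b : M.B) : ‖M.ev t b‖ ≤ ‖b‖ :=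
  (M.norm_ev_le' t b).trans ((norm_mul_le _ _).trans
    (mul_le_of_le_one_left (norm_nonneg _) M.isStarProjection_p.norm_le))

theorem ev_one (t : M.X) : M.ev t 1 = M.ev t M.q := by
  rw [← sub_eq_zero, ← map_sub, ← norm_le_zero_iff]
  refine (M.norm_ev_le' t _).trans_eq ?_
  change ‖M.p * (1 - M.p)‖ = 0
  rw [M.isStarProjection_p.mul_one_sub_self, norm_zero]

theorem ev_q_mul (t : M.X) (b : M.B) : M.ev t M.q * M.ev t b = M.ev t b := by
  rw [← ev_one, ← map_mul, one_mul]

theorem ev_mul_q (t : M.X) (b : M.B) : M.ev t b * M.ev t M.q = M.ev t b := by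
  rw [← ev_one, ← map_mul, mul_one]

theorem isStarProjection_ev_q (t : M.X) : IsStarProjection (M.ev t M.q) := by
  constructor
  · exact M.ev_q_mul t M.q
  · change star (M.ev t M.q) = _
    rw [← map_star, star_q]

/-- The rank of the fibre of `p`. -/
noncomputable def rank (t : M.X) : ℕ :=
  Module.finrank ℂ (LinearMap.range (M.ev t M.q : M.E →ₗ[ℂ] M.E))

theorem rank_eq_of_ev_eq {t : M.X} {T : M.E →L[ℂ] M.E} (h : M.ev t M.q = T) :
    M.rank t = Module.finrank ℂ (LinearMap.range (T : M.E →ₗ[ℂ] M.E)) := by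
  rw [← h]
  rfl

end TracialModel

section
variable {A : Type*} [CStarAlgebra A] {p : A} (hp : IsStarProjection p)
  (C : NonUnitalStarSubalgebra ℂ A)

/-- The elements commuting with `p` whose `p`-part lies in `C`. -/
def blockAlgebra (hpC : p ∈ C) : StarSubalgebra ℂ A where
  carrier := {b | p * b = b * p ∧ p * b ∈ C}
  mul_mem' := by
    rintro a b ⟨ha, ha'⟩ ⟨hb, hb'⟩
    refine ⟨by rw [← mul_assoc, ha, mul_assoc, hb, mul_assoc], ?_⟩
    have : p * (a * b) = (p * a) * (p * b) := by
      rw [hb, ← mul_assoc (p * a), mul_assoc p a b, mul_assoc p (a * b), mul_assoc a b, ← hb,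
        ← mul_assoc a p, ← ha, mul_assoc p a b, ← mul_assoc p p, hp.isIdempotentElem.eq]
    rw [this]
    exact mul_mem ha' hb'
  add_mem' := by
    rintro a b ⟨ha, ha'⟩ ⟨hb, hb'⟩
    exact ⟨by rw [mul_add, add_mul, ha, hb], by rw [mul_add]; exact add_mem ha' hb'⟩
  algebraMap_mem' c := by
    refine ⟨(Algebra.commutes c p).symm, ?_⟩
    rw [← Algebra.commutes, ← Algebra.smul_def]
    exact SMulMemClass.smul_mem c hpC
  star_mem' := by
    rintro a ⟨ha, ha'⟩
    have h1 : p * star a = star a * p := by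
      have := congrArg star ha
      rw [star_mul, star_mul, hp.isSelfAdjoint.star_eq] at this
      exact this.symm
    refine ⟨h1, ?_⟩
    have := star_mem ha'
    rwa [star_mul, hp.isSelfAdjoint.star_eq, ← h1] at this

theorem isClosed_blockAlgebra (hpC : p ∈ C) (hC : IsClosed (C : Set A)) :
    IsClosed (blockAlgebra hp C hpC : Set A) :=
  (isClosed_eq (continuous_const.mul continuous_id) (continuous_id.mul continuous_const)).inter
    (hC.preimage (continuous_const.mul continuous_id))

end

end TracialAH

/-! ### Models supplied by the class `C_1`. -/

namespace TracialAH

section Construct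

variable {A : Type*} [CStarAlgebra A]

/-- The isomorphism is only algebraic, but an injective star homomorphism of C⋆-algebras is
isometric. -/
theorem norm_matrixAction_equiv {C : NonUnitalStarSubalgebra ℂ A} (hC : IsClosed (C : Set A))
    {d : ℕ} (m : HomogeneousModel d) [CompactSpace m.X] (Ψ : C ≃⋆ₐ[ℂ] m.algebra) (c : C) :
    ‖matrixAction m.r (Ψ c : Matrix (Fin m.r) (Fin m.r) C(m.X, ℂ))‖ = ‖c‖ := by
  have := hC
  let φ : C →⋆ₙₐ[ℂ] C(m.X, EuclideanSpace ℂ (Fin m.r) →L[ℂ] EuclideanSpace ℂ (Fin m.r)) :=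
    { toFun := fun c => matrixAction m.r (Ψ c : Matrix (Fin m.r) (Fin m.r) C(m.X, ℂ))
      map_smul' := fun a c => by
        rw [map_smul]; exact matrixAction_smul _ _
      map_zero' := by
        rw [map_zero]; exact matrixAction_zero
      map_add' := fun a c => by
        rw [map_add]; exact matrixAction_add _ _
      map_mul' := fun a c => by
        rw [map_mul]; exact matrixAction_mul _ _
      map_star' := fun c => by
        rw [map_star]; exact matrixAction_star _ }
  refine NonUnitalStarAlgHom.norm_map φ ?_ c
  intro a b hab
  exact Ψ.injective (Subtype.ext (matrixAction_bijective.1 hab))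

/-- Evaluation at a point of the model space. -/
noncomputable def blockEval {p : A} (hp : IsStarProjection p) (C : NonUnitalStarSubalgebra ℂ A)
    (hpC : p ∈ C) {d : ℕ} (m : HomogeneousModel d) (Ψ : C ≃⋆ₐ[ℂ] m.algebra) (t : m.X) :
    blockAlgebra hp C hpC →⋆ₙₐ[ℂ]
      (EuclideanSpace ℂ (Fin m.r) →L[ℂ] EuclideanSpace ℂ (Fin m.r)) where
  toFun b := matrixAction m.r (Ψ ⟨p * b, b.2.2⟩ : Matrix (Fin m.r) (Fin m.r) C(m.X, ℂ)) t
  map_smul' a b := by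
    have : (⟨p * (a • b : blockAlgebra hp C hpC), (a • b).2.2⟩ : C) = a • ⟨p * b, b.2.2⟩ :=
      Subtype.ext (mul_smul_comm a p (b : A))
    rw [this, map_smul]
    exact DFunLike.congr_fun (matrixAction_smul _ _) t
  map_zero' := by
    have : (⟨p * (0 : blockAlgebra hp C hpC), (0 : blockAlgebra hp C hpC).2.2⟩ : C) = 0 :=
      Subtype.ext (mul_zero p)
    rw [this, map_zero]
    exact DFunLike.congr_fun matrixAction_zero t
  map_add' a b := by
    have : (⟨p * (a + b : blockAlgebra hp C hpC), (a + b).2.2⟩ : C) =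
        ⟨p * a, a.2.2⟩ + ⟨p * b, b.2.2⟩ :=
      Subtype.ext (mul_add p (a : A) b)
    rw [this, map_add]
    exact DFunLike.congr_fun (matrixAction_add _ _) t
  map_mul' a b := by
    have : (⟨p * (a * b : blockAlgebra hp C hpC), (a * b).2.2⟩ : C) =
        ⟨p * a, a.2.2⟩ * ⟨p * b, b.2.2⟩ := by
      refine Subtype.ext ?_
      change p * (a * b : A) = p * a * (p * b)
      rw [mul_assoc, ← mul_assoc (a : A) p, ← a.2.1, mul_assoc p (a : A), ← mul_assoc p p,
        hp.isIdempotentElem.eq]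
    rw [this, map_mul]
    exact DFunLike.congr_fun (matrixAction_mul _ _) t
  map_star' a := by
    have : (⟨p * (star a : blockAlgebra hp C hpC), (star a).2.2⟩ : C) = star ⟨p * a, a.2.2⟩ := by
      refine Subtype.ext ?_
      change p * star (a : A) = star (p * (a : A))
      rw [a.2.1, star_mul, hp.isSelfAdjoint.star_eq]
    rw [this, map_star]
    exact DFunLike.congr_fun (matrixAction_star _) t

theorem blockEval_apply {p : A} (hp : IsStarProjection p) (C : NonUnitalStarSubalgebra ℂ A)
    (hpC : p ∈ C) {d : ℕ} (m : HomogeneousModel d) (Ψ : C ≃⋆ₐ[ℂ] m.algebra) (t : m.X)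
    (b : blockAlgebra hp C hpC) : blockEval hp C hpC m Ψ t b =
      matrixAction m.r (Ψ ⟨p * b, b.2.2⟩ : Matrix (Fin m.r) (Fin m.r) C(m.X, ℂ)) t := rfl

theorem equiv_unit {p : A} {C : NonUnitalStarSubalgebra ℂ A}
    (hpC : p ∈ C) (hunit : ∀ c ∈ C, p * c = c ∧ c * p = c) {d : ℕ} (m : HomogeneousModel d)
    (Ψ : C ≃⋆ₐ[ℂ] m.algebra) :
    (Ψ ⟨p, hpC⟩ : Matrix (Fin m.r) (Fin m.r) C(m.X, ℂ)) = m.P := by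
  have hP : m.P * m.P = m.P := m.isStarProjection_P.isIdempotentElem
  obtain ⟨c, hc⟩ : ∃ c, Ψ c = ⟨m.P, hP, hP⟩ := ⟨_, Ψ.apply_symm_apply _⟩
  have h1 : (⟨p, hpC⟩ : C) * c = c := Subtype.ext (hunit c c.2).1
  have h2 := congrArg (fun a => ((Ψ a : m.algebra) : Matrix (Fin m.r) (Fin m.r) C(m.X, ℂ))) h1
  simp only [map_mul, hc] at h2
  change (Ψ ⟨p, hpC⟩ : Matrix (Fin m.r) (Fin m.r) C(m.X, ℂ)) * m.P = m.P at h2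
  rw [(Ψ ⟨p, hpC⟩).2.2] at h2
  exact h2

/-- The model given by a homogeneous subalgebra with unit `p`. -/
noncomputable def TracialModel.ofHomogeneous {p : A} (hp : IsStarProjection p)
    (C : NonUnitalStarSubalgebra ℂ A) (hC : IsClosed (C : Set A)) (hpC : p ∈ C)
    (hunit : ∀ c ∈ C, p * c = c ∧ c * p = c) {d : ℕ} (m : HomogeneousModel d)
    (Ψ : C ≃⋆ₐ[ℂ] m.algebra) : TracialModel A :=
  have := isCompact_iff_compactSpace.1 m.isCompact_X
  have hpp : p * p = p := hp.isIdempotentElem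
  have hpm : p ∈ blockAlgebra hp C hpC := ⟨rfl, by rwa [hpp]⟩
  have hev : ∀ t, blockEval hp C hpC m Ψ t ⟨p, hpm⟩ = matrixAction m.r m.P t := fun t => by
    rw [blockEval_apply, ← equiv_unit hpC hunit m Ψ]
    simp only [hpp]
  { p := p
    isStarProjection_p := hp
    B := blockAlgebra hp C hpC
    isClosed_B := isClosed_blockAlgebra hp C hpC hC
    p_mem := hpm
    comm := fun b hb => hb.1
    X := m.X
    compactX := this
    nonemptyX := m.nonempty_X.to_subtype
    d := d
    dim_le := m.dim_le.subtype m.isCompact_X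
    r := m.r
    ev := blockEval hp C hpC m Ψ
    continuous_ev := fun b => (matrixAction m.r
      (Ψ ⟨p * b, b.2.2⟩ : Matrix (Fin m.r) (Fin m.r) C(m.X, ℂ))).continuous
    norm_ev_le' := fun t b => by
      rw [blockEval_apply]
      refine (ContinuousMap.norm_coe_le_norm _ t).trans ?_
      rw [norm_matrixAction_equiv hC]
      exact le_rfl
    norm_le_of_ev := fun b ρ h => by
      have h1 := norm_matrixAction_equiv hC m Ψ ⟨p * b, b.2.2⟩
      change _ = ‖p * (b : A)‖ at h1
      rw [← h1]
      have hρ : 0 ≤ ρ := by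
        obtain ⟨t⟩ := m.nonempty_X.to_subtype
        exact (norm_nonneg _).trans (h t)
      exact (ContinuousMap.norm_le _ hρ).2 h
    exists_of_corner := fun h h1 h2 => by
      obtain ⟨N, hN⟩ := matrixAction_bijective.2 h
      have hNm : N ∈ m.algebra := by
        constructor
        · apply matrixAction_bijective.1
          rw [matrixAction_mul, hN]
          ext t : 1
          rw [ContinuousMap.mul_apply, ← hev]
          exact h1 t
        · apply matrixAction_bijective.1
          rw [matrixAction_mul, hN]
          ext t : 1
          rw [ContinuousMap.mul_apply, ← hev]
          exact h2 t
      obtain ⟨c, hc⟩ : ∃ c, Ψ c = ⟨N, hNm⟩ := ⟨_, Ψ.apply_symm_apply _⟩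
      have hpc := (hunit c c.2).1
      refine ⟨⟨c, by rw [hpc, (hunit c c.2).2], by rw [hpc]; exact c.2⟩, hpc, fun t => ?_⟩
      rw [blockEval_apply]
      simp only [hpc]
      rw [Subtype.coe_eta, hc, hN] }

theorem rank_ofHomogeneous {p : A} (hp : IsStarProjection p)
    (C : NonUnitalStarSubalgebra ℂ A) (hC : IsClosed (C : Set A)) (hpC : p ∈ C)
    (hunit : ∀ c ∈ C, p * c = c ∧ c * p = c) {d : ℕ} (m : HomogeneousModel d)
    (Ψ : C ≃⋆ₐ[ℂ] m.algebra) (t : m.X) :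
    (TracialModel.ofHomogeneous hp C hC hpC hunit m Ψ).rank t = m.rankAt t := by
  have hpp : p * p = p := hp.isIdempotentElem
  have h1 : (TracialModel.ofHomogeneous hp C hC hpC hunit m Ψ).ev t
      (TracialModel.ofHomogeneous hp C hC hpC hunit m Ψ).q = matrixAction m.r m.P t := by
    change matrixAction m.r (Ψ ⟨p * p, _⟩ : Matrix (Fin m.r) (Fin m.r) C(m.X, ℂ)) t = _
    rw [← equiv_unit hpC hunit m Ψ]
    simp only [hpp]
  exact (TracialModel.rank_eq_of_ev_eq _ h1).trans (finrank_range_matrixAction m.P t)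

/-- The approximation property in the form used later: any open condition on finitely many elements
can be realised by elements that lie in the model algebra and hence commute with `p`. -/
theorem exists_tracialModel [PartialOrder A] [StarOrderedRing A] (hA : InClassC1 A) (n : ℕ)
    {ι : Type*} [Finite ι] (s : ι → A) {U : Set (ι → A)} (hU : U ∈ 𝓝 s) {a : A} (ha : 0 ≤ a)
    (ha0 : a ≠ 0) :
    ∃ M : TracialModel A, (∀ t, n * (M.d + 1) ≤ M.rank t) ∧ CuntzLE (1 - M.p) a ∧
      ∃ b : ι → M.B, (fun i => (b i : A)) ∈ U := by
  classical
  have := Fintype.ofFinite ι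
  obtain ⟨ε, hε, hεU⟩ := Metric.mem_nhds_iff.1 hU
  -- With `g = 1` the ratio `(d + 1) / rank` is below half of `2 / (n + 1)`, so the rank exceeds `(n
  -- + 1)(d + 1)`.
  obtain ⟨p, C, d, m, hp, hC, ⟨Ψ⟩, ⟨hpC, hunit⟩, hF1, hF2, hrank, hpa⟩ :=
    hA (Finset.univ.image s) (ε / 3) (2 / (n + 1)) (by positivity) (by positivity) a ha ha0
  refine ⟨TracialModel.ofHomogeneous hp C hC hpC hunit m Ψ, fun t => ?_, hpa, ?_⟩
  · have ht : m.X := t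
    rw [rank_ofHomogeneous hp C hC hpC hunit m Ψ t]
    change n * (d + 1) ≤ m.rankAt t
    obtain ⟨h1, h2⟩ := hrank t
    have h1' : (0 : ℝ) < m.rankAt t := by exact_mod_cast h1
    rw [div_lt_div_iff₀ h1' (by positivity)] at h2
    have h3 : (2 / ((n : ℝ) + 1)) * (n + 1) = 2 := by field_simp
    have h4 : ((d : ℝ) + 1) * (n + 1) < m.rankAt t := by
      have : ((d : ℝ) + 1) * (n + 1) * 2 < m.rankAt t * 2 := by
        calc ((d : ℝ) + 1) * (n + 1) * 2 = (d + 1) * (((1 : ℕ) : ℝ) + 1) * (n + 1) := by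
              push_cast; ring
          _ < (2 / ((n : ℝ) + 1)) * m.rankAt t * (n + 1) := by gcongr
          _ = (2 / ((n : ℝ) + 1)) * (n + 1) * m.rankAt t := by ring
          _ = m.rankAt t * 2 := by rw [h3]; ring
      linarith
    have h5 : (d + 1) * (n + 1) < m.rankAt t := by exact_mod_cast h4
    nlinarith
  · have hpp : p * p = p := hp.isIdempotentElem
    have key : ∀ i, ∃ b : blockAlgebra hp C hpC, dist (b : A) (s i) < ε := fun i => by
      have hi : s i ∈ Finset.univ.image s := Finset.mem_image_of_mem _ (Finset.mem_univ i)
      obtain ⟨c, hc, hcd⟩ := (Metric.infDist_lt_iff ⟨0, C.zero_mem'⟩).1 (hF2 _ hi)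
      have hz : p * (1 - p) = 0 := by rw [mul_sub, mul_one, hpp, sub_self]
      have hz' : (1 - p) * p = 0 := by rw [sub_mul, one_mul, hpp, sub_self]
      have e1 : p * (c + (1 - p) * s i * (1 - p)) = c := by
        rw [mul_add, (hunit c hc).1, ← mul_assoc, ← mul_assoc, hz, zero_mul, zero_mul, add_zero]
      have e2 : (c + (1 - p) * s i * (1 - p)) * p = c := by
        rw [add_mul, (hunit c hc).2, mul_assoc, hz', mul_zero, add_zero]
      -- Keep the two diagonal blocks. The off-diagonal ones are compressions of the commutator with
      -- `p`, so each of the three errors is below `ε/3`.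
      refine ⟨⟨c + (1 - p) * s i * (1 - p), e1.trans e2.symm, by rw [e1]; exact hc⟩, ?_⟩
      rw [dist_comm, dist_eq_norm]
      change ‖s i - (c + (1 - p) * s i * (1 - p))‖ < ε
      have e3 : s i - (c + (1 - p) * s i * (1 - p)) = (p * s i * p - c) +
          (p * s i - s i * p) * (1 - p) - (1 - p) * (p * s i - s i * p) := by
        have e4 : ∀ x : A, x - (c + (1 - p) * x * (1 - p)) - ((p * x * p - c) +
          (p * x - x * p) * (1 - p) - (1 - p) * (p * x - x * p)) =
            - (x * (p * p)) + x * p - p * p * x + p * x := fun x => by noncomm_ring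
        have := e4 (s i)
        rw [hpp] at this
        rw [← sub_eq_zero, this]
        abel
      rw [e3]
      have n1 := hF1 _ hi
      rw [dist_eq_norm] at hcd
      have n2 := hp.one_sub.norm_le
      have n3 : ‖(p * s i - s i * p) * (1 - p)‖ ≤ ‖p * s i - s i * p‖ :=
        (norm_mul_le _ _).trans (mul_le_of_le_one_right (norm_nonneg _) n2)
      have n4 : ‖(1 - p) * (p * s i - s i * p)‖ ≤ ‖p * s i - s i * p‖ :=
        (norm_mul_le _ _).trans (mul_le_of_le_one_left (norm_nonneg _) n2)
      refine (norm_sub_le _ _).trans_lt ?_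
      have n5 := norm_add_le (p * s i * p - c) ((p * s i - s i * p) * (1 - p))
      linarith
    choose b hb using key
    exact ⟨b, hεU ((dist_pi_lt_iff hε).2 hb)⟩

end Construct
end TracialAH

/-! ### Consequences of simplicity, and direct finiteness. -/

namespace TracialAH

theorem exists_sum_eq_of_mem_closure {A : Type*} [Ring A] {k x : A}
    (hx : x ∈ AddSubgroup.closure {x : A | ∃ a b, x = a * k * b}) :
    ∃ (n : ℕ) (a b : Fin n → A), x = ∑ i, a i * k * b i := by
  suffices h : ∃ (ι : Type) (_ : Fintype ι) (a b : ι → A), x = ∑ i, a i * k * b i by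
    obtain ⟨ι, _, a, b, h⟩ := h
    refine ⟨Fintype.card ι, a ∘ (Fintype.equivFin ι).symm, b ∘ (Fintype.equivFin ι).symm, ?_⟩
    rw [h, ← (Fintype.equivFin ι).symm.sum_comp]
    rfl
  induction hx using AddSubgroup.closure_induction with
  | mem x hx =>
    obtain ⟨a, b, rfl⟩ := hx
    exact ⟨Unit, inferInstance, fun _ => a, fun _ => b, by simp⟩
  | zero => exact ⟨Empty, inferInstance, fun _ => 0, fun _ => 0, by simp⟩
  | add x y _ _ hx hy =>
    obtain ⟨ι, _, a, b, rfl⟩ := hx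
    obtain ⟨κ, _, a', b', rfl⟩ := hy
    exact ⟨ι ⊕ κ, inferInstance, Sum.elim a a', Sum.elim b b', by simp⟩
  | neg x _ hx =>
    obtain ⟨ι, _, a, b, rfl⟩ := hx
    exact ⟨ι, inferInstance, fun i => - a i, b, by simp⟩

/-- The closed ideal generated by `k` is everything, so its algebraic part has an element within
distance `1` of the unit. That element is invertible, hence the algebraic ideal contains `1`. -/
theorem IsSimpleCStar.exists_sum_eq_one {A : Type*} [CStarAlgebra A] (hA : IsSimpleCStar A) {k : A}
    (hk : k ≠ 0) : ∃ (n : ℕ) (a b : Fin n → A), ∑ i, a i * k * b i = 1 := by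
  have := hA.1
  obtain ⟨H, hH⟩ : ∃ H, H = AddSubgroup.closure {x : A | ∃ a b, x = a * k * b} := ⟨_, rfl⟩
  have hl : ∀ y : A, ∀ x ∈ H, y * x ∈ H := fun y x hx => by
    rw [hH] at hx ⊢
    induction hx using AddSubgroup.closure_induction with
    | mem x hx =>
      obtain ⟨a, b, rfl⟩ := hx
      exact AddSubgroup.subset_closure ⟨y * a, b, by simp only [mul_assoc]⟩
    | zero => rw [mul_zero]; exact zero_mem _
    | add x z _ _ hx hz => rw [mul_add]; exact add_mem hx hz
    | neg x _ hx => rw [mul_neg]; exact neg_mem hx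
  have hr : ∀ y : A, ∀ x ∈ H, x * y ∈ H := fun y x hx => by
    rw [hH] at hx ⊢
    induction hx using AddSubgroup.closure_induction with
    | mem x hx =>
      obtain ⟨a, b, rfl⟩ := hx
      exact AddSubgroup.subset_closure ⟨a, b * y, by simp only [mul_assoc]⟩
    | zero => rw [zero_mul]; exact zero_mem _
    | add x z _ _ hx hz => rw [add_mul]; exact add_mem hx hz
    | neg x _ hx => rw [neg_mul]; exact neg_mem hx
  let J : TwoSidedIdeal A := .mk' (closure (H : Set A)) (subset_closure H.zero_mem)
    (fun hx hy => H.topologicalClosure.add_mem hx hy) (fun hx => H.topologicalClosure.neg_mem hx)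
    (fun {x y} hy => map_mem_closure (f := fun z => x * z) (by fun_prop) hy (fun z hz => hl x z hz))
    (fun {x y} hx => map_mem_closure (f := fun z => z * y) (by fun_prop) hx (fun z hz => hr y z hz))
  have hJ : (J : Set A) = closure (H : Set A) := TwoSidedIdeal.coe_mk' ..
  have hkJ : k ∈ (J : Set A) := by
    rw [hJ, hH]
    exact subset_closure (AddSubgroup.subset_closure ⟨1, 1, by simp⟩)
  have hJtop : J = ⊤ := by
    refine (hA.2 J (by rw [hJ]; exact isClosed_closure)).resolve_left fun h => hk ?_
    rw [h] at hkJ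
    exact hkJ
  have h1 : (1 : A) ∈ closure (H : Set A) := by rw [← hJ, hJtop]; trivial
  obtain ⟨u, hu, hu1⟩ := Metric.mem_closure_iff.1 h1 1 one_pos
  rw [dist_eq_norm] at hu1
  obtain ⟨v, hv⟩ : IsUnit u := by
    have := isUnit_one_sub_of_norm_lt_one hu1
    rwa [sub_sub_cancel] at this
  have h2 : (1 : A) ∈ H := by
    have := hl ((v⁻¹ : Aˣ) : A) u hu
    rwa [← hv, Units.inv_mul] at this
  rw [hH] at h2
  obtain ⟨n, a, b, h⟩ := exists_sum_eq_of_mem_closure h2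
  exact ⟨n, a, b, h.symm⟩

section
variable {E : Type*} [NormedAddCommGroup E] [InnerProductSpace ℂ E] [FiniteDimensional ℂ E]

/-- Otherwise some nonzero `ξ` in the range of `P` has every `β i ξ` orthogonal to `S`, where `κ` is
bounded by `δ`. The sum then sends `ξ` to norm at most `‖ξ‖ / 4`, although it should move `ξ` by at
most `‖ξ‖ / 2`. -/
theorem finrank_le_of_sum_near {ι : Type*} [Fintype ι] {P κ : E →L[ℂ] E} (hP : IsStarProjection P)
    {α β : ι → (E →L[ℂ] E)} (h : ‖∑ i, α i * κ * β i - P‖ < 1 / 2) {δ : ℝ}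
    (hδ : 0 < δ) (hδL : δ * ∑ i, ‖α i‖ * ‖β i‖ ≤ 1 / 4) {S : Submodule ℂ E}
    (hS : ∀ ξ ∈ Sᗮ, ‖κ ξ‖ ≤ δ * ‖ξ‖) :
    Module.finrank ℂ (LinearMap.range (P : E →ₗ[ℂ] E)) ≤ Fintype.card ι * Module.finrank ℂ S := by
  by_contra! hlt
  let T : LinearMap.range (P : E →ₗ[ℂ] E) →ₗ[ℂ] (ι → S) := LinearMap.pi fun i =>
    (S.orthogonalProjectionOnto : E →ₗ[ℂ] S) ∘ₗ (β i : E →ₗ[ℂ] E) ∘ₗ Submodule.subtype _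
  have hker : LinearMap.ker T ≠ ⊥ := LinearMap.ker_ne_bot_of_finrank_lt (by
    rw [Module.finrank_pi_fintype]
    simpa using hlt)
  obtain ⟨⟨ξ, hξP⟩, hξ, hξ0⟩ := Submodule.exists_mem_ne_zero_of_ne_bot hker
  have hPξ : P ξ = ξ := by
    obtain ⟨ζ, rfl⟩ := hξP
    exact DFunLike.congr_fun hP.isIdempotentElem ζ
  have hξ0' : 0 < ‖ξ‖ := norm_pos_iff.2 fun h => hξ0 (Subtype.ext h)
  have hβ : ∀ i, β i ξ ∈ Sᗮ := fun i => by
    have h1 : T ⟨ξ, hξP⟩ i = 0 := by rw [LinearMap.mem_ker.1 hξ]; rfl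
    have h2 : S.orthogonalProjectionOnto (β i ξ) = 0 := h1
    exact Submodule.orthogonalProjectionOnto_eq_zero_iff.1 h2
  have n1 : ‖(∑ i, α i * κ * β i) ξ‖ ≤ 1 / 4 * ‖ξ‖ := by
    rw [sum_apply]
    calc ‖∑ i, (α i * κ * β i) ξ‖ ≤ ∑ i, ‖(α i * κ * β i) ξ‖ := norm_sum_le _ _
      _ ≤ ∑ i, δ * (‖α i‖ * ‖β i‖) * ‖ξ‖ := by
        refine Finset.sum_le_sum fun i _ => ?_
        have m1 := hS _ (hβ i)
        calc ‖α i (κ (β i ξ))‖ ≤ ‖α i‖ * (δ * (‖β i‖ * ‖ξ‖)) :=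
              ((α i).le_opNorm _).trans (mul_le_mul_of_nonneg_left (m1.trans
                (mul_le_mul_of_nonneg_left ((β i).le_opNorm _) hδ.le)) (norm_nonneg _))
          _ = δ * (‖α i‖ * ‖β i‖) * ‖ξ‖ := by ring
      _ = (δ * ∑ i, ‖α i‖ * ‖β i‖) * ‖ξ‖ := by rw [← Finset.sum_mul, ← Finset.mul_sum]
      _ ≤ 1 / 4 * ‖ξ‖ := by gcongr
  have n2 : ‖(∑ i, α i * κ * β i) ξ - ξ‖ ≤ 1 / 2 * ‖ξ‖ := by
    have := (∑ i, α i * κ * β i - P).le_of_opNorm_le h.le ξ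
    rwa [sub_apply, hPξ] at this
  have n3 := norm_sub_norm_le ξ ((∑ i, α i * κ * β i) ξ)
  rw [norm_sub_rev] at n2
  linarith

/-- In finite dimensions a left inverse is a right inverse, approximately. -/
theorem not_approximate_shift {P α β γ δ : E →L[ℂ] E} (hP : IsStarProjection P) {ξ : E}
    (hξ : ξ ≠ 0) (hPξ : P ξ = ξ) (hPβ : P * β = β) (hβP : β * P = β) (hPδ : P * δ = δ)
    (hαβ : ‖α * β - P‖ ≤ 1 / 2) (hγδ : ‖γ * δ - P‖ ≤ 1 / 2)
    (h : ‖γ * β‖ * (‖α‖ * ‖δ‖) < 1 / 8) : False := by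
  have hPP : ∀ z, P (P z) = P z := fun z => DFunLike.congr_fun hP.isIdempotentElem z
  have e1 : ∀ z, P (β z) = β z := fun z => DFunLike.congr_fun hPβ z
  have e2 : ∀ z, β (P z) = β z := fun z => DFunLike.congr_fun hβP z
  have e3 : ∀ z, P (δ z) = δ z := fun z => DFunLike.congr_fun hPδ z
  have low : ∀ η, P η = η → 1 / 2 * ‖η‖ ≤ ‖α (β η)‖ := fun η hη => by
    have := (α * β - P).le_of_opNorm_le hαβ η
    rw [sub_apply, hη, mul_apply_eq_comp, norm_sub_rev] at this
    have := norm_sub_norm_le η (α (β η))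
    linarith
  -- Finite dimension enters here: `β` is bounded below on the range of `P`, hence maps onto it.
  have hunit : IsUnit (β + (1 - P)) := isUnit_of_injective fun z hz => by
    have h0 : β z + (z - P z) = 0 := hz
    have h1 : β z = 0 := by
      have := congrArg P h0
      rwa [map_add, map_sub, hPP, sub_self, add_zero, e1, map_zero] at this
    have h2 : P z = z := by
      rw [h1, zero_add] at h0
      exact (sub_eq_zero.1 h0).symm
    have h3 := low z h2
    rw [h1, map_zero, norm_zero] at h3
    exact norm_le_zero_iff.1 (by linarith)
  obtain ⟨v, hv⟩ := hunit
  obtain ⟨η, hη⟩ : ∃ η, η = P ((v⁻¹ : (E →L[ℂ] E)ˣ).val (δ ξ)) := ⟨_, rfl⟩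
  have hβη : β η = δ ξ := by
    have h1 : (β + (1 - P)) ((v⁻¹ : (E →L[ℂ] E)ˣ).val (δ ξ)) = δ ξ := by
      rw [← hv]
      exact DFunLike.congr_fun v.mul_inv (δ ξ)
    have h2 : P (β ((v⁻¹ : (E →L[ℂ] E)ˣ).val (δ ξ)) + ((v⁻¹ : (E →L[ℂ] E)ˣ).val (δ ξ) -
        P ((v⁻¹ : (E →L[ℂ] E)ˣ).val (δ ξ)))) = P (δ ξ) := congrArg P h1
    rw [map_add, map_sub, hPP, sub_self, add_zero, e1, e3] at h2
    rw [hη, e2, h2]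
  have hPη : P η = η := by rw [hη, hPP]
  have n1 := low η hPη
  rw [hβη] at n1
  have n2 : ‖η‖ ≤ 2 * (‖α‖ * (‖δ‖ * ‖ξ‖)) := by
    have : ‖α (δ ξ)‖ ≤ ‖α‖ * (‖δ‖ * ‖ξ‖) :=
      (α.le_opNorm _).trans (by gcongr; exact δ.le_opNorm _)
    linarith
  have n3 : 1 / 2 * ‖ξ‖ ≤ ‖γ (δ ξ)‖ := by
    have := (γ * δ - P).le_of_opNorm_le hγδ ξ
    rw [sub_apply, hPξ, mul_apply_eq_comp, norm_sub_rev] at this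
    have := norm_sub_norm_le ξ (γ (δ ξ))
    linarith
  have n4 : ‖γ (δ ξ)‖ ≤ ‖γ * β‖ * (2 * (‖α‖ * (‖δ‖ * ‖ξ‖))) := by
    rw [← hβη]
    exact ((γ * β).le_opNorm η).trans (by gcongr)
  have n5 : 0 < ‖ξ‖ := norm_pos_iff.2 hξ
  have n6 : ‖γ * β‖ * (‖α‖ * ‖δ‖) * ‖ξ‖ < 1 / 8 * ‖ξ‖ := by gcongr
  nlinarith

end

theorem TracialModel.exists_range_ne_zero {A : Type*} [CStarAlgebra A] (M : TracialModel A)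
    {t : M.X} (h : 0 < M.rank t) : ∃ ξ, ξ ≠ 0 ∧ M.ev t M.q ξ = ξ := by
  have : LinearMap.range (M.ev t M.q : M.E →ₗ[ℂ] M.E) ≠ ⊥ := fun h0 => by
    rw [TracialModel.rank, h0, finrank_bot] at h
    exact lt_irrefl _ h
  obtain ⟨_, ⟨ζ, rfl⟩, h0⟩ := Submodule.exists_mem_ne_zero_of_ne_bot this
  exact ⟨_, h0, DFunLike.congr_fun (M.ev_q_mul t M.q) ζ⟩

section
variable {A : Type*} [CStarAlgebra A]

/-- The translates of the defect `1 - xy` under powers of the one-sided shift behave like matrix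
units. -/
theorem shift_orthogonality {A : Type*} [Ring A] {x y : A} (hyx : y * x = 1) (k l : ℕ) :
    (1 - x * y) * y ^ k * (x ^ l * (1 - x * y)) = if k = l then 1 - x * y else 0 := by
  have h1 : y * (1 - x * y) = 0 := by rw [mul_sub, mul_one, ← mul_assoc, hyx, one_mul, sub_self]
  have h2 : (1 - x * y) * x = 0 := by rw [sub_mul, one_mul, mul_assoc, hyx, mul_one, sub_self]
  have h3 : (1 - x * y) * (1 - x * y) = 1 - x * y := by
    rw [mul_sub, mul_one, ← mul_assoc, h2, zero_mul, sub_zero]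
  induction k generalizing l with
  | zero =>
    rcases l with _ | l
    · simp [h3]
    · rw [pow_zero, mul_one, pow_succ', ← mul_assoc, ← mul_assoc, h2, zero_mul, zero_mul]
      simp
  | succ k ih =>
    rcases l with _ | l
    · rw [pow_zero, one_mul, pow_succ, mul_assoc, mul_assoc, h1, mul_zero, mul_zero]
      simp
    · have : (1 - x * y) * y ^ (k + 1) * (x ^ (l + 1) * (1 - x * y)) =
          (1 - x * y) * y ^ k * (x ^ l * (1 - x * y)) := by
        calc _ = (1 - x * y) * y ^ k * (y * x) * (x ^ l * (1 - x * y)) := by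
              rw [pow_succ, pow_succ']
              simp only [mul_assoc]
          _ = _ := by rw [hyx, mul_one]
      rw [this, ih]
      simp

/-- A relation `yx = 1` with small defect `1 - xy` could be invisible in a model. Simplicity
amplifies the defect: it yields a left-invertible `w` with `yⁿ w = 0` while `yⁿ xⁿ = 1`, which is
impossible even approximately on a nonzero finite-dimensional fibre. -/
theorem mul_eq_one_of_mul_eq_one [PartialOrder A] [StarOrderedRing A] (hs : IsSimpleCStar A)
    (hA : InClassC1 A) {x y : A} (hyx : y * x = 1) : x * y = 1 := by
  by_contra hxy
  have := hs.1
  have hq : 1 - x * y ≠ 0 := fun h => hxy (sub_eq_zero.1 h).symm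
  obtain ⟨n, a, b, hab⟩ := hs.exists_sum_eq_one hq
  obtain ⟨w, hw⟩ : ∃ w, w = ∑ k : Fin n, x ^ (k : ℕ) * (1 - x * y) * b k := ⟨_, rfl⟩
  obtain ⟨w', hw'⟩ : ∃ w', w' = ∑ k : Fin n, a k * (1 - x * y) * y ^ (k : ℕ) := ⟨_, rfl⟩
  have h1 : w' * w = 1 := by
    rw [hw, hw', Finset.sum_mul]
    refine Eq.trans ?_ hab
    refine Finset.sum_congr rfl fun k _ => ?_
    rw [Finset.mul_sum, Finset.sum_eq_single k]
    · calc a k * (1 - x * y) * y ^ (k : ℕ) * (x ^ (k : ℕ) * (1 - x * y) * b k)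
          = a k * ((1 - x * y) * y ^ (k : ℕ) * (x ^ (k : ℕ) * (1 - x * y))) * b k := by
            simp only [mul_assoc]
        _ = _ := by rw [shift_orthogonality hyx, if_pos rfl]
    · intro l _ hl
      calc a k * (1 - x * y) * y ^ (k : ℕ) * (x ^ (l : ℕ) * (1 - x * y) * b l)
          = a k * ((1 - x * y) * y ^ (k : ℕ) * (x ^ (l : ℕ) * (1 - x * y))) * b l := by
            simp only [mul_assoc]
        _ = 0 := by
            rw [shift_orthogonality hyx, if_neg fun h => hl (Fin.ext h.symm), mul_zero, zero_mul]
    · simp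
  have hyx' : ∀ k : ℕ, y ^ k * x ^ k = 1 := fun k => by
    induction k with
    | zero => simp
    | succ k ih => rw [pow_succ, pow_succ', mul_assoc, ← mul_assoc y, hyx, one_mul, ih]
  have h2 : y ^ n * w = 0 := by
    rw [hw, Finset.mul_sum]
    refine Finset.sum_eq_zero fun k _ => ?_
    obtain ⟨j, hj⟩ : ∃ j, n = j + 1 + k := ⟨n - 1 - k, by have := k.2; omega⟩
    have hj' : y ^ n = y ^ j * y * y ^ (k : ℕ) := by rw [← pow_succ, ← pow_add, ← hj]
    have h0 : y * (1 - x * y) = 0 := by rw [mul_sub, mul_one, ← mul_assoc, hyx, one_mul, sub_self]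
    rw [hj']
    calc _ = y ^ j * y * (y ^ (k : ℕ) * x ^ (k : ℕ)) * (1 - x * y) * b k := by
          simp only [mul_assoc]
      _ = 0 := by rw [hyx', mul_one, mul_assoc _ y, h0, mul_zero, zero_mul]
  have hU : {v : Fin 4 → A | ‖v 1 * v 0 - 1‖ < 1 / 2 ∧ ‖v 2 * v 3 - 1‖ < 1 / 2 ∧
      ‖v 2 * v 0‖ * (‖v 1‖ * ‖v 3‖) < 1 / 8} ∈ 𝓝 (![w, w', y ^ n, x ^ n] : Fin 4 → A) := by
    refine IsOpen.mem_nhds ?_ ?_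
    · simp only [Set.ofPred_and]
      refine .inter (isOpen_lt ?_ ?_) (.inter (isOpen_lt ?_ ?_) (isOpen_lt ?_ ?_)) <;> fun_prop
    · simp [h1, h2, hyx']
  -- Only a nonzero fibre is needed, so `n = 1`, and the smallness of `1 - p` plays no role.
  obtain ⟨M, hM, -, v, hv1, hv2, hv3⟩ :=
    exists_tracialModel hA 1 _ hU (zero_le_one' A) one_ne_zero
  obtain ⟨t⟩ := M.nonemptyX
  obtain ⟨ξ, hξ, hPξ⟩ := M.exists_range_ne_zero (t := t) (by have := hM t; omega)
  refine not_approximate_shift (M.isStarProjection_ev_q t) (α := M.ev t (v 1)) (β := M.ev t (v 0))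
    (γ := M.ev t (v 2)) (δ := M.ev t (v 3)) hξ hPξ
    (M.ev_q_mul t _) (M.ev_mul_q t _) (M.ev_q_mul t _) ?_ ?_ ?_
  · rw [← map_mul, ← M.ev_one, ← map_sub]
    exact (M.norm_ev_le t _).trans hv1.le
  · rw [← map_mul, ← M.ev_one, ← map_sub]
    exact (M.norm_ev_le t _).trans hv2.le
  · rw [← map_mul]
    refine lt_of_le_of_lt ?_ hv3
    have n0 := M.norm_ev_le t (v 2 * v 0)
    have n1 := M.norm_ev_le t (v 1)
    have n3 := M.norm_ev_le t (v 3)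
    exact mul_le_mul n0 (mul_le_mul n1 n3 (norm_nonneg _) (norm_nonneg _))
      (mul_nonneg (norm_nonneg _) (norm_nonneg _)) (norm_nonneg _)

end
end TracialAH

/-! ### Perturbing projections, and an invertible block matrix. -/

namespace TracialAH

/-- The bound keeps the spectrum away from `1/2`, so the indicator of `(1/2, ∞)` is continuous on
it. The projection is written as a product `c * g` so that anything annihilating `c` annihilates it
as well. -/
theorem exists_projection_near {B : Type*} [CStarAlgebra B] {c : B} (hc : IsSelfAdjoint c) {δ : ℝ}
    (hδ : δ < 1 / 4) (h : ‖c * c - c‖ ≤ δ) :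
    ∃ g, c * g = g * c ∧ IsStarProjection (c * g) ∧ ‖c * g - c‖ ≤ 2 * δ := by
  have hδ0 : 0 ≤ δ := (norm_nonneg _).trans h
  have hspec : ∀ x ∈ spectrum ℝ c, |x * x - x| ≤ δ := fun x hx => by
    have h1 : cfc (fun x : ℝ => x * x - x) c = c * c - c := by
      rw [cfc_sub _ _ c, cfc_mul _ _ c, cfc_id' ℝ c]
    refine le_trans ?_ h
    rw [← h1]
    exact norm_apply_le_norm_cfc (fun x : ℝ => x * x - x) c hx
  have hhalf : ∀ x ∈ spectrum ℝ c, x ≠ 1 / 2 := fun x hx h0 => by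
    have := hspec x hx
    rw [h0] at this
    norm_num at this
    linarith
  obtain ⟨f, hf⟩ : ∃ f : ℝ → ℝ, f = fun x => if 1 / 2 < x then x⁻¹ else 0 := ⟨_, rfl⟩
  have hfc : ContinuousOn f (spectrum ℝ c) := fun x hx => by
    rcases lt_or_gt_of_ne (hhalf x hx) with h1 | h1
    · refine (continuousAt_const (y := (0 : ℝ))).congr ?_ |>.continuousWithinAt
      filter_upwards [Iio_mem_nhds h1] with y hy
      rw [hf]
      simp only [if_neg (not_lt.2 (le_of_lt (Set.mem_Iio.1 hy)))]
    · have hx0 : x ≠ 0 := by rintro rfl; norm_num at h1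
      refine (continuousAt_inv₀ hx0).congr ?_ |>.continuousWithinAt
      filter_upwards [Ioi_mem_nhds h1] with y hy
      rw [hf]
      simp only [if_pos (show 1 / 2 < y from hy)]
  have hval : ∀ x ∈ spectrum ℝ c, (1 / 2 < x ∧ x * f x = 1) ∨ (x < 1 / 2 ∧ x * f x = 0) :=
    fun x hx => by
    rcases lt_or_gt_of_ne (hhalf x hx) with h1 | h1
    · exact Or.inr ⟨h1, by rw [hf]; simp only [if_neg (not_lt.2 h1.le), mul_zero]⟩
    · have hx0 : x ≠ 0 := by rintro rfl; norm_num at h1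
      exact Or.inl ⟨h1, by rw [hf]; simp only [if_pos h1, mul_inv_cancel₀ hx0]⟩
  have hcg : c * cfc f c = cfc (fun x => x * f x) c := by
    rw [cfc_mul _ _ c, cfc_id' ℝ c]
  refine ⟨cfc f c, ?_, ⟨?_, ?_⟩, ?_⟩
  · rw [hcg, cfc_congr (g := fun x => f x * x) fun x _ => mul_comm _ _, cfc_mul _ _ c, cfc_id' ℝ c]
  · change _ * _ = _
    rw [hcg, ← cfc_mul _ _ c]
    refine cfc_congr fun x hx => ?_
    rcases hval x hx with ⟨-, h1⟩ | ⟨-, h1⟩ <;> simp [h1]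
  · rw [hcg]
    exact cfc_predicate _ c
  · have : c * cfc f c - c = cfc (fun x => x * f x - x) c := by
      rw [cfc_sub _ _ c, ← hcg, cfc_id' ℝ c]
    rw [this]
    refine norm_cfc_le (by positivity) fun x hx => ?_
    have h0 := hspec x hx
    rw [Real.norm_eq_abs]
    rcases hval x hx with ⟨hx1, h1⟩ | ⟨hx1, h1⟩
    · rw [h1]
      have : |x * x - x| = x * |1 - x| := by
        have h2 : x * x - x = x * -(1 - x) := by ring
        rw [h2, abs_mul, abs_neg, abs_of_pos (by linarith : 0 < x)]
      nlinarith [abs_nonneg (1 - x)]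
    · rw [h1, zero_sub, abs_neg]
      have : |x * x - x| = |x| * (1 - x) := by
        have h2 : x * x - x = -x * (1 - x) := by ring
        rw [h2, abs_mul, abs_neg, abs_of_pos (by linarith : 0 < 1 - x)]
      nlinarith [abs_nonneg x]

theorem norm_mul_self_sub_le {A : Type*} [NormedRing A] {c e : A} (he : e * e = e)
    (hen : ‖e‖ ≤ 1) {δ : ℝ} (hδ : δ ≤ 1) (h : ‖c - e‖ ≤ δ) : ‖c * c - c‖ ≤ 4 * δ := by
  have h1 : c * c - c = (c - e) * (c - e) + (c - e) * e + e * (c - e) - (c - e) := by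
    simp only [sub_mul, mul_sub, he]
    abel
  have n0 := norm_nonneg (c - e)
  have hδ0 : 0 ≤ δ := n0.trans h
  have n1 : ‖(c - e) * (c - e)‖ ≤ 1 * δ := (norm_mul_le _ _).trans (by gcongr; linarith)
  have n2 : ‖(c - e) * e‖ ≤ δ * 1 := (norm_mul_le _ _).trans (by gcongr)
  have n3 : ‖e * (c - e)‖ ≤ 1 * δ := (norm_mul_le _ _).trans (by gcongr)
  rw [h1]
  have m1 := norm_sub_le ((c - e) * (c - e) + (c - e) * e + e * (c - e)) (c - e)
  have m2 := norm_add_le ((c - e) * (c - e) + (c - e) * e) (e * (c - e))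
  have m3 := norm_add_le ((c - e) * (c - e)) ((c - e) * e)
  linarith

/-- A projection near a closed unital subalgebra is near a projection of the subalgebra. -/
theorem exists_projection_mem_near {A : Type*} [CStarAlgebra A] {B : StarSubalgebra ℂ A}
    [hB : IsClosed (B : Set A)] {e : A} (he : IsStarProjection e) {c : B} {δ : ℝ} (hδ : δ < 1 / 16)
    (hc : ‖(c : A) - e‖ ≤ δ) :
    ∃ c' g : B, IsSelfAdjoint c' ∧ c' = (2⁻¹ : ℂ) • (c + star c) ∧ c' * g = g * c' ∧
      IsStarProjection (c' * g) ∧ ‖((c' * g : B) : A) - e‖ ≤ 9 * δ := by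
  have hδ0 : 0 ≤ δ := (norm_nonneg _).trans hc
  obtain ⟨c', hc'⟩ : ∃ c' : B, c' = (2⁻¹ : ℂ) • (c + star c) := ⟨_, rfl⟩
  have hsa : IsSelfAdjoint c' := by
    rw [hc']
    refine IsSelfAdjoint.smul ?_ (.add_star_self c)
    rw [isSelfAdjoint_iff]
    simp
  have hn : ‖(c' : A) - e‖ ≤ δ := by
    have h1 : (c' : A) - e = (2⁻¹ : ℂ) • (((c : A) - e) + star ((c : A) - e)) := by
      rw [hc', star_sub, he.isSelfAdjoint.star_eq]
      change (2⁻¹ : ℂ) • ((c : A) + star (c : A)) - e = _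
      have : e = (2⁻¹ : ℂ) • (e + e) := by
        rw [← two_smul ℂ e, smul_smul]; norm_num
      conv_lhs => rw [this, ← smul_sub]
      congr 1
      abel
    rw [h1, norm_smul]
    have := norm_add_le ((c : A) - e) (star ((c : A) - e))
    rw [norm_star] at this
    have : ‖(2⁻¹ : ℂ)‖ = 2⁻¹ := by simp
    rw [this]
    linarith
  have h2 : ‖c' * c' - c'‖ ≤ 4 * δ :=
    norm_mul_self_sub_le (c := (c' : A)) he.isIdempotentElem he.norm_le (by linarith) hn
  obtain ⟨g, h3, h4, h5⟩ := exists_projection_near hsa (by linarith) h2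
  refine ⟨c', g, hsa, hc', h3, h4, ?_⟩
  have h6 : ‖((c' * g : B) : A) - c'‖ ≤ 2 * (4 * δ) := h5
  have := norm_sub_le_norm_sub_add_norm_sub ((c' * g : B) : A) (c' : A) e
  linarith

/-- On `Q` the element is `c`. On `f + ww'` it is the matrix with rows `(y, -ε)` and `(ε, 0)`, the
second coordinate being identified with `f` through `w`; this is invertible for every `y`. On the
rest of `g` it is the scalar `ε`. -/
theorem isUnit_block {R : Type*} [Ring R] [Algebra ℂ R] {Q f g c c' y w w' : R} (hsum : Q + f + g = 1)
    (hcQ : c * Q = c) (hc'Q : c' * Q = c') (hQc : Q * c = c) (hQc' : Q * c' = c')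
    (hcc : c * c' = Q) (hcc' : c' * c = Q) (hfQ : f * Q = 0) (hQf : Q * f = 0) (hgQ : g * Q = 0)
    (hQg : Q * g = 0)
    (hgg : g * g = g) (hfg : f * g = 0) (hgf : g * f = 0) (hyf : y * f = y)
    (hfy : f * y = y) (hw'w : w' * w = f) (hgw : g * w = w) (hwf : w * f = w) (hfw' : f * w' = w')
    (hw'g : w' * g = w') {ε : ℂ} (hε : ε ≠ 0) :
    IsUnit (c + (y + ε • (w - w') + ε • (g - w * w'))) := by
  obtain ⟨h, hh⟩ : ∃ h, h = g - w * w' := ⟨_, rfl⟩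
  rw [← hh]
  have yg : y * g = 0 := by rw [← hyf, mul_assoc, hfg, mul_zero]
  have gy : g * y = 0 := by rw [← hfy, ← mul_assoc, hgf, zero_mul]
  have yw : y * w = 0 := by rw [← hgw, ← mul_assoc, yg, zero_mul]
  have wg : w * g = 0 := by rw [← hwf, mul_assoc, hfg, mul_zero]
  have ww : w * w = 0 := by
    calc w * w = w * (g * w) := by rw [hgw]
      _ = 0 := by rw [← mul_assoc, wg, zero_mul]
  have gw' : g * w' = 0 := by rw [← hfw', ← mul_assoc, hgf, zero_mul]
  have w'w' : w' * w' = 0 := by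
    calc w' * w' = w' * g * w' := by rw [hw'g]
      _ = 0 := by rw [mul_assoc, gw', mul_zero]
  have w'y : w' * y = 0 := by rw [← hw'g, mul_assoc, gy, mul_zero]
  have yh : y * h = 0 := by rw [hh, mul_sub, yg, ← mul_assoc, yw, zero_mul, sub_zero]
  have hy' : h * y = 0 := by rw [hh, sub_mul, gy, mul_assoc, w'y, mul_zero, sub_zero]
  have wh : w * h = 0 := by rw [hh, mul_sub, wg, ← mul_assoc, ww, zero_mul, sub_zero]
  have hw : h * w = 0 := by rw [hh, sub_mul, hgw, mul_assoc, hw'w, hwf, sub_self]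
  have w'h : w' * h = 0 := by rw [hh, mul_sub, hw'g, ← mul_assoc, hw'w, hfw', sub_self]
  have hw' : h * w' = 0 := by rw [hh, sub_mul, gw', mul_assoc, w'w', mul_zero, sub_zero]
  have gh : g * h = h := by rw [hh, mul_sub, hgg, ← mul_assoc, hgw]
  have hhh : h * h = h := by
    calc h * h = (g - w * w') * h := by rw [← hh]
      _ = h := by rw [sub_mul, gh, mul_assoc, w'h, mul_zero, sub_zero]
  have ext : ∀ {a b : R}, a * b = 0 → ∀ z, a * (b * z) = 0 := fun hab z => by
    rw [← mul_assoc, hab, zero_mul]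
  have hw'wz : ∀ z, w' * (w * z) = f * z := fun z => by rw [← mul_assoc, hw'w]
  have hfyz : ∀ z, f * (y * z) = y * z := fun z => by rw [← mul_assoc, hfy]
  obtain ⟨η, hη⟩ : ∃ η, η = ε⁻¹ := ⟨_, rfl⟩
  have hεη : ε * η = 1 := by rw [hη, mul_inv_cancel₀ hε]
  have hηε : η * ε = 1 := by rw [hη, inv_mul_cancel₀ hε]
  have hεηz : ∀ z, ε * (η * z) = z := fun z => by rw [← mul_assoc, hεη, one_mul]
  obtain ⟨T, hT⟩ : ∃ T, T = y + ε • (w - w') + ε • h := ⟨_, rfl⟩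
  -- The explicit inverse of that matrix: rows `(0, ε⁻¹)` and `(-ε⁻¹, ε⁻² y)`.
  obtain ⟨T', hT'⟩ : ∃ T', T' = η • (w' - w) + (η * η) • (w * y * w') + η • h := ⟨_, rfl⟩
  have hfgw : f + w * w' + h = f + g := by rw [hh]; abel
  have h1 : T * T' = f + g := by
    rw [hT, hT', ← hfgw]
    simp only [add_mul, mul_add, sub_mul, mul_sub, smul_mul_assoc, mul_smul_comm, smul_smul,
      mul_assoc, smul_sub, smul_add, yw, yh, ww, wh, w'w', hw'w, w'h, hw', hw, hhh, ext yw, ext ww,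
      ext hw, hw'wz, hfyz, hηε, mul_one, one_smul, smul_zero]
    abel
  have h2 : T' * T = f + g := by
    rw [hT, hT', ← hfgw]
    simp only [add_mul, mul_add, sub_mul, mul_sub, smul_mul_assoc, mul_smul_comm, smul_smul,
      mul_assoc, smul_sub, smul_add, w'y, hy', ww, wh, w'w', hw'w, w'h, hw', hw, hhh, hyf, mul_zero,
      hεη, hεηz, one_smul, smul_zero]
    abel
  have hg : h * g = h := by rw [hh, sub_mul, hgg, mul_assoc, hw'g]
  have lf : ∀ {a : R}, f * a = a → Q * a = 0 := fun ha => by rw [← ha, ← mul_assoc, hQf, zero_mul]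
  have lg : ∀ {a : R}, g * a = a → Q * a = 0 := fun ha => by rw [← ha, ← mul_assoc, hQg, zero_mul]
  have rf : ∀ {a : R}, a * f = a → a * Q = 0 := fun ha => by rw [← ha, mul_assoc, hfQ, mul_zero]
  have rg : ∀ {a : R}, a * g = a → a * Q = 0 := fun ha => by rw [← ha, mul_assoc, hgQ, mul_zero]
  have TQ : T * Q = 0 := by
    rw [hT]
    simp only [add_mul, sub_mul, smul_mul_assoc, rf hyf, rf hwf, rg hw'g, rg hg, sub_zero, smul_zero,
      add_zero]
  have QT : Q * T = 0 := by
    rw [hT]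
    simp only [mul_add, mul_sub, mul_smul_comm, lf hfy, lg hgw, lf hfw', lg gh, sub_zero, smul_zero,
      add_zero]
  have T'Q : T' * Q = 0 := by
    rw [hT']
    simp only [add_mul, sub_mul, smul_mul_assoc, mul_assoc, rf hwf, rg hw'g, rg hg, sub_zero,
      smul_zero, add_zero, mul_zero]
  have QT' : Q * T' = 0 := by
    rw [hT']
    simp only [mul_add, mul_sub, mul_smul_comm, ← mul_assoc, lg hgw, lf hfw', lg gh, sub_zero,
      smul_zero, add_zero, zero_mul]
  rw [← hT]
  refine ⟨⟨c + T, c' + T', ?_, ?_⟩, rfl⟩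
  · have m1 : c * T' = 0 := by rw [← hcQ, mul_assoc, QT', mul_zero]
    have m2 : T * c' = 0 := by rw [← hQc', ← mul_assoc, TQ, zero_mul]
    rw [add_mul, mul_add, mul_add, m1, m2, hcc, h1, ← hsum]
    abel
  · have m1 : c' * T = 0 := by rw [← hc'Q, mul_assoc, QT, mul_zero]
    have m2 : T' * c = 0 := by rw [← hQc, ← mul_assoc, T'Q, zero_mul]
    rw [add_mul, mul_add, mul_add, m1, m2, hcc', h2, ← hsum]
    abel

/-- The comparison embeds the part of `1 - p` outside `E` into `e`, and a similarity carries `e` to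
the nearby `E`. The embedding need not be isometric: a one-sided inverse is all that `isUnit_block`
needs. -/
theorem exists_partial_inverse_of_cuntzLE {A : Type*} [CStarAlgebra A] {p e E : A}
    (hp : IsStarProjection p) (he : IsStarProjection e) (hE : IsStarProjection E)
    (hpE : p * E = E * p) (hEe : ‖E - e‖ < 1 / 2) (h : CuntzLE (1 - p) e) :
    ∃ w w' : A, w' * w = (1 - p) * (1 - E) ∧ E * w = w ∧ w * ((1 - p) * (1 - E)) = w ∧
      ((1 - p) * (1 - E)) * w' = w' ∧ w' * E = w' := by
  have hee : e * e = e := he.isIdempotentElem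
  have hEE : E * E = E := hE.isIdempotentElem
  obtain ⟨f, hf⟩ : ∃ f, f = (1 - p) * (1 - E) := ⟨_, rfl⟩
  rw [← hf]
  have hcomm : (1 - p) * (1 - E) = (1 - E) * (1 - p) := by
    simp only [sub_mul, mul_sub, one_mul, mul_one, hpE]
    abel
  have hff : f * f = f := by
    have h1 : (1 - p) * (1 - p) = 1 - p := hp.one_sub.isIdempotentElem
    have h2 : (1 - E) * (1 - E) = 1 - E := hE.one_sub.isIdempotentElem
    calc f * f = (1 - p) * ((1 - E) * (1 - p)) * (1 - E) := by rw [hf]; simp only [mul_assoc]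
      _ = ((1 - p) * (1 - p)) * ((1 - E) * (1 - E)) := by rw [← hcomm]; simp only [mul_assoc]
      _ = f := by rw [h1, h2, hf]
  have hfp : IsStarProjection f := by
    refine ⟨hff, ?_⟩
    change star f = f
    rw [hf, star_mul, hp.one_sub.isSelfAdjoint.star_eq, hE.one_sub.isSelfAdjoint.star_eq, hcomm]
  have hfpf : f * (1 - p) * f = f := by
    have : (1 - p) * f = f := by
      rw [hf, ← mul_assoc, hp.one_sub.isIdempotentElem.eq]
    rw [mul_assoc, this, hff]
  obtain ⟨x, hx⟩ := h
  obtain ⟨n, hn⟩ := (hx.eventually (gt_mem_nhds one_pos)).exists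
  -- `s` is `f x⋆ e x f + (1 - f)`, so `e x f` is left invertible on `f`.
  obtain ⟨s, hs⟩ : IsUnit (1 + f * (star (x n) * e * x n - (1 - p)) * f) :=
    isUnit_one_add_of_norm_lt ((norm_corner_le hfp.norm_le hfp.norm_le).trans_lt hn)
  have hs' : (s : A) = f * star (x n) * e * x n * f + (1 - f) := by
    rw [hs, mul_sub, sub_mul, hfpf]
    simp only [mul_assoc]
    abel
  have hsf : (s : A) * f = f * star (x n) * e * x n * f := by
    rw [hs', add_mul, mul_assoc _ f f, hff, sub_mul, one_mul, hff, sub_self, add_zero]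
  have hfs : f * (s : A) = f * star (x n) * e * x n * f := by
    rw [hs', mul_add, mul_sub, mul_one, hff, sub_self, add_zero]
    simp only [← mul_assoc, hff]
  have hfs' : f * ((s⁻¹ : Aˣ) : A) = ((s⁻¹ : Aˣ) : A) * f :=
    ((Commute.units_inv_right (show Commute f (s : A) from hfs.trans hsf.symm))).eq
  -- `z = E e + (1 - E)(1 - e)`, the standard intertwiner of two close projections.
  obtain ⟨z, hz⟩ : IsUnit (1 + (E * (e - E) + (E - e) * e)) := by
    refine isUnit_one_add_of_norm_lt ?_
    have n1 : ‖E * (e - E)‖ ≤ ‖E - e‖ := by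
      rw [norm_sub_rev E e]
      exact (norm_mul_le _ _).trans (mul_le_of_le_one_left (norm_nonneg _) hE.norm_le)
    have n2 : ‖(E - e) * e‖ ≤ ‖E - e‖ :=
      (norm_mul_le _ _).trans (mul_le_of_le_one_right (norm_nonneg _) he.norm_le)
    have := norm_add_le (E * (e - E)) ((E - e) * e)
    linarith
  have hEz : E * (z : A) = z * e := by
    rw [hz]
    simp only [mul_add, add_mul, mul_sub, sub_mul, mul_one, one_mul, ← mul_assoc, hEE]
    simp only [mul_assoc, hee]
    abel
  have hzE : e * ((z⁻¹ : Aˣ) : A) = ((z⁻¹ : Aˣ) : A) * E := by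
    rw [Units.eq_inv_mul_iff_mul_eq, ← mul_assoc, ← hEz, mul_assoc, Units.mul_inv, mul_one]
  refine ⟨z * e * x n * f, ((s⁻¹ : Aˣ) : A) * f * star (x n) * e * ((z⁻¹ : Aˣ) : A), ?_, ?_, ?_, ?_, ?_⟩
  · calc ((s⁻¹ : Aˣ) : A) * f * star (x n) * e * ((z⁻¹ : Aˣ) : A) * (z * e * x n * f)
        = ((s⁻¹ : Aˣ) : A) * (f * star (x n) * (e * (((z⁻¹ : Aˣ) : A) * z) * e) * x n * f) := by
          simp only [mul_assoc]
      _ = f := by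
          rw [Units.inv_mul, mul_one, hee, ← hsf, ← mul_assoc, Units.inv_mul, one_mul]
  · rw [← mul_assoc, ← mul_assoc, ← mul_assoc, hEz, mul_assoc (z : A), hee]
  · rw [mul_assoc, hff]
  · simp only [← mul_assoc, hfs']
    rw [mul_assoc _ f f, hff]
  · rw [mul_assoc, ← hzE, ← mul_assoc, mul_assoc _ e e, hee]

end TracialAH

/-! ### Lifting fibrewise constructions to the model algebra. -/

namespace TracialAH

namespace TracialModel
variable {A : Type*} [CStarAlgebra A] (M : TracialModel A)

/-- The function on the model space defined by an element of `B`. -/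
noncomputable def evMap (b : M.B) : C(M.X, M.E →L[ℂ] M.E) := ⟨fun t => M.ev t b, M.continuous_ev b⟩

theorem norm_le_of_ev_le {b : M.B} (hb : M.q * b = b) {ρ : ℝ} (h : ∀ t, ‖M.ev t b‖ ≤ ρ) :
    ‖b‖ ≤ ρ := by
  rw [← hb]
  exact M.norm_le_of_ev b ρ h

theorem eq_of_ev_eq {b b' : M.B} (hb : M.q * b = b) (hb' : M.q * b' = b')
    (h : ∀ t, M.ev t b = M.ev t b') : b = b' := by
  rw [← sub_eq_zero, ← norm_le_zero_iff]
  refine M.norm_le_of_ev_le (by rw [mul_sub, hb, hb']) fun t => ?_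
  rw [map_sub, h, sub_self, norm_zero]

theorem exists_lift (h : C(M.X, M.E →L[ℂ] M.E)) (h1 : ∀ t, M.ev t M.q * h t = h t)
    (h2 : ∀ t, h t * M.ev t M.q = h t) : ∃ b : M.B, M.q * b = b ∧ ∀ t, M.ev t b = h t := by
  obtain ⟨b, hb, hbt⟩ := M.exists_of_corner h h1 h2
  exact ⟨b, Subtype.ext hb, hbt⟩

theorem isStarProjection_ev {b : M.B} (hb : IsStarProjection b) (t : M.X) :
    IsStarProjection (M.ev t b) := by
  constructor
  · change M.ev t b * M.ev t b = M.ev t b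
    rw [← map_mul, hb.isIdempotentElem.eq]
  · change star (M.ev t b) = M.ev t b
    rw [← map_star, hb.isSelfAdjoint.star_eq]

theorem exists_corner_inverse_near {P e c : M.B} (hP : IsStarProjection P)
    (he : IsStarProjection e) (hqP : M.q * P = P) (hPe : P * e = e)
    (hr : ∀ t, 5 * (M.d + 1) ≤ Module.finrank ℂ (LinearMap.range (M.ev t e : M.E →ₗ[ℂ] M.E)))
    (hc : (P - e) * c = c) (hc' : c * (P - e) = c) {ε : ℝ} (hε : 0 < ε) :
    ∃ c' c'' : M.B, P * c' = c' ∧ c' * P = c' ∧ P * c'' = c'' ∧ c'' * P = c'' ∧ c' * c'' = P ∧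
      c'' * c' = P ∧ ‖c' - c‖ ≤ ε := by
  have hqe : M.q * e = e := by rw [← hPe, ← mul_assoc, hqP]
  have hqc : M.q * c = c := by rw [← hc, ← mul_assoc, mul_sub, hqP, hqe]
  have hPq : P * M.q = P := by rw [← M.q_comm, hqP]
  obtain ⟨h', h'', h1, h2, h3, h4, h5, h6, h7⟩ := TracialAH.exists_corner_inverse_near M.dim_le
    (M.evMap P) (M.evMap e) (M.evMap c) (M.isStarProjection_ev hP) (M.isStarProjection_ev he)
    (fun t => by
      change M.ev t P * M.ev t e = M.ev t e
      rw [← map_mul, hPe])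
    hr
    (fun t => by
      change (M.ev t P - M.ev t e) * M.ev t c = M.ev t c
      rw [← map_sub, ← map_mul, hc])
    (fun t => by
      change M.ev t c * (M.ev t P - M.ev t e) = M.ev t c
      rw [← map_sub, ← map_mul, hc'])
    hε
  have l : ∀ h : C(M.X, M.E →L[ℂ] M.E), (∀ t, M.evMap P t * h t = h t) →
      (∀ t, h t * M.evMap P t = h t) → ∃ b : M.B, P * b = b ∧ b * P = b ∧ M.q * b = b ∧
        ∀ t, M.ev t b = h t := fun h hl hr => by
    obtain ⟨b, hb, hbt⟩ := M.exists_lift h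
      (fun t => by
        rw [← hl t, ← mul_assoc]
        change M.ev t M.q * M.ev t P * h t = M.ev t P * h t
        rw [← map_mul, hqP])
      (fun t => by
        rw [← hr t, mul_assoc]
        change h t * (M.ev t P * M.ev t M.q) = h t * M.ev t P
        rw [← map_mul, hPq])
    refine ⟨b, M.eq_of_ev_eq (by rw [← mul_assoc, hqP]) hb fun t => ?_,
      M.eq_of_ev_eq (by rw [← mul_assoc, hb]) hb fun t => ?_, hb, hbt⟩
    · rw [map_mul, hbt]; exact hl t
    · rw [map_mul, hbt]; exact hr t
  obtain ⟨c', a1, a2, a3, a4⟩ := l h' h1 h2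
  obtain ⟨c'', b1, b2, b3, b4⟩ := l h'' h3 h4
  refine ⟨c', c'', a1, a2, b1, b2, M.eq_of_ev_eq (by rw [← mul_assoc, a3]) hqP fun t => ?_,
    M.eq_of_ev_eq (by rw [← mul_assoc, b3]) hqP fun t => ?_,
    M.norm_le_of_ev_le (by rw [mul_sub, a3, hqc]) fun t => ?_⟩
  · rw [map_mul, a4, b4]; exact h5 t
  · rw [map_mul, a4, b4]; exact h6 t
  · rw [map_sub, a4]
    exact (ContinuousMap.norm_coe_le_norm (h' - M.evMap c) t).trans h7.le

/-- If finitely many two-sided translates of `k` sum to nearly `1`, then in each fibre `k` is bounded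
below on a subspace of proportional dimension. -/
theorem exists_subspace {n : ℕ} {a b : Fin n → M.B} {k : M.B} (hk : IsSelfAdjoint k)
    (h : ‖∑ i, a i * k * b i - 1‖ < 1 / 2) {δ : ℝ} (hδ : 0 < δ)
    (hδL : δ * ∑ i, ‖a i‖ * ‖b i‖ ≤ 1 / 4) (t : M.X) :
    ∃ S : Submodule ℂ M.E, M.rank t ≤ n * Module.finrank ℂ S ∧
      ∀ ξ ∈ S, ∃ ζ, ξ = M.ev t k ζ ∧ δ * ‖ζ‖ ≤ ‖ξ‖ := by
  have hκ : IsSelfAdjoint (M.ev t k) := by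
    rw [isSelfAdjoint_iff, ← map_star, hk.star_eq]
  obtain ⟨S, hS, hS'⟩ := exists_spectral_subspace hκ hδ
  refine ⟨S, ?_, hS⟩
  have := finrank_le_of_sum_near (M.isStarProjection_ev_q t) (α := fun i => M.ev t (a i))
    (β := fun i => M.ev t (b i)) (κ := M.ev t k) ?_ hδ ?_ hS'
  · rwa [Fintype.card_fin] at this
  · simp only [← map_mul]
    rw [← map_sum, ← M.ev_one, ← map_sub]
    exact (M.norm_ev_le t _).trans_lt h
  · refine le_trans ?_ hδL
    gcongr
    · exact M.norm_ev_le t _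
    · exact M.norm_ev_le t _

end TracialModel

section
variable {A : Type*} [CStarAlgebra A]

theorem norm_compress_sub_le {E e x y : A} (hE : IsStarProjection E) (hex : e * x = 0)
    (hxe : x * e = 0) {δ ρ : ℝ} (hδ : ‖E - e‖ ≤ δ) (hρ : ‖y - x‖ ≤ ρ) :
    ‖(1 - E) * y * (1 - E) - x‖ ≤ ρ + 2 * δ * ‖x‖ := by
  have hn := hE.one_sub.norm_le
  have hδ0 : 0 ≤ δ := (norm_nonneg _).trans hδ
  have e1 : (1 - E) * y * (1 - E) - x =
      (1 - E) * (y - x) * (1 - E) - (E - e) * x * (1 - E) - x * (E - e) := by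
    simp only [sub_mul, mul_sub, one_mul, mul_one, hex, hxe]
    simp
    abel
  have n1 := norm_corner_le (x := y - x) hn hn
  have n2 : ‖(E - e) * x * (1 - E)‖ ≤ δ * ‖x‖ * 1 :=
    norm_mul₃_le.trans (by gcongr)
  have n3 : ‖x * (E - e)‖ ≤ ‖x‖ * δ := (norm_mul_le _ _).trans (by gcongr)
  rw [e1]
  have m1 := norm_sub_le ((1 - E) * (y - x) * (1 - E) - (E - e) * x * (1 - E)) (x * (E - e))
  have m2 := norm_sub_le ((1 - E) * (y - x) * (1 - E)) ((E - e) * x * (1 - E))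
  linarith

/-- Compress the second approximant by `1 - E₁` before taking its spectral projection, which
therefore stays orthogonal to `E₁`. Compression costs `δ + 2 · 9δ = 19δ`, and `9 · 19 = 171`. -/
theorem exists_orthogonal_projections_near {B : StarSubalgebra ℂ A} [hB : IsClosed (B : Set A)]
    {e₁ e₂ : A} (he₁ : IsStarProjection e₁) (he₂ : IsStarProjection e₂) (h12 : e₁ * e₂ = 0)
    {b₁ b₂ : B} {δ : ℝ} (hδ : δ < 1 / 1000) (h₁ : ‖(b₁ : A) - e₁‖ ≤ δ) (h₂ : ‖(b₂ : A) - e₂‖ ≤ δ) :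
    ∃ E₁ E₂ : B, IsStarProjection E₁ ∧ IsStarProjection E₂ ∧ E₁ * E₂ = 0 ∧ E₂ * E₁ = 0 ∧
      ‖(E₁ : A) - e₁‖ ≤ 9 * δ ∧ ‖(E₂ : A) - e₂‖ ≤ 171 * δ := by
  have hδ0 : 0 ≤ δ := (norm_nonneg _).trans h₁
  have h21 : e₂ * e₁ = 0 := by
    have := congrArg star h12
    rwa [star_mul, he₁.isSelfAdjoint.star_eq, he₂.isSelfAdjoint.star_eq, star_zero] at this
  obtain ⟨c₁, g₁, -, -, -, hE₁, hn₁⟩ := exists_projection_mem_near he₁ (by linarith) h₁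
  obtain ⟨E₁, hE⟩ : ∃ E₁, E₁ = c₁ * g₁ := ⟨_, rfl⟩
  rw [← hE] at hE₁ hn₁
  have hE₁A : IsStarProjection (E₁ : A) :=
    ⟨congrArg Subtype.val hE₁.isIdempotentElem, congrArg Subtype.val hE₁.isSelfAdjoint⟩
  obtain ⟨b, hb⟩ : ∃ b, b = (1 - E₁) * b₂ * (1 - E₁) := ⟨_, rfl⟩
  have hn : ‖(b : A) - e₂‖ ≤ 19 * δ := by
    have := norm_compress_sub_le hE₁A h12 h21 hn₁ h₂
    have h3 := he₂.norm_le
    rw [hb]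
    refine this.trans ?_
    nlinarith
  have hEb : E₁ * b = 0 := by
    rw [hb, ← mul_assoc, ← mul_assoc, hE₁.mul_one_sub_self, zero_mul, zero_mul]
  have hbE : b * E₁ = 0 := by
    rw [hb, mul_assoc, hE₁.one_sub_mul_self, mul_zero]
  have hEb' : E₁ * star b = 0 := by
    have := congrArg star hbE
    rwa [star_mul, hE₁.isSelfAdjoint.star_eq, star_zero] at this
  have hbE' : star b * E₁ = 0 := by
    have := congrArg star hEb
    rwa [star_mul, hE₁.isSelfAdjoint.star_eq, star_zero] at this
  obtain ⟨c₂, g₂, -, hc₂, hcg, hE₂, hn₂⟩ := exists_projection_mem_near he₂ (by linarith) hn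
  refine ⟨E₁, c₂ * g₂, hE₁, hE₂, ?_, ?_, hn₁, by linarith⟩
  · rw [← mul_assoc, hc₂, mul_smul_comm, mul_add, hEb, hEb', add_zero, smul_zero, zero_mul]
  · rw [hcg, mul_assoc, hc₂, smul_mul_assoc, add_mul, hbE, hbE', add_zero, smul_zero, mul_zero]

end
end TracialAH

/-! ### Elements orthogonal on both sides to two projections. -/

namespace TracialAH

section
variable {A : Type*} [CStarAlgebra A]

/-- Units near an element orthogonal to two projections of which one dominates the complement of the
model and the other is large in the model. -/
theorem TracialModel.exists_isUnit_near (M : TracialModel A) {e : A} (he : IsStarProjection e)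
    (hp : CuntzLE (1 - M.p) e) {E₁ E₂ b : M.B} (hE₁ : IsStarProjection E₁)
    (hE₂ : IsStarProjection E₂) (h12 : E₁ * E₂ = 0) (hb₁ : E₁ * b = 0)
    (hb₁' : b * E₁ = 0) (hb₂ : E₂ * b = 0) (hb₂' : b * E₂ = 0) (hE₁e : ‖(E₁ : A) - e‖ < 1 / 2)
    (hr : ∀ t, 5 * (M.d + 1) ≤ Module.finrank ℂ (LinearMap.range (M.ev t E₂ : M.E →ₗ[ℂ] M.E)))
    {ε : ℝ} (hε : 0 < ε) : ∃ g : A, IsUnit g ∧ ‖g - b‖ ≤ 2 * ε := by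
  have hqq := M.q_mul_q
  have hq : ∀ b, M.q * b = b * M.q := M.q_comm
  have hqz : ∀ b c, b * (M.q * c) = M.q * (b * c) := fun b c => by
    rw [← mul_assoc, ← hq, mul_assoc]
  have hqp : IsStarProjection M.q := ⟨hqq, M.star_q⟩
  have hEE₁ : E₁ * E₁ = E₁ := hE₁.isIdempotentElem
  have hEE₂ : E₂ * E₂ = E₂ := hE₂.isIdempotentElem
  have hqqz : ∀ b, M.q * (M.q * b) = M.q * b := fun b => by rw [← mul_assoc, hqq]
  have hP : IsStarProjection (M.q * (1 - E₁)) := by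
    constructor
    · change _ * _ = _
      rw [mul_assoc, hqz, hqqz, hE₁.one_sub.isIdempotentElem.eq]
    · change star _ = _
      rw [star_mul, M.star_q, hE₁.one_sub.isSelfAdjoint.star_eq, hq]
  have hqE : IsStarProjection (M.q * E₂) := by
    constructor
    · change _ * _ = _
      rw [mul_assoc, hqz, hqqz, hEE₂]
    · change star _ = _
      rw [star_mul, M.star_q, hE₂.isSelfAdjoint.star_eq, hq]
  have hPb : M.q * (1 - E₁) - M.q * E₂ = M.q * (1 - E₁ - E₂) := by rw [mul_sub _ (1 - E₁)]
  obtain ⟨c', c'', h1, h2, h3, h4, h5, h6, h7⟩ := M.exists_corner_inverse_near hP hqE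
    (c := M.q * b) (hqqz _)
    (by rw [mul_assoc, hqz, hqqz, sub_mul, one_mul, h12, sub_zero])
    (fun t => by rw [map_mul, M.ev_q_mul]; exact hr t)
    (by rw [hPb, mul_assoc, hqz, hqqz, sub_mul, sub_mul, hb₁, hb₂, one_mul, sub_zero, sub_zero])
    (by rw [hPb, mul_assoc, hqz, hqqz, mul_sub b, mul_sub b, hb₁', hb₂', mul_one, sub_zero, sub_zero])
    hε
  have coe : ∀ {a b : M.B}, a = b → (a : A) = b := fun h => congrArg _ h
  have hE₁A : IsStarProjection (E₁ : A) := ⟨coe hEE₁, coe hE₁.isSelfAdjoint⟩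
  obtain ⟨w, w', hw1, hw2, hw3, hw4, hw5⟩ := exists_partial_inverse_of_cuntzLE
    M.isStarProjection_p he hE₁A (coe (hq E₁)) hE₁e hp
  -- The comparison gives no bound on `w` and `w'`, so the scale `ρ` of the block matrix is chosen
  -- after them.
  obtain ⟨K, hK⟩ : ∃ K, K = ‖(w - w') + ((E₁ : A) - w * w')‖ := ⟨_, rfl⟩
  have hK0 : 0 ≤ K := hK ▸ norm_nonneg _
  obtain ⟨ρ, hρ⟩ : ∃ ρ, ρ = ε / (K + 1) := ⟨_, rfl⟩
  have hρ0 : 0 < ρ := by rw [hρ]; positivity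
  have hρK : ρ * K ≤ ε := by
    rw [hρ, div_mul_eq_mul_div, div_le_iff₀ (by positivity)]
    nlinarith
  -- The three summands are the blocks `Q`, `f`, `g` of `isUnit_block`; `qE₂` is the spare room
  -- inside the first, and `E₁` receives the complement of the model.
  have hmul : M.q * (1 - E₁) + (1 - M.q) * (1 - E₁) + E₁ = 1 := by noncomm_ring
  obtain ⟨f, hf⟩ : ∃ f : M.B, f = (1 - M.q) * (1 - E₁) := ⟨_, rfl⟩
  have hcommf : f = (1 - E₁) * (1 - M.q) := by
    rw [hf]
    simp only [mul_sub, sub_mul, one_mul, mul_one, hq]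
    abel
  have hfE : f * E₁ = 0 := by rw [hf, mul_assoc, hE₁.one_sub_mul_self, mul_zero]
  have hEf : E₁ * f = 0 := by rw [hcommf, ← mul_assoc, hE₁.mul_one_sub_self, zero_mul]
  have hqf : M.q * f = 0 := by rw [hf, ← mul_assoc, hqp.mul_one_sub_self, zero_mul]
  have hfq : f * M.q = 0 := by rw [← hq, hqf]
  have hPE : M.q * (1 - E₁) * E₁ = 0 := by rw [mul_assoc, hE₁.one_sub_mul_self, mul_zero]
  have hEP : E₁ * (M.q * (1 - E₁)) = 0 := by rw [hqz, hE₁.mul_one_sub_self, mul_zero]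
  have hfP : f * (M.q * (1 - E₁)) = 0 := by rw [← mul_assoc, hfq, zero_mul]
  have hPf : M.q * (1 - E₁) * f = 0 := by rw [mul_assoc, sub_mul, one_mul, hEf, sub_zero, hqf]
  have hfy : f * ((1 - M.q) * b) = (1 - M.q) * b := by
    rw [hcommf, mul_assoc, ← mul_assoc (1 - M.q), hqp.one_sub.isIdempotentElem.eq, sub_mul, one_mul,
      sub_mul 1 M.q, one_mul, mul_sub, hb₁, hqz, hb₁, mul_zero, sub_zero, sub_zero]
  have hyf : (1 - M.q) * b * f = (1 - M.q) * b := by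
    have hbq : (1 - M.q) * b = b * (1 - M.q) := by rw [sub_mul, mul_sub, one_mul, mul_one, hq]
    rw [hf, hbq, mul_assoc, ← mul_assoc (1 - M.q), hqp.one_sub.isIdempotentElem.eq, ← mul_assoc,
      ← hbq, mul_assoc, mul_sub, hb₁', mul_one, sub_zero]
  have hunit := isUnit_block (Q := ((M.q * (1 - E₁) : M.B) : A)) (f := (f : A)) (g := (E₁ : A))
    (c := (c' : A)) (c' := (c'' : A)) (y := (((1 - M.q) * b : M.B) : A)) (w := w)
    (w' := w') (by rw [hf]; exact coe hmul) (coe h2) (coe h4) (coe h1) (coe h3) (coe h5) (coe h6)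
    (coe hfP) (coe hPf) (coe hEP) (coe hPE) (coe hEE₁) (coe hfE) (coe hEf) (coe hyf) (coe hfy)
    (by rw [hf]; exact hw1) hw2 (by rw [hf]; exact hw3) (by rw [hf]; exact hw4) hw5
    (ε := (ρ : ℂ)) (by exact_mod_cast hρ0.ne')
  refine ⟨_, hunit, ?_⟩
  have e1 : (c' : A) + ((((1 - M.q) * b : M.B) : A) + (ρ : ℂ) • (w - w') +
      (ρ : ℂ) • ((E₁ : A) - w * w')) - b = ((c' - M.q * b : M.B) : A) +
      (ρ : ℂ) • ((w - w') + ((E₁ : A) - w * w')) := by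
    have : ((1 - M.q) * b : M.B) = b - M.q * b := by rw [sub_mul, one_mul]
    rw [this, smul_add]
    push_cast
    abel
  rw [e1]
  refine (norm_add_le _ _).trans ?_
  have n1 : ‖((c' - M.q * b : M.B) : A)‖ ≤ ε := h7
  have n2 : ‖(ρ : ℂ) • ((w - w') + ((E₁ : A) - w * w'))‖ ≤ ε := by
    rw [norm_smul, Complex.norm_real, Real.norm_of_nonneg hρ0.le, ← hK]
    exact hρK
  linarith

/-- The two projections have separate tasks: `e₁` controls the complement of the model through `1 -
p ≲ e₁`, and `e₂` gives a projection of large rank inside it, by simplicity. -/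
theorem mem_closure_isUnit_of_orthogonal [PartialOrder A] [StarOrderedRing A]
    (hs : IsSimpleCStar A) (hA : InClassC1 A) {x e₁ e₂ : A} (he₁ : IsStarProjection e₁)
    (he₂ : IsStarProjection e₂) (h₁ : e₁ ≠ 0) (h₂ : e₂ ≠ 0) (h12 : e₁ * e₂ = 0)
    (hx₁ : e₁ * x = 0) (hx₁' : x * e₁ = 0) (hx₂ : e₂ * x = 0) (hx₂' : x * e₂ = 0) :
    x ∈ closure {x : A | IsUnit x} := by
  have := hs.1
  obtain ⟨n, a, b, hab⟩ := hs.exists_sum_eq_one h₂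
  have hn : 0 < n := by
    rcases Nat.eq_zero_or_pos n with rfl | h
    · simp at hab
    · exact h
  refine Metric.mem_closure_iff.2 fun r hr => ?_
  have hcont : ∀ᶠ z in 𝓝 (Sum.elim (![e₁, e₂, x] : Fin 3 → A) (Sum.elim a b), e₂),
      ‖∑ i : Fin n, z.1 (Sum.inr (Sum.inl i)) * z.2 * z.1 (Sum.inr (Sum.inr i)) - 1‖ < 1 / 2 := by
    refine ContinuousAt.eventually_lt (by fun_prop) continuousAt_const ?_
    simp [hab]
  rw [nhds_prod_eq, Filter.eventually_prod_iff] at hcont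
  obtain ⟨pa, hpa, pb, hpb, hpab⟩ := hcont
  obtain ⟨δ₀, hδ₀, hδ₀b⟩ := Metric.eventually_nhds_iff.1 hpb
  -- The sum of the two projections moves by at most `9δ + 171δ = 180δ`, so compression moves `x` by
  -- at most `δ + 360δ‖x‖`.
  obtain ⟨δ, hδ0, hδ1, hδ2, hδ3⟩ : ∃ δ : ℝ, 0 < δ ∧ δ < 1 / 1000 ∧ 171 * δ < δ₀ ∧
      δ * (1 + 400 * ‖x‖) < r / 2 := by
    have hx0 := norm_nonneg x
    have e1 : ∀ᶠ δ : ℝ in 𝓝[>] 0, δ < 1 / 1000 ∧ 171 * δ < δ₀ ∧ δ * (1 + 400 * ‖x‖) < r / 2 := by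
      refine nhdsWithin_le_nhds ?_
      refine (ContinuousAt.eventually_lt (by fun_prop) continuousAt_const (by norm_num)).and
        ((ContinuousAt.eventually_lt (by fun_prop) continuousAt_const (by simpa)).and
        (ContinuousAt.eventually_lt (by fun_prop) continuousAt_const (by simpa)))
    obtain ⟨δ, h, hδ⟩ := (e1.and self_mem_nhdsWithin).exists
    exact ⟨δ, hδ, h⟩
  have hball : ∀ᶠ v in 𝓝 (Sum.elim (![e₁, e₂, x] : Fin 3 → A) (Sum.elim a b)),
      ‖v (Sum.inl 0) - e₁‖ < δ ∧ ‖v (Sum.inl 1) - e₂‖ < δ ∧ ‖v (Sum.inl 2) - x‖ < δ := by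
    have hc : ∀ (i : Fin 3 ⊕ Fin n ⊕ Fin n) (e : A), Continuous fun v : Fin 3 ⊕ Fin n ⊕ Fin n → A =>
        ‖v i - e‖ := fun i e => by fun_prop
    refine ((hc _ _).continuousAt.eventually_lt continuousAt_const (by simpa)).and
      (((hc _ _).continuousAt.eventually_lt continuousAt_const (by simpa)).and
      ((hc _ _).continuousAt.eventually_lt continuousAt_const (by simpa)))
  -- Since `n` translates of `E₂` nearly add up to `1`, its fibre rank is at least one `n`-th of
  -- that of `p`, hence the factor `n * 5`.
  obtain ⟨M, hM, hp, v, hv1, hv2, hv3, hv4⟩ :=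
    exists_tracialModel hA (n * 5) _ (hpa.and hball) he₁.nonneg h₁
  obtain ⟨E₁, E₂, hE₁, hE₂, hE12, hE21, hn₁, hn₂⟩ :=
    exists_orthogonal_projections_near he₁ he₂ h12 hδ1 hv2.le hv3.le
  have hsum : ‖∑ i : Fin n, v (Sum.inr (Sum.inl i)) * E₂ * v (Sum.inr (Sum.inr i)) - 1‖ <
      1 / 2 := by
    have h := hpab hv1 (hδ₀b (show dist (E₂ : A) e₂ < δ₀ by rw [dist_eq_norm]; linarith))
    have e1 : ‖∑ i : Fin n, v (Sum.inr (Sum.inl i)) * E₂ * v (Sum.inr (Sum.inr i)) - 1‖ =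
      ‖((∑ i : Fin n, v (Sum.inr (Sum.inl i)) * E₂ * v (Sum.inr (Sum.inr i)) - 1 : M.B) : A)‖ := rfl
    rw [e1]
    push_cast
    exact h
  have hrank : ∀ t, 5 * (M.d + 1) ≤
      Module.finrank ℂ (LinearMap.range (M.ev t E₂ : M.E →ₗ[ℂ] M.E)) := fun t => by
    obtain ⟨L, hL⟩ : ∃ L, L = ∑ i : Fin n,
      ‖v (Sum.inr (Sum.inl i))‖ * ‖v (Sum.inr (Sum.inr i))‖ := ⟨_, rfl⟩
    have hL0 : 0 ≤ L := by rw [hL]; positivity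
    obtain ⟨S, hS, hS'⟩ := M.exists_subspace hE₂.isSelfAdjoint hsum (δ := 1 / (4 * (L + 1)))
      (by positivity)
      (by rw [← hL, div_mul_eq_mul_div, one_mul, div_le_div_iff₀ (by positivity) (by norm_num)]
          linarith) t
    have h1 : S ≤ LinearMap.range (M.ev t E₂ : M.E →ₗ[ℂ] M.E) := fun ξ hξ => by
      obtain ⟨ζ, hζ, -⟩ := hS' ξ hξ
      exact ⟨ζ, hζ.symm⟩
    have h2 := Submodule.finrank_mono h1
    have h3 : n * (5 * (M.d + 1)) ≤ n * Module.finrank ℂ S := by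
      rw [← mul_assoc]
      exact (hM t).trans hS
    exact (Nat.le_of_mul_le_mul_left h3 hn).trans h2
  obtain ⟨F, hF⟩ : ∃ F : M.B, F = E₁ + E₂ := ⟨_, rfl⟩
  have hFp : IsStarProjection F := by
    constructor
    · change F * F = F
      rw [hF, add_mul, mul_add, mul_add, hE₁.isIdempotentElem.eq, hE₂.isIdempotentElem.eq, hE12,
        hE21, add_zero, zero_add]
    · rw [hF]; exact hE₁.isSelfAdjoint.add hE₂.isSelfAdjoint
  have hF1 : E₁ * (1 - F) = 0 := by
    rw [hF, mul_sub, mul_one, mul_add, hE₁.isIdempotentElem.eq, hE12, add_zero, sub_self]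
  have hF2 : E₂ * (1 - F) = 0 := by
    rw [hF, mul_sub, mul_one, mul_add, hE₂.isIdempotentElem.eq, hE21, zero_add, sub_self]
  have hF1' : (1 - F) * E₁ = 0 := by
    rw [hF, sub_mul, one_mul, add_mul, hE₁.isIdempotentElem.eq, hE21, add_zero, sub_self]
  have hF2' : (1 - F) * E₂ = 0 := by
    rw [hF, sub_mul, one_mul, add_mul, hE₂.isIdempotentElem.eq, hE12, zero_add, sub_self]
  obtain ⟨g, hg, hgb⟩ := M.exists_isUnit_near he₁ hp (b := (1 - F) * v (Sum.inl 2) * (1 - F))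
    hE₁ hE₂ hE12 (by rw [← mul_assoc, ← mul_assoc, hF1, zero_mul, zero_mul])
    (by rw [mul_assoc, hF1', mul_zero]) (by rw [← mul_assoc, ← mul_assoc, hF2, zero_mul, zero_mul])
    (by rw [mul_assoc, hF2', mul_zero]) (by linarith) hrank (ε := r / 4) (by positivity)
  refine ⟨g, hg, ?_⟩
  have hFA : IsStarProjection (F : A) :=
    ⟨congrArg Subtype.val hFp.isIdempotentElem, congrArg Subtype.val hFp.isSelfAdjoint⟩
  have hFn : ‖(F : A) - (e₁ + e₂)‖ ≤ 180 * δ := by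
    have : (F : A) - (e₁ + e₂) = ((E₁ : A) - e₁) + ((E₂ : A) - e₂) := by
      rw [hF]; push_cast; abel
    rw [this]
    exact (norm_add_le _ _).trans (by linarith)
  have hbx := norm_compress_sub_le hFA (e := e₁ + e₂) (x := x) (y := v (Sum.inl 2))
    (by rw [add_mul, hx₁, hx₂, add_zero]) (by rw [mul_add, hx₁', hx₂', add_zero]) hFn hv4.le
  have hgb' : ‖g - (1 - (F : A)) * v (Sum.inl 2) * (1 - (F : A))‖ ≤ 2 * (r / 4) := hgb
  rw [dist_comm, dist_eq_norm]
  have := norm_sub_le_norm_sub_add_norm_sub g ((1 - (F : A)) * v (Sum.inl 2) * (1 - (F : A))) x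
  have hx0 := norm_nonneg x
  nlinarith

end
end TracialAH

/-! ### Partial isometries between orthogonal trivial subbundles. -/

namespace TracialAH

open ContinuousLinearMap (adjoint)

section
variable {E F : Type*} [NormedAddCommGroup E] [InnerProductSpace ℂ E] [FiniteDimensional ℂ E]
  [NormedAddCommGroup F] [InnerProductSpace ℂ F] [FiniteDimensional ℂ F]

omit [FiniteDimensional ℂ E] in
-- Expanding the square gives `(1 + τ)² + 1 - 2(1 - 2τ) = 6τ + τ² ≤ 7τ`: a contraction up to `τ`
-- with Rayleigh quotient near `1` almost fixes the vector.
theorem norm_sub_apply_sq_le {κ : E →L[ℂ] E} {τ : ℝ} (hτ : 0 ≤ τ) (hτ1 : τ ≤ 1) (hκ : ‖κ‖ ≤ 1 + τ)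
    {ξ : E} (h : (1 - 2 * τ) * ‖ξ‖ ^ 2 ≤ (inner ℂ (κ ξ) ξ).re) :
    ‖κ ξ - ξ‖ ^ 2 ≤ 7 * τ * ‖ξ‖ ^ 2 := by
  have h1 := @norm_sub_sq ℂ E _ _ _ (κ ξ) ξ
  have h2 : RCLike.re (inner ℂ (κ ξ) ξ) = (inner ℂ (κ ξ) ξ).re := rfl
  have h3 : ‖κ ξ‖ ≤ (1 + τ) * ‖ξ‖ := κ.le_of_opNorm_le hκ ξ
  have h4 : ‖κ ξ‖ ^ 2 ≤ ((1 + τ) * ‖ξ‖) ^ 2 := by gcongr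
  rw [h1, h2]
  have h5 : 0 ≤ τ * (1 - τ) * ‖ξ‖ ^ 2 := by
    have : 0 ≤ 1 - τ := by linarith
    positivity
  nlinarith

omit [FiniteDimensional ℂ E] in
theorem re_inner_ge_of_norm_sub_le {κ : E →L[ℂ] E} {τ : ℝ} {ξ : E} (h : ‖κ ξ - ξ‖ ≤ τ * ‖ξ‖) :
    (1 - τ) * ‖ξ‖ ^ 2 ≤ (inner ℂ (κ ξ) ξ).re := by
  have h1 : (inner ℂ (κ ξ) ξ).re = ‖ξ‖ ^ 2 + (inner ℂ (κ ξ - ξ) ξ).re := by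
    have h0 : (inner ℂ ξ ξ).re = ‖ξ‖ ^ 2 := inner_self_eq_norm_sq (𝕜 := ℂ) ξ
    rw [inner_sub_left, Complex.sub_re, h0]
    ring
  have h2 : |(inner ℂ (κ ξ - ξ) ξ).re| ≤ τ * ‖ξ‖ * ‖ξ‖ :=
    (Complex.abs_re_le_norm _).trans ((norm_inner_le_norm _ _).trans (by gcongr))
  have h3 := neg_abs_le (inner ℂ (κ ξ - ξ) ξ).re
  rw [h1]
  nlinarith

theorem exists_inf_ker_finrank_le (S : Submodule ℂ E) (T : E →ₗ[ℂ] F) :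
    ∃ S' ≤ S, (∀ ξ ∈ S', T ξ = 0) ∧
      Module.finrank ℂ S ≤ Module.finrank ℂ S' + Module.finrank ℂ F := by
  refine ⟨(LinearMap.ker (T ∘ₗ S.subtype)).map S.subtype, Submodule.map_subtype_le _ _, ?_, ?_⟩
  · rintro _ ⟨ξ, hξ, rfl⟩
    exact hξ
  · rw [Submodule.finrank_map_subtype_eq, ← LinearMap.finrank_range_add_finrank_ker (T ∘ₗ S.subtype),
      add_comm]
    gcongr
    exact Submodule.finrank_le _

end

section
variable {X E : Type*} [TopologicalSpace X] [CompactSpace X] [T2Space X] [Nonempty X]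
  [NormedAddCommGroup E] [InnerProductSpace ℂ E] [FiniteDimensional ℂ E]

/-- Find `U` first, then look for `W` inside `P - UU⋆` with `κ'` compressed to it. Intersecting the
given subspaces with `ker U⋆` costs at most `dim F` dimensions, hence the `4 dim F` in the
hypothesis. -/
theorem exists_two_isometries {F : Type*} [NormedAddCommGroup F] [InnerProductSpace ℂ F]
    [FiniteDimensional ℂ F] [Nontrivial F] {d : ℕ} (hX : CoveringDimLE X d)
    (P κ κ' : C(X, E →L[ℂ] E))
    (hP : ∀ t, IsStarProjection (P t)) (hκ : ∀ t, IsSelfAdjoint (κ t))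
    (hκ' : ∀ t, IsSelfAdjoint (κ' t)) (hPκ : ∀ t, P t * κ t = κ t)
    {τ : ℝ} (hτ : 0 < τ) (hτ1 : 2 * τ < 1) {R : ℕ} (hR : d + 1 + 4 * Module.finrank ℂ F < 2 * R)
    (hS : ∀ t, ∃ S : Submodule ℂ E, R ≤ Module.finrank ℂ S ∧ ∀ ξ ∈ S,
      ‖κ t ξ - ξ‖ ≤ τ * ‖ξ‖)
    (hS' : ∀ t, ∃ S : Submodule ℂ E, R ≤ Module.finrank ℂ S ∧ ∀ ξ ∈ S, P t ξ = ξ ∧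
      ‖κ' t ξ - ξ‖ ≤ τ * ‖ξ‖) :
    ∃ U W : C(X, F →L[ℂ] E), (∀ t z, adjoint (U t) (U t z) = z) ∧
      (∀ t z, adjoint (W t) (W t z) = z) ∧ (∀ t z, adjoint (U t) (W t z) = 0) ∧
      (∀ t z, P t (U t z) = U t z) ∧ (∀ t z, P t (W t z) = W t z) ∧
      (∀ t z, (1 - 2 * τ) * ‖z‖ ^ 2 ≤ (inner ℂ (κ t (U t z)) (U t z)).re) ∧
      (∀ t z, (1 - 2 * τ) * ‖z‖ ^ 2 ≤ (inner ℂ (κ' t (W t z)) (W t z)).re) := by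
  obtain ⟨U, hU, hPU, hκU⟩ := exists_isometry_of_rayleigh (F := F) (R := R) hX P κ hP hκ hPκ
    (θ := 1 - τ) (θ' := 1 - 2 * τ) (by linarith) (by linarith)
    (fun t => by
      obtain ⟨S, hS1, hS2⟩ := hS t
      exact ⟨S, hS1, fun ξ hξ => re_inner_ge_of_norm_sub_le (hS2 ξ hξ)⟩)
    (by omega)
  have hUU : ∀ t z, adjoint (U t) (U t z) = z := fun t z =>
    DFunLike.congr_fun ((U t).norm_map_iff_adjoint_comp_self.1 (hU t)) z
  have hPP : ∀ t z, P t (P t z) = P t z := fun t z =>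
    DFunLike.congr_fun (hP t).isIdempotentElem z
  have hPs : ∀ t, adjoint (P t) = P t := fun t => (hP t).isSelfAdjoint
  have hUP : ∀ t z, adjoint (U t) (P t z) = adjoint (U t) z := fun t z => by
    have h1 : P t ∘L U t = U t := ContinuousLinearMap.ext (hPU t)
    conv_rhs => rw [← h1, ContinuousLinearMap.adjoint_comp, hPs]
    rfl
  obtain ⟨P', hP'⟩ : ∃ P' : C(X, E →L[ℂ] E), ∀ t, P' t = P t - U t ∘L adjoint (U t) :=
    ⟨⟨fun t => P t - U t ∘L adjoint (U t), P.continuous.sub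
      (U.continuous.clm_comp (adjoint.continuous.comp U.continuous))⟩, fun _ => rfl⟩
  have hP'a : ∀ t z, P' t z = P t z - U t (adjoint (U t) z) := fun t z => by rw [hP']; rfl
  have hP'P' : ∀ t z, P' t (P' t z) = P' t z := fun t z => by
    rw [hP'a, hP'a]
    simp only [map_sub, hPP, hPU, hUP, hUU, sub_self, map_zero, sub_zero]
  have hP's : ∀ t, adjoint (P' t) = P' t := fun t => by
    rw [hP', map_sub, hPs, ContinuousLinearMap.adjoint_comp, ContinuousLinearMap.adjoint_adjoint]
  have hP'p : ∀ t, IsStarProjection (P' t) := fun t =>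
    ⟨ContinuousLinearMap.ext (hP'P' t), hP's t⟩
  have hinner : ∀ t ξ, P' t ξ = ξ → inner ℂ ((P' t * κ' t * P' t) ξ) ξ = inner ℂ (κ' t ξ) ξ :=
    fun t ξ hξ => by
      change inner ℂ (P' t (κ' t (P' t ξ))) ξ = _
      rw [hξ, ← ContinuousLinearMap.adjoint_inner_right, hP's, hξ]
  obtain ⟨W, hW, hPW, hκW⟩ := exists_isometry_of_rayleigh (F := F)
    (R := R - Module.finrank ℂ F) hX P'
    ⟨fun t => P' t * κ' t * P' t, (P'.continuous.mul κ'.continuous).mul P'.continuous⟩ hP'p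
    (fun t => by
      change star (P' t * κ' t * P' t) = P' t * κ' t * P' t
      rw [star_mul, star_mul, (hP'p t).isSelfAdjoint.star_eq, (hκ' t).star_eq, mul_assoc])
    (fun t => by
      change P' t * (P' t * κ' t * P' t) = _
      rw [← mul_assoc, ← mul_assoc, (hP'p t).isIdempotentElem.eq]
      rfl)
    (θ := 1 - τ) (θ' := 1 - 2 * τ) (by linarith) (by linarith)
    (fun t => by
      obtain ⟨S, hS1, hS2⟩ := hS' t
      obtain ⟨S', hS'S, hS'0, hS'r⟩ := exists_inf_ker_finrank_le S
        (adjoint (U t) : E →ₗ[ℂ] F)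
      refine ⟨S', by omega, fun ξ hξ => ?_⟩
      have h0 : adjoint (U t) ξ = 0 := hS'0 ξ hξ
      have h1 : P' t ξ = ξ := by rw [hP'a, h0, map_zero, sub_zero, (hS2 ξ (hS'S hξ)).1]
      change _ ≤ (inner ℂ ((P' t * κ' t * P' t) ξ) ξ).re
      rw [hinner t ξ h1]
      exact re_inner_ge_of_norm_sub_le (hS2 ξ (hS'S hξ)).2)
    (by omega)
  have hWW : ∀ t z, adjoint (W t) (W t z) = z := fun t z =>
    DFunLike.congr_fun ((W t).norm_map_iff_adjoint_comp_self.1 (hW t)) z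
  have hUW : ∀ t z, adjoint (U t) (W t z) = 0 := fun t z => by
    rw [← hPW, hP'a, map_sub, hUP, hUU, sub_self]
  refine ⟨U, W, hUU, hWW, hUW, hPU, fun t z => ?_, hκU, fun t z => ?_⟩
  · have := hP'a t (W t z)
    rw [hPW, hUW, map_zero, sub_zero] at this
    exact this.symm
  · have := hκW t z
    change _ ≤ (inner ℂ ((P' t * κ' t * P' t) (W t z)) (W t z)).re at this
    rwa [hinner t _ (hPW t z)] at this

/-- Take `v = WU⋆`; orthogonality of the ranges gives `v² = 0`. Rank two is used so that `v⋆v = UU⋆`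
splits into two nonzero projections. -/
theorem exists_partialIsometry {d : ℕ} (hX : CoveringDimLE X d)
    (P κ κ' : C(X, E →L[ℂ] E))
    (hP : ∀ t, IsStarProjection (P t)) (hκ : ∀ t, IsSelfAdjoint (κ t))
    (hκ' : ∀ t, IsSelfAdjoint (κ' t)) (hPκ : ∀ t, P t * κ t = κ t)
    {τ : ℝ} (hτ : 0 < τ) (hτ1 : 2 * τ < 1) (hn : ∀ t, ‖κ t‖ ≤ 1 + τ) (hn' : ∀ t, ‖κ' t‖ ≤ 1 + τ)
    (hS : ∀ t, ∃ S : Submodule ℂ E, 5 * (d + 1) ≤ Module.finrank ℂ S ∧ ∀ ξ ∈ S,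
      ‖κ t ξ - ξ‖ ≤ τ * ‖ξ‖)
    (hS' : ∀ t, ∃ S : Submodule ℂ E, 5 * (d + 1) ≤ Module.finrank ℂ S ∧ ∀ ξ ∈ S, P t ξ = ξ ∧
      ‖κ' t ξ - ξ‖ ≤ τ * ‖ξ‖) :
    ∃ v u₁ u₂ : C(X, E →L[ℂ] E), ∀ t, P t * v t = v t ∧ v t * P t = v t ∧ v t * v t = 0 ∧
      v t * star (v t) * v t = v t ∧ P t * u₁ t = u₁ t ∧ P t * u₂ t = u₂ t ∧
      IsStarProjection (u₁ t) ∧ IsStarProjection (u₂ t) ∧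
      u₁ t * u₂ t = 0 ∧ u₁ t + u₂ t = star (v t) * v t ∧ u₁ t ≠ 0 ∧ u₂ t ≠ 0 ∧
      ‖κ t * star (v t) - star (v t)‖ ≤ √(7 * τ) ∧ ‖κ' t * v t - v t‖ ≤ √(7 * τ) := by
  -- The count is `d + 1 + 4 · 2 < 10(d + 1)`; at `d = 0` it reads `9 < 10`, so here the constant
  -- `5` cannot be lowered.
  obtain ⟨U, W, hUU, hWW, hUW, hPU, hPW, hκU, hκW⟩ :=
    exists_two_isometries (F := EuclideanSpace ℂ (Fin 2)) hX P κ κ' hP hκ hκ' hPκ hτ hτ1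
      (R := 5 * (d + 1)) (by simp; omega) hS hS'
  have hWU : ∀ t z, adjoint (W t) (U t z) = 0 := fun t z => by
    have h1 : adjoint (U t) ∘L W t = 0 := ContinuousLinearMap.ext (hUW t)
    have h2 := congrArg adjoint h1
    rw [ContinuousLinearMap.adjoint_comp, ContinuousLinearMap.adjoint_adjoint, map_zero] at h2
    exact DFunLike.congr_fun h2 z
  have hPs : ∀ t, adjoint (P t) = P t := fun t => (hP t).isSelfAdjoint
  have hUP : ∀ t z, adjoint (U t) (P t z) = adjoint (U t) z := fun t z => by
    have h1 : P t ∘L U t = U t := ContinuousLinearMap.ext (hPU t)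
    conv_rhs => rw [← h1, ContinuousLinearMap.adjoint_comp, hPs]
    rfl
  obtain ⟨q, hqp, hq0⟩ : ∃ q : Fin 2 → (EuclideanSpace ℂ (Fin 2) →L[ℂ] EuclideanSpace ℂ (Fin 2)),
      ((∀ i, IsStarProjection (q i)) ∧ q 0 * q 1 = 0 ∧ q 0 + q 1 = 1) ∧ ∀ i, q i ≠ 0 := by
    refine ⟨fun i => Matrix.toEuclideanCLM (𝕜 := ℂ) (Matrix.single i i 1), ⟨fun i => ⟨?_, ?_⟩, ?_, ?_⟩, fun i h => ?_⟩
    · change _ * _ = _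
      rw [← map_mul]; simp
    · change star _ = _
      rw [← map_star]; simp [Matrix.star_eq_conjTranspose]
    · rw [← map_mul]; simp
    · rw [← map_add, ← map_one (Matrix.toEuclideanCLM (n := Fin 2) (𝕜 := ℂ))]
      congr 1
      ext i j
      fin_cases i <;> fin_cases j <;> simp [Matrix.single]
    · have h1 := (Matrix.toEuclideanCLM (n := Fin 2) (𝕜 := ℂ)).injective
        (h.trans (map_zero _).symm)
      have h2 := congrFun (congrFun h1 i) i
      simp at h2
  have hadj : Continuous fun t => adjoint (U t) := adjoint.continuous.comp U.continuous
  have hstar : ∀ t, star (W t ∘L adjoint (U t)) = U t ∘L adjoint (W t) := fun t => by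
    change adjoint _ = _
    rw [ContinuousLinearMap.adjoint_comp, ContinuousLinearMap.adjoint_adjoint]
  have huP : ∀ i t, IsStarProjection (U t ∘L q i ∘L adjoint (U t)) := fun i t => by
    constructor
    · refine ContinuousLinearMap.ext fun z => ?_
      have h1 : ∀ z, q i (q i z) = q i z := fun z => DFunLike.congr_fun (hqp.1 i).isIdempotentElem z
      simp [hUU, h1]
    · change adjoint _ = _
      have h1 : adjoint (q i) = q i := (hqp.1 i).isSelfAdjoint
      rw [ContinuousLinearMap.adjoint_comp, ContinuousLinearMap.adjoint_comp, h1,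
        ContinuousLinearMap.adjoint_adjoint]
      rfl
  have hu0 : ∀ i t, U t ∘L q i ∘L adjoint (U t) ≠ 0 := fun i t h => hq0 i <| by
    refine ContinuousLinearMap.ext fun z => ?_
    have h1 : U t (q i (adjoint (U t) (U t z))) = 0 := DFunLike.congr_fun h (U t z)
    have h2 := congrArg (adjoint (U t)) h1
    rwa [hUU, hUU, map_zero] at h2
  have hnorm : ∀ G : EuclideanSpace ℂ (Fin 2) →L[ℂ] E, (∀ z, adjoint G (G z) = z) →
      (∀ z, ‖G z‖ = ‖z‖) := fun G hG =>
    G.norm_map_iff_adjoint_comp_self.2 (ContinuousLinearMap.ext hG)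
  have hnorm' : ∀ G : EuclideanSpace ℂ (Fin 2) →L[ℂ] E, (∀ z, adjoint G (G z) = z) →
      (∀ z, ‖adjoint G z‖ ≤ ‖z‖) := fun G hG z => by
    have h1 : ‖adjoint G‖ ≤ 1 := by
      rw [LinearIsometryEquiv.norm_map]
      exact G.opNorm_le_bound zero_le_one fun z => by rw [hnorm G hG, one_mul]
    simpa using (adjoint G).le_of_opNorm_le h1 z
  have bound : ∀ (k : E →L[ℂ] E) (G H : EuclideanSpace ℂ (Fin 2) →L[ℂ] E), ‖k‖ ≤ 1 + τ →
      (∀ z, adjoint G (G z) = z) → (∀ z, adjoint H (H z) = z) →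
      (∀ z, (1 - 2 * τ) * ‖z‖ ^ 2 ≤ (inner ℂ (k (G z)) (G z)).re) →
      ‖k * (G ∘L adjoint H) - G ∘L adjoint H‖ ≤ √(7 * τ) := fun k G H hk hG hH h => by
    refine ContinuousLinearMap.opNorm_le_bound _ (Real.sqrt_nonneg _) fun z => ?_
    change ‖k (G (adjoint H z)) - G (adjoint H z)‖ ≤ _
    have h1 := norm_sub_apply_sq_le hτ.le (by linarith) hk (ξ := G (adjoint H z))
      (by rw [hnorm G hG]; exact h _)
    rw [hnorm G hG] at h1
    have h2 := hnorm' H hH z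
    refine le_trans (Real.le_sqrt_of_sq_le h1) ?_
    rw [Real.sqrt_mul (by positivity), Real.sqrt_sq (norm_nonneg _)]
    gcongr
  refine ⟨⟨fun t => W t ∘L adjoint (U t), W.continuous.clm_comp hadj⟩,
    ⟨fun t => U t ∘L q 0 ∘L adjoint (U t),
      U.continuous.clm_comp (continuous_const.clm_comp hadj)⟩,
    ⟨fun t => U t ∘L q 1 ∘L adjoint (U t),
      U.continuous.clm_comp (continuous_const.clm_comp hadj)⟩, fun t => ?_⟩
  simp only [ContinuousMap.coe_mk, hstar]
  refine ⟨?_, ?_, ?_, ?_, ?_, ?_, huP 0 t, huP 1 t, ?_, ?_, hu0 0 t, hu0 1 t,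
    bound _ _ _ (hn t) (hUU t) (hWW t) (hκU t), bound _ _ _ (hn' t) (hWW t) (hUU t) (hκW t)⟩
  · refine ContinuousLinearMap.ext fun z => ?_
    simp [hPW]
  · refine ContinuousLinearMap.ext fun z => ?_
    simp [hUP]
  · refine ContinuousLinearMap.ext fun z => ?_
    simp [hUW]
  · refine ContinuousLinearMap.ext fun z => ?_
    simp [hUU, hWW]
  · refine ContinuousLinearMap.ext fun z => ?_
    simp [hPU]
  · refine ContinuousLinearMap.ext fun z => ?_
    simp [hPU]
  · refine ContinuousLinearMap.ext fun z => ?_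
    have h1 : ∀ z, q 0 (q 1 z) = 0 := fun z => DFunLike.congr_fun hqp.2.1 z
    simp [hUU, h1]
  · refine ContinuousLinearMap.ext fun z => ?_
    have h1 : ∀ z, q 0 z + q 1 z = z := fun z => DFunLike.congr_fun hqp.2.2 z
    have h2 := congrArg (U t) (h1 (adjoint (U t) z))
    rw [map_add] at h2
    simpa [hWW] using h2

end
end TracialAH

/-! ### Cutting a general element down to the orthogonal case. -/

namespace TracialAH

section
variable {A : Type*} [CStarAlgebra A]

/-- All three elements are functions of `x⋆x`, whose spectrum contains `0`: `k` and `k₂` live near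
`0`, where `x` is small, and `u` lives away from it. The extra `k₂`, on which `k` acts as the
identity, turns spectral information into honest near-fixed vectors of `k`. -/
theorem exists_cut {x : A} (hx : ¬ IsUnit (star x * x)) {ε : ℝ} (hε : 0 < ε) :
    ∃ k k₂ u : A, IsSelfAdjoint k ∧ IsSelfAdjoint k₂ ∧ IsSelfAdjoint u ∧ ‖k‖ ≤ 1 ∧
      k * k₂ = k₂ ∧ k₂ ≠ 0 ∧ u * k = 0 ∧ ‖u‖ ≤ 1 ∧ ‖x * u - x‖ ≤ ε := by
  obtain ⟨b, hb⟩ : ∃ b, b = star x * x := ⟨_, rfl⟩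
  have hbs : IsSelfAdjoint b := hb ▸ .star_mul_self x
  have h0 : (0 : ℝ) ∈ spectrum ℝ b := (spectrum.zero_mem_iff ℝ).2 (hb ▸ hx)
  have hpos : ∀ y ∈ spectrum ℝ b, 0 ≤ y := fun y hy => by
    rw [hb] at hy
    exact spectrum_star_mul_self_nonneg y hy
  obtain ⟨η, hη⟩ : ∃ η, η = ε ^ 2 / 3 := ⟨_, rfl⟩
  have hη0 : 0 < η := by rw [hη]; positivity
  -- `f` is `1` up to `η` and vanishes after `2η`, `f₂` vanishes after `η`, and `g` vanishes up to
  -- `2η` and is `1` after `3η`; the loss `‖xu - x‖²` is at most `3η = ε²`.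
  obtain ⟨f, hf⟩ : ∃ f : ℝ → ℝ, f = fun y => min 1 (max 0 (2 - y / η)) := ⟨_, rfl⟩
  obtain ⟨f₂, hf₂⟩ : ∃ f : ℝ → ℝ, f = fun y => max 0 (1 - y / η) := ⟨_, rfl⟩
  obtain ⟨g, hg⟩ : ∃ f : ℝ → ℝ, f = fun y => min 1 (max 0 (y / η - 2)) := ⟨_, rfl⟩
  have cf : Continuous f := by rw [hf]; fun_prop
  have cf₂ : Continuous f₂ := by rw [hf₂]; fun_prop
  have cg : Continuous g := by rw [hg]; fun_prop
  have hb1 : ∀ z : ℝ, ‖min 1 (max 0 z)‖ ≤ 1 := fun z => by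
    rw [Real.norm_eq_abs, abs_of_nonneg (le_min zero_le_one (le_max_left _ _))]
    exact min_le_left _ _
  refine ⟨cfc f b, cfc f₂ b, cfc g b, cfc_predicate _ _, cfc_predicate _ _, cfc_predicate _ _,
    norm_cfc_le zero_le_one fun y _ => by rw [hf]; exact hb1 _, ?_, ?_, ?_,
    norm_cfc_le zero_le_one fun y _ => by rw [hg]; exact hb1 _, ?_⟩
  · rw [← cfc_mul f f₂ b cf.continuousOn cf₂.continuousOn]
    refine cfc_congr fun y hy => ?_
    rw [hf, hf₂]
    beta_reduce
    rcases le_total (y / η) 1 with h | h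
    · rw [max_eq_right (a := 0) (b := 2 - y / η) (by linarith), min_eq_left (by linarith), one_mul]
    · rw [max_eq_left (a := 0) (b := 1 - y / η) (by linarith), mul_zero]
  · intro h
    have := norm_apply_le_norm_cfc f₂ b h0 cf₂.continuousOn
    rw [h, norm_zero, hf₂] at this
    norm_num at this
  · rw [← cfc_mul g f b cg.continuousOn cf.continuousOn, ← cfc_zero ℝ b]
    refine cfc_congr fun y hy => ?_
    rw [hf, hg]
    beta_reduce
    rcases le_total (y / η) 2 with h | h
    · rw [max_eq_left (a := 0) (b := y / η - 2) (by linarith)]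
      simp
    · rw [max_eq_left (a := 0) (b := 2 - y / η) (by linarith)]
      simp
  · have hu : star (cfc g b) = cfc g b := (cfc_predicate g b : IsSelfAdjoint _)
    have e1 : star (x * cfc g b - x) * (x * cfc g b - x) =
        cfc (fun y => g y * y * g y - g y * y - (y * g y - y)) b := by
      rw [cfc_sub (fun y => g y * y * g y - g y * y) (fun y => y * g y - y) b,
        cfc_sub (fun y => g y * y * g y) (fun y => g y * y) b, cfc_sub (fun y => y * g y) (fun y => y) b,
        cfc_mul (fun y => g y * y) g b, cfc_mul g (fun y => y) b, cfc_mul (fun y => y) g b,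
        cfc_id' ℝ b]
      rw [star_sub, star_mul, hu]
      simp only [sub_mul, mul_sub]
      rw [hb]
      simp only [mul_assoc]
      abel
    have e2 : ‖x * cfc g b - x‖ ^ 2 ≤ ε ^ 2 := by
      rw [sq, ← CStarRing.norm_star_mul_self, e1]
      refine norm_cfc_le (by positivity) fun y hy => ?_
      have hy0 := hpos y hy
      have e3 : g y * y * g y - g y * y - (y * g y - y) = (1 - g y) ^ 2 * y := by ring
      rw [e3, Real.norm_of_nonneg (by positivity)]
      rcases le_total (y / η) 3 with h | h
      · rw [div_le_iff₀ hη0] at h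
        have h1 : 0 ≤ g y ∧ g y ≤ 1 := by
          rw [hg]; exact ⟨le_min zero_le_one (le_max_left _ _), min_le_left _ _⟩
        have h2 : (1 - g y) ^ 2 ≤ 1 := by nlinarith
        have h3 : (1 - g y) ^ 2 * y ≤ 1 * y := by gcongr
        have h4 : 3 * η = ε ^ 2 := by rw [hη]; ring
        linarith
      · have : g y = 1 := by
          rw [hg]
          simp only
          rw [max_eq_right (by linarith), min_eq_left (by linarith)]
        rw [this]
        simp
        positivity
    exact le_of_sq_le_sq e2 hε.le

/-- The relations between `k`, `k₂` and the translates are open conditions up to small errors, so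
they pass to approximants in a model. There `k₂` has large rank in each fibre by simplicity, and `K`
almost fixes the image on which `k₂` is bounded below. -/
theorem eventually_exists_subspace {n : ℕ} {a b : Fin n → A} {k k₂ : A} (hn : 0 < n)
    (hk : IsSelfAdjoint k) (hk₂ : IsSelfAdjoint k₂) (hk1 : ‖k‖ ≤ 1) (hkk : k * k₂ = k₂)
    (hab : ∑ i, a i * k₂ * b i = 1) {τ σ : ℝ} (hτ : 0 < τ) (hσ : 0 < σ) :
    ∀ᶠ v in 𝓝 (Sum.elim (![k, k₂] : Fin 2 → A) (Sum.elim a b)), ∀ (M : TracialModel A)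
      (v' : Fin 2 ⊕ Fin n ⊕ Fin n → M.B), (∀ i, (v' i : A) = v i) →
      (∀ t, n * (5 * (M.d + 1)) ≤ M.rank t) →
      ∃ K : M.B, IsSelfAdjoint K ∧ ‖K‖ ≤ 1 + τ ∧ ‖(K : A) - k‖ ≤ σ ∧
        ∀ t, ∃ S : Submodule ℂ M.E, 5 * (M.d + 1) ≤ Module.finrank ℂ S ∧
          ∀ ξ ∈ S, M.ev t M.q ξ = ξ ∧ ‖M.ev t K ξ - ξ‖ ≤ τ * ‖ξ‖ := by
  obtain ⟨L, hL⟩ : ∃ L, L = ∑ i, ‖a i‖ * ‖b i‖ + 1 := ⟨_, rfl⟩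
  have hL0 : 0 < L := by rw [hL]; positivity
  obtain ⟨δ, hδ⟩ : ∃ δ, δ = 1 / (4 * L) := ⟨_, rfl⟩
  have hδ0 : 0 < δ := by rw [hδ]; positivity
  -- Approximants inside the model need not be self-adjoint, so they are symmetrised.
  obtain ⟨sym, hsym⟩ : ∃ sym : A → A, sym = fun z => (2⁻¹ : ℂ) • (z + star z) := ⟨_, rfl⟩
  have csym : Continuous sym := by rw [hsym]; fun_prop
  have sym_eq : ∀ z, IsSelfAdjoint z → sym z = z := fun z hz => by
    rw [hsym]
    simp only
    rw [hz.star_eq, ← two_smul ℂ z, smul_smul]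
    norm_num
  have e1 : ∀ᶠ v in 𝓝 (Sum.elim (![k, k₂] : Fin 2 → A) (Sum.elim a b)),
      ‖∑ i : Fin n, v (Sum.inr (Sum.inl i)) * sym (v (Sum.inl 1)) * v (Sum.inr (Sum.inr i)) - 1‖ <
        1 / 2 := by
    have hc : Continuous fun v : Fin 2 ⊕ Fin n ⊕ Fin n → A => ‖∑ i : Fin n,
      v (Sum.inr (Sum.inl i)) * sym (v (Sum.inl 1)) * v (Sum.inr (Sum.inr i)) - 1‖ := by fun_prop
    refine hc.continuousAt.eventually_lt continuousAt_const ?_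
    simp [sym_eq k₂ hk₂, hab]
  have e2 : ∀ᶠ v in 𝓝 (Sum.elim (![k, k₂] : Fin 2 → A) (Sum.elim a b)),
      ∑ i : Fin n, ‖v (Sum.inr (Sum.inl i))‖ * ‖v (Sum.inr (Sum.inr i))‖ < L := by
    have hc : Continuous fun v : Fin 2 ⊕ Fin n ⊕ Fin n → A => ∑ i : Fin n,
      ‖v (Sum.inr (Sum.inl i))‖ * ‖v (Sum.inr (Sum.inr i))‖ := by fun_prop
    refine hc.continuousAt.eventually_lt continuousAt_const ?_
    simp [hL]
  have e3 : ∀ᶠ v in 𝓝 (Sum.elim (![k, k₂] : Fin 2 → A) (Sum.elim a b)),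
      ‖sym (v (Sum.inl 0)) * sym (v (Sum.inl 1)) - sym (v (Sum.inl 1))‖ < τ * δ := by
    have hc : Continuous fun v : Fin 2 ⊕ Fin n ⊕ Fin n → A =>
      ‖sym (v (Sum.inl 0)) * sym (v (Sum.inl 1)) - sym (v (Sum.inl 1))‖ := by fun_prop
    refine hc.continuousAt.eventually_lt continuousAt_const ?_
    simp only [Sum.elim_inl, Matrix.cons_val_zero, Matrix.cons_val_one, sym_eq k hk, sym_eq k₂ hk₂,
      hkk, sub_self, norm_zero]
    positivity
  have e4 : ∀ᶠ v in 𝓝 (Sum.elim (![k, k₂] : Fin 2 → A) (Sum.elim a b)),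
      ‖sym (v (Sum.inl 0)) - k‖ < σ := by
    have hc : Continuous fun v : Fin 2 ⊕ Fin n ⊕ Fin n → A => ‖sym (v (Sum.inl 0)) - k‖ := by
      fun_prop
    refine hc.continuousAt.eventually_lt continuousAt_const ?_
    simpa [sym_eq k hk] using hσ
  have e5 : ∀ᶠ v in 𝓝 (Sum.elim (![k, k₂] : Fin 2 → A) (Sum.elim a b)),
      ‖sym (v (Sum.inl 0))‖ < 1 + τ := by
    have hc : Continuous fun v : Fin 2 ⊕ Fin n ⊕ Fin n → A => ‖sym (v (Sum.inl 0))‖ := by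
      fun_prop
    refine hc.continuousAt.eventually_lt continuousAt_const ?_
    simp only [Sum.elim_inl, Matrix.cons_val_zero, sym_eq k hk]
    linarith
  filter_upwards [e1, e2, e3, e4, e5] with v h1 h2 h3 h4 h5 M v' hv hr
  obtain ⟨s, hs⟩ : ∃ s : M.B → M.B, s = fun z => (2⁻¹ : ℂ) • (z + star z) := ⟨_, rfl⟩
  have hss : ∀ z, IsSelfAdjoint (s z) := fun z => by
    rw [hs]
    refine IsSelfAdjoint.smul ?_ (.add_star_self z)
    rw [isSelfAdjoint_iff]
    simp
  have hsA : ∀ z : M.B, ((s z : M.B) : A) = sym z := fun z => by rw [hs, hsym]; rfl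
  refine ⟨s (v' (Sum.inl 0)), hss _, ?_, ?_, fun t => ?_⟩
  · change ‖((s (v' (Sum.inl 0)) : M.B) : A)‖ ≤ _
    rw [hsA, hv]; exact h5.le
  · rw [hsA, hv]; exact h4.le
  · have g1 : ‖∑ i : Fin n, v' (Sum.inr (Sum.inl i)) * s (v' (Sum.inl 1)) *
        v' (Sum.inr (Sum.inr i)) - 1‖ < 1 / 2 := by
      have e1 : ‖∑ i : Fin n, v' (Sum.inr (Sum.inl i)) * s (v' (Sum.inl 1)) *
          v' (Sum.inr (Sum.inr i)) - 1‖ =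
        ‖((∑ i : Fin n, v' (Sum.inr (Sum.inl i)) * s (v' (Sum.inl 1)) *
          v' (Sum.inr (Sum.inr i)) - 1 : M.B) : A)‖ := rfl
      rw [e1]
      push_cast
      simpa only [hsA, hv] using h1
    have g2 : δ * ∑ i : Fin n, ‖v' (Sum.inr (Sum.inl i))‖ * ‖v' (Sum.inr (Sum.inr i))‖ ≤ 1 / 4 := by
      have e1 : ∑ i : Fin n, ‖v' (Sum.inr (Sum.inl i))‖ * ‖v' (Sum.inr (Sum.inr i))‖ =
          ∑ i : Fin n, ‖v (Sum.inr (Sum.inl i))‖ * ‖v (Sum.inr (Sum.inr i))‖ := by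
        simp only [← hv]; rfl
      rw [e1, hδ, div_mul_eq_mul_div, one_mul, div_le_div_iff₀ (by positivity) (by norm_num)]
      linarith
    have g3 : ‖s (v' (Sum.inl 0)) * s (v' (Sum.inl 1)) - s (v' (Sum.inl 1))‖ ≤ τ * δ := by
      have e1 : ‖s (v' (Sum.inl 0)) * s (v' (Sum.inl 1)) - s (v' (Sum.inl 1))‖ =
        ‖((s (v' (Sum.inl 0)) * s (v' (Sum.inl 1)) - s (v' (Sum.inl 1)) : M.B) : A)‖ := rfl
      rw [e1]
      push_cast
      simpa only [hsA, hv] using h3.le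
    obtain ⟨S, hS, hS'⟩ := M.exists_subspace (hss _) g1 hδ0 g2 t
    refine ⟨S, Nat.le_of_mul_le_mul_left ((hr t).trans hS) hn, fun ξ hξ => ?_⟩
    obtain ⟨ζ, rfl, hζ⟩ := hS' ξ hξ
    refine ⟨DFunLike.congr_fun (M.ev_q_mul t _) ζ, ?_⟩
    have e1 : M.ev t (s (v' (Sum.inl 0))) (M.ev t (s (v' (Sum.inl 1))) ζ) -
        M.ev t (s (v' (Sum.inl 1))) ζ =
        M.ev t (s (v' (Sum.inl 0)) * s (v' (Sum.inl 1)) - s (v' (Sum.inl 1))) ζ := by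
      rw [map_sub, map_mul]; rfl
    rw [e1]
    -- The tolerance `τ * δ` was chosen because `δ‖ζ‖ ≤ ‖ξ‖` for the preimage `ζ` of `ξ`.
    refine ((M.ev t _).le_of_opNorm_le ((M.norm_ev_le t _).trans g3) ζ).trans ?_
    rw [mul_assoc]
    gcongr

theorem TracialModel.exists_partialIsometry (M : TracialModel A) {k k' : M.B}
    (hk : IsSelfAdjoint k) (hk' : IsSelfAdjoint k') {τ : ℝ} (hτ : 0 < τ) (hτ1 : 2 * τ < 1)
    (hn : ‖k‖ ≤ 1 + τ) (hn' : ‖k'‖ ≤ 1 + τ)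
    (hS : ∀ t, ∃ S : Submodule ℂ M.E, 5 * (M.d + 1) ≤ Module.finrank ℂ S ∧
      ∀ ξ ∈ S, M.ev t M.q ξ = ξ ∧ ‖M.ev t k ξ - ξ‖ ≤ τ * ‖ξ‖)
    (hS' : ∀ t, ∃ S : Submodule ℂ M.E, 5 * (M.d + 1) ≤ Module.finrank ℂ S ∧
      ∀ ξ ∈ S, M.ev t M.q ξ = ξ ∧ ‖M.ev t k' ξ - ξ‖ ≤ τ * ‖ξ‖) :
    ∃ v u₁ u₂ : M.B, v * v = 0 ∧ v * star v * v = v ∧ IsStarProjection u₁ ∧ IsStarProjection u₂ ∧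
      u₁ * u₂ = 0 ∧ u₁ + u₂ = star v * v ∧ u₁ ≠ 0 ∧ u₂ ≠ 0 ∧
      ‖k * star v - star v‖ ≤ √(7 * τ) ∧ ‖k' * v - v‖ ≤ √(7 * τ) := by
  have hsa : ∀ b : M.B, IsSelfAdjoint b → ∀ t, IsSelfAdjoint (M.ev t b) := fun b hb t => by
    rw [isSelfAdjoint_iff, ← map_star, hb.star_eq]
  obtain ⟨fv, f₁, f₂, h⟩ := TracialAH.exists_partialIsometry M.dim_le (M.evMap M.q) (M.evMap k)
    (M.evMap k') M.isStarProjection_ev_q (hsa k hk) (hsa k' hk') (fun t => M.ev_q_mul t k) hτ hτ1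
    (fun t => (M.norm_ev_le t k).trans hn) (fun t => (M.norm_ev_le t k').trans hn')
    (fun t => by
      obtain ⟨S, h1, h2⟩ := hS t
      exact ⟨S, h1, fun ξ hξ => (h2 ξ hξ).2⟩) hS'
  choose h1 h2 h3 h4 h5 h6 h7 h8 h9 h10 h11 h12 h13 h14 using h
  obtain ⟨v, hv, hvt⟩ := M.exists_lift fv h1 h2
  have hr : ∀ f : C(M.X, M.E →L[ℂ] M.E), (∀ t, M.ev t M.q * f t = f t) →
      (∀ t, IsStarProjection (f t)) → ∃ u : M.B, M.q * u = u ∧ (∀ t, M.ev t u = f t) ∧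
        IsStarProjection u := fun f hf1 hf2 => by
    have hf3 : ∀ t, f t * M.ev t M.q = f t := fun t => by
      have := congrArg star (hf1 t)
      rwa [star_mul, (hf2 t).isSelfAdjoint.star_eq,
        (M.isStarProjection_ev_q t).isSelfAdjoint.star_eq] at this
    obtain ⟨u, hu, hut⟩ := M.exists_lift f hf1 hf3
    refine ⟨u, hu, hut, M.eq_of_ev_eq (by rw [← mul_assoc, hu]) hu fun t => ?_,
      M.eq_of_ev_eq ?_ hu fun t => ?_⟩
    · rw [map_mul, hut, (hf2 t).isIdempotentElem.eq]
    · have := congrArg star hu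
      rwa [star_mul, M.star_q, ← M.q_comm] at this
    · rw [map_star, hut, (hf2 t).isSelfAdjoint.star_eq]
  obtain ⟨u₁, hu₁, hu₁t, hu₁p⟩ := hr f₁ h5 h7
  obtain ⟨u₂, hu₂, hu₂t, hu₂p⟩ := hr f₂ h6 h8
  have hqv : M.q * star v = star v := by
    have := congrArg star hv
    rwa [star_mul, M.star_q, ← M.q_comm] at this
  have hqk : ∀ a b : M.B, M.q * b = b → M.q * (a * b) = a * b := fun a b hb => by
    rw [← mul_assoc, M.q_comm, mul_assoc, hb]
  obtain ⟨t₀⟩ := M.nonemptyX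
  refine ⟨v, u₁, u₂, M.eq_of_ev_eq (hqk _ _ hv) (mul_zero _) fun t => ?_,
    M.eq_of_ev_eq (hqk _ _ hv) hv fun t => ?_, hu₁p, hu₂p,
    M.eq_of_ev_eq (hqk _ _ hu₂) (mul_zero _) fun t => ?_,
    M.eq_of_ev_eq (by rw [mul_add, hu₁, hu₂]) (hqk _ _ hv) fun t => ?_,
    fun h => h11 t₀ ?_, fun h => h12 t₀ ?_,
    M.norm_le_of_ev_le (by rw [mul_sub, hqk _ _ hqv, hqv]) fun t => ?_,
    M.norm_le_of_ev_le (by rw [mul_sub, hqk _ _ hv, hv]) fun t => ?_⟩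
  · rw [map_mul, map_zero, hvt, h3]
  · rw [map_mul, map_mul, map_star, hvt, h4]
  · rw [map_mul, map_zero, hu₁t, hu₂t, h9]
  · rw [map_add, map_mul, map_star, hu₁t, hu₂t, hvt, h10]
  · rw [← hu₁t, h, map_zero]
  · rw [← hu₂t, h, map_zero]
  · rw [map_sub, map_mul, map_star, hvt]; exact h13 t
  · rw [map_sub, map_mul, hvt]; exact h14 t

/-- The left annihilator `v⋆v` and the right annihilator `vv⋆` differ, and right multiplication by a
unitary that exchanges them makes them agree. Units are preserved, so the orthogonal case applies.
-/
theorem mem_closure_isUnit_of_partialIsometry [PartialOrder A] [StarOrderedRing A]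
    (hs : IsSimpleCStar A) (hA : InClassC1 A) {x v u₁ u₂ : A} (hvv : v * v = 0)
    (hv : v * star v * v = v) (hu₁ : IsStarProjection u₁) (hu₂ : IsStarProjection u₂)
    (h12 : u₁ * u₂ = 0) (hsum : u₁ + u₂ = star v * v) (h₁ : u₁ ≠ 0) (h₂ : u₂ ≠ 0) :
    (1 - star v * v) * x * (1 - v * star v) ∈ closure {x : A | IsUnit x} := by
  have hss : star v * star v = 0 := by
    have := congrArg star hvv
    rwa [star_mul, star_zero] at this
  have hv' : star v * v * star v = star v := by
    have := congrArg star hv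
    rwa [star_mul, star_mul, star_star, ← mul_assoc] at this
  have h21 : u₂ * u₁ = 0 := by
    have := congrArg star h12
    rwa [star_mul, hu₁.isSelfAdjoint.star_eq, hu₂.isSelfAdjoint.star_eq, star_zero] at this
  -- The self-adjoint unitary exchanging `v⋆v` and `vv⋆` and fixing their common complement.
  obtain ⟨V, hV⟩ : ∃ V, V = v + star v + 1 - star v * v - v * star v := ⟨_, rfl⟩
  have ext : ∀ {a b : A}, a * b = 0 → ∀ z, a * (b * z) = 0 := fun hab z => by
    rw [← mul_assoc, hab, zero_mul]
  have hva : v * (star v * v) = v := by rw [← mul_assoc, hv]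
  have hva' : star v * (v * star v) = star v := by rw [← mul_assoc, hv']
  have hVV : V * V = 1 := by
    rw [hV]
    simp only [add_mul, sub_mul, mul_add, mul_sub, one_mul, mul_one, mul_assoc, hvv, hss, hva, hva',
      ext hvv, ext hss, mul_zero]
    abel
  have hVe : V * (star v * v) = v := by
    rw [hV]
    simp only [add_mul, sub_mul, one_mul, mul_assoc, hva, ext hss, mul_zero]
    abel
  obtain ⟨y, hy⟩ : ∃ y, y = (1 - star v * v) * x * (1 - v * star v) := ⟨_, rfl⟩
  have hyv : y * v = 0 := by
    rw [hy, mul_assoc, sub_mul 1 (v * star v), one_mul, hv, sub_self, mul_zero]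
  have left : ∀ u, u * (star v * v) = u → u * (y * V) = 0 := fun u hu => by
    have h0 : u * (1 - star v * v) = 0 := by rw [mul_sub, mul_one, hu, sub_self]
    rw [hy, ← mul_assoc, ← mul_assoc, ← mul_assoc, h0, zero_mul, zero_mul, zero_mul]
  have right : ∀ u, star v * v * u = u → y * V * u = 0 := fun u hu => by
    rw [← hu, mul_assoc, ← mul_assoc V, hVe, ← mul_assoc, hyv, zero_mul]
  have hcl : y * V ∈ closure {x : A | IsUnit x} :=
    mem_closure_isUnit_of_orthogonal hs hA hu₁ hu₂ h₁ h₂ h12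
      (left _ (by rw [← hsum, mul_add, hu₁.isIdempotentElem.eq, h12, add_zero]))
      (right _ (by rw [← hsum, add_mul, hu₁.isIdempotentElem.eq, h21, add_zero]))
      (left _ (by rw [← hsum, mul_add, hu₂.isIdempotentElem.eq, h21, zero_add]))
      (right _ (by rw [← hsum, add_mul, hu₂.isIdempotentElem.eq, h12, zero_add]))
  rw [← hy]
  have : y = y * V * V := by rw [mul_assoc, hVV, mul_one]
  rw [this]
  have hVu : IsUnit V := ⟨⟨V, V, hVV, hVV⟩, rfl⟩
  exact map_mem_closure (f := fun z => z * V) (by fun_prop) hcl fun z hz => hz.mul hVu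

end
end TracialAH

namespace TracialAH

section
variable {A : Type*} [CStarAlgebra A]

/-- The range of `v` is almost under `k`, which `u` kills, and that of `v⋆` almost under `k'`, which
`u'` kills. So both `yv` and `vy` have norm at most `2σ‖x‖` for `y = u'xu`. -/
theorem norm_cut_sub_le {x v k k' u u' K K' : A} (hv : v * star v * v = v)
    (hu' : IsSelfAdjoint u') (huk : u * k = 0)
    (huk' : u' * k' = 0) (hk' : IsSelfAdjoint k') (hu : ‖u‖ ≤ 1) (hu'n : ‖u'‖ ≤ 1)
    (hK' : IsSelfAdjoint K') {σ : ℝ} (hKk : ‖K - k‖ ≤ σ)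
    (hKk' : ‖K' - k'‖ ≤ σ) (h : ‖K * v - v‖ ≤ σ) (h' : ‖K' * star v - star v‖ ≤ σ) :
    ‖(1 - star v * v) * (u' * x * u) * (1 - v * star v) - u' * x * u‖ ≤ 4 * σ * ‖x‖ := by
  obtain ⟨y, hy⟩ : ∃ y, y = u' * x * u := ⟨_, rfl⟩
  have hσ : 0 ≤ σ := (norm_nonneg _).trans h
  have hyn : ‖y‖ ≤ ‖x‖ := hy ▸ norm_corner_le hu'n hu
  have hyk : y * k = 0 := by rw [hy, mul_assoc, huk, mul_zero]
  have hky : k' * y = 0 := by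
    have := congrArg star huk'
    rw [star_mul, hk'.star_eq, hu'.star_eq, star_zero] at this
    rw [hy, ← mul_assoc, ← mul_assoc, this, zero_mul, zero_mul]
  have hvn : ‖v‖ ≤ 1 := by
    have hp : IsStarProjection (star v * v) := by
      refine ⟨?_, .star_mul_self v⟩
      change _ * _ = _
      rw [mul_assoc, ← mul_assoc v, hv]
    rw [← sq_le_one_iff₀ (norm_nonneg _), sq, ← CStarRing.norm_star_mul_self]
    exact hp.norm_le
  have hfn : ‖1 - v * star v‖ ≤ 1 := by
    have hp : IsStarProjection (v * star v) := by
      refine ⟨?_, .mul_star_self v⟩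
      change _ * _ = _
      rw [← mul_assoc, hv]
    exact hp.one_sub.norm_le
  have n1 : ‖y * v‖ ≤ 2 * σ * ‖x‖ := by
    have e1 : y * v = y * ((K - k) * v - (K * v - v)) := by
      simp only [mul_sub, sub_mul, ← mul_assoc, hyk]
      simp
    have m1 : ‖(K - k) * v‖ ≤ σ * 1 := (norm_mul_le _ _).trans (by gcongr)
    have m2 := norm_sub_le ((K - k) * v) (K * v - v)
    rw [e1]
    refine (norm_mul_le _ _).trans ?_
    calc ‖y‖ * ‖(K - k) * v - (K * v - v)‖ ≤ ‖x‖ * (2 * σ) := by gcongr; linarith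
      _ = 2 * σ * ‖x‖ := by ring
  have n2 : ‖v * y‖ ≤ 2 * σ * ‖x‖ := by
    have h1 : ‖v * K' - v‖ ≤ σ := by
      rw [← norm_star, star_sub, star_mul, hK'.star_eq]
      exact h'
    have e1 : v * y = (v * (K' - k') - (v * K' - v)) * y := by
      simp only [mul_sub, sub_mul, mul_assoc, hky]
      simp
    have m1 : ‖v * (K' - k')‖ ≤ 1 * σ := (norm_mul_le _ _).trans (by gcongr)
    have m2 := norm_sub_le (v * (K' - k')) (v * K' - v)
    rw [e1]
    refine (norm_mul_le _ _).trans ?_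
    have m3 : ‖v * (K' - k') - (v * K' - v)‖ ≤ 2 * σ := by linarith
    gcongr
  have hvs : ‖star v‖ ≤ 1 := by rwa [norm_star]
  have e2 : (1 - star v * v) * y * (1 - v * star v) - y =
      - (star v * (v * y) * (1 - v * star v)) - y * v * star v := by
    simp only [mul_sub, sub_mul, mul_one, one_mul, ← mul_assoc]
    abel
  rw [← hy, e2]
  have n3 : ‖star v * (v * y) * (1 - v * star v)‖ ≤ 2 * σ * ‖x‖ := (norm_corner_le hvs hfn).trans n2
  have n4 : ‖y * v * star v‖ ≤ 2 * σ * ‖x‖ :=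
    (norm_mul_le _ _).trans ((mul_le_of_le_one_right (norm_nonneg _) hvs).trans n1)
  refine (norm_sub_le _ _).trans ?_
  rw [norm_neg]
  linarith

theorem mem_closure_isUnit [PartialOrder A] [StarOrderedRing A]
    (hs : IsSimpleCStar A) (hA : InClassC1 A) (x : A) : x ∈ closure {x : A | IsUnit x} := by
  have := hs.1
  by_cases hx : IsUnit x
  · exact subset_closure hx
  -- If `x⋆x` or `xx⋆` were invertible, `x` would have a one-sided inverse and hence, by direct
  -- finiteness, be a unit.
  have hx1 : ¬ IsUnit (star x * x) := fun h => hx <| by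
    obtain ⟨s, hs'⟩ := h
    have h1 : ((s⁻¹ : Aˣ) : A) * star x * x = 1 := by rw [mul_assoc, ← hs', Units.inv_mul]
    exact ⟨⟨x, _, mul_eq_one_of_mul_eq_one hs hA h1, h1⟩, rfl⟩
  have hx2 : ¬ IsUnit (star (star x) * star x) := fun h => hx <| by
    obtain ⟨s, hs'⟩ := h
    rw [star_star] at hs'
    have h1 : x * (star x * ((s⁻¹ : Aˣ) : A)) = 1 := by rw [← mul_assoc, ← hs', Units.mul_inv]
    exact ⟨⟨x, _, h1, mul_eq_one_of_mul_eq_one hs hA h1⟩, rfl⟩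
  refine Metric.mem_closure_iff.2 fun r hr => ?_
  obtain ⟨k, k₂, u, hk, hk₂, hu, hkn, hkk, hk0, huk, hun, hxu⟩ := exists_cut hx1 (ε := r / 8)
    (by positivity)
  obtain ⟨k', k₂', u', hk', hk₂', hu', hkn', hkk', hk0', huk', hun', hxu'⟩ :=
    exists_cut hx2 (ε := r / 8) (by positivity)
  obtain ⟨n, a, b, hab⟩ := hs.exists_sum_eq_one hk0
  obtain ⟨n', a', b', hab'⟩ := hs.exists_sum_eq_one hk0'
  have pos_of_sum : ∀ {n : ℕ} {k : A} {a b : Fin n → A}, ∑ i, a i * k * b i = 1 → 0 < n :=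
    fun {n k a b} h => by
      rcases Nat.eq_zero_or_pos n with rfl | hn
      · simp at h
      · exact hn
  obtain ⟨σ, hσ0, hσ1, hσr⟩ : ∃ σ : ℝ, 0 < σ ∧ σ ≤ 1 ∧ 4 * σ * ‖x‖ ≤ r / 4 := by
    refine ⟨min 1 (r / (16 * (‖x‖ + 1))), lt_min one_pos (by positivity), min_le_left _ _, ?_⟩
    calc 4 * min 1 (r / (16 * (‖x‖ + 1))) * ‖x‖ ≤ 4 * (r / (16 * (‖x‖ + 1))) * (‖x‖ + 1) := by
          gcongr
          · exact min_le_right _ _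
          · linarith
      _ = r / 4 := by field_simp; norm_num
  -- Chosen so that the error `√(7τ)` of the partial isometry equals `σ`.
  obtain ⟨τ, hτ⟩ : ∃ τ, τ = σ ^ 2 / 7 := ⟨_, rfl⟩
  have hτ0 : 0 < τ := by rw [hτ]; positivity
  have hτ1 : 2 * τ < 1 := by rw [hτ]; nlinarith
  have hτσ : √(7 * τ) = σ := by
    rw [hτ, mul_div_cancel₀ _ (by norm_num), Real.sqrt_sq hσ0.le]
  have ev1 := eventually_exists_subspace (pos_of_sum hab) hk hk₂ hkn hkk hab hτ0 hσ0
  have ev2 := eventually_exists_subspace (pos_of_sum hab') hk' hk₂' hkn' hkk' hab' hτ0 hσ0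
  obtain ⟨s, hs1, hs2⟩ : ∃ s : (Fin 2 ⊕ Fin n ⊕ Fin n) ⊕ (Fin 2 ⊕ Fin n' ⊕ Fin n') → A,
      s ∘ Sum.inl = Sum.elim (![k, k₂] : Fin 2 → A) (Sum.elim a b) ∧
      s ∘ Sum.inr = Sum.elim (![k', k₂'] : Fin 2 → A) (Sum.elim a' b') :=
    ⟨Sum.elim _ _, Sum.elim_comp_inl _ _, Sum.elim_comp_inr _ _⟩
  rw [← hs1] at ev1
  rw [← hs2] at ev2
  have hc1 : Continuous fun v : (Fin 2 ⊕ Fin n ⊕ Fin n) ⊕ (Fin 2 ⊕ Fin n' ⊕ Fin n') → A =>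
    v ∘ Sum.inl := continuous_pi fun i => continuous_apply _
  have hc2 : Continuous fun v : (Fin 2 ⊕ Fin n ⊕ Fin n) ⊕ (Fin 2 ⊕ Fin n' ⊕ Fin n') → A =>
    v ∘ Sum.inr := continuous_pi fun i => continuous_apply _
  -- A single model serves both sides, so its rank must dominate both numbers of translates.
  obtain ⟨M, hM, -, v, hv1, hv2⟩ := exists_tracialModel hA ((n + n') * 5) s
    ((hc1.continuousAt.eventually ev1).and (hc2.continuousAt.eventually ev2)) (zero_le_one' A)
    one_ne_zero
  obtain ⟨K, hK, hKn, hKk, hS⟩ := hv1 M (v ∘ Sum.inl) (fun _ => rfl) fun t =>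
    le_trans (by nlinarith) (hM t)
  obtain ⟨K', hK', hKn', hKk', hS'⟩ := hv2 M (v ∘ Sum.inr) (fun _ => rfl) fun t =>
    le_trans (by nlinarith) (hM t)
  -- The order of the arguments puts the range of `w` near `K` and that of `w⋆` near `K'`, as
  -- `norm_cut_sub_le` requires.
  obtain ⟨w, u₁, u₂, hww, hw, hu₁, hu₂, h12, hsum, hu₁0, hu₂0, hl, hr'⟩ :=
    M.exists_partialIsometry hK' hK hτ0 hτ1 hKn' hKn hS' hS
  rw [hτσ] at hl hr'
  have coe : ∀ {a b : M.B}, a = b → (a : A) = b := fun h => congrArg _ h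
  have proj : ∀ {a : M.B}, IsStarProjection a → IsStarProjection (a : A) := fun h =>
    ⟨coe h.isIdempotentElem, coe h.isSelfAdjoint⟩
  have hcl := mem_closure_isUnit_of_partialIsometry hs hA (x := u' * x * u) (v := (w : A))
    (u₁ := (u₁ : A)) (u₂ := (u₂ : A)) (coe hww) (coe hw) (proj hu₁) (proj hu₂) (coe h12) (coe hsum)
    (fun h => hu₁0 (Subtype.ext h)) (fun h => hu₂0 (Subtype.ext h))
  have hn := norm_cut_sub_le (x := x) (v := (w : A)) (K := (K : A)) (K' := (K' : A)) (coe hw) hu'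
    huk huk' hk' hun hun' (coe hK') hKk hKk' hr' hl
  obtain ⟨g, hg, hgd⟩ := Metric.mem_closure_iff.1 hcl (r / 4) (by positivity)
  refine ⟨g, hg, ?_⟩
  have n1 : ‖u' * x * u - x‖ ≤ r / 4 := by
    have e1 : u' * x * u - x = u' * (x * u - x) + (u' * x - x) := by
      rw [mul_sub, ← mul_assoc]; abel
    have m1 : ‖u' * (x * u - x)‖ ≤ 1 * (r / 8) := (norm_mul_le _ _).trans (by gcongr)
    have m2 : ‖u' * x - x‖ ≤ r / 8 := by
      rw [← norm_star, star_sub, star_mul, hu'.star_eq]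
      exact hxu'
    rw [e1]
    refine (norm_add_le _ _).trans ?_
    linarith
  have d1 := dist_triangle x (u' * x * u) g
  have d2 := dist_triangle (u' * x * u)
    ((1 - star (w : A) * w) * (u' * x * u) * (1 - w * star (w : A))) g
  have k1 : dist x (u' * x * u) ≤ r / 4 := by
    rw [dist_comm, dist_eq_norm]; exact n1
  have k2 : dist (u' * x * u) ((1 - star (w : A) * w) * (u' * x * u) * (1 - w * star (w : A))) ≤
      r / 4 := by
    rw [dist_comm, dist_eq_norm]; exact hn.trans hσr
  linarith

end
end TracialAH

theorem mainTheorem6 {A : Type*} [CStarAlgebra A] [PartialOrder A] [StarOrderedRing A]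
    (hsimple : TracialAH.IsSimpleCStar A) (hA : TracialAH.InClassC1 A) :
    TracialAH.HasStableRankOne A :=
  fun x => TracialAH.mem_closure_isUnit hsimple hA x
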